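/- Let $\Omega\subset\mathbb R^2$ be an open convex set. A *network with two triple junctions* in $\Omega$ is a connected set $\mathbb S=\bigcup_{i=1}^n\sigma^i([0,1])$ given by finitely many regular $C^1$ curves $\sigma^i:[0,1]\to\overline\Omega$ such that: no curve has a self-intersection, except that its two ends may coincide; two different curves meet only at their ends; there are exactly two points $O^1\ne O^2$ in $\Omega$ (the triple junctions) at each of which exactly three ends of curves concur (a closed curve counting with both its ends); every other end of a curve lies on $\partial\Omega$ and is not an end of any other curve; a curve touches $\partial\Omega$ only at its ends, and at one of them at most. The network is *regular* if at each $O^p$ the exterior unit tangent vectors of the three concurring curves sum up to zero. For $T\in(0,+\infty]$, a *motion by curvature* with fixed end-points on $[0,T)$ of a regular $C^2$ network $\mathbb S_0=\bigcup_i\sigma^i([0,1])$ is a family of regular networks $\mathbb S_t=\bigcup_i\gamma^i([0,1],t)$, $t\in[0,T)$, in $\Omega$ with two triple junctions and with the same combinatorial structure as $\mathbb S_0$, where the maps $\gamma^i:[0,1]\times[0,T)\to\overline\Omega$ are continuous, are $C^2$ in space and $C^1$ in time on $[0,1]\times(0,T)$, satisfy $\gamma^i(\cdot,0)=\sigma^i$,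 keep fixed the ends on $\partial\Omega$, and satisfy $\gamma^i_t=k^i\nu^i+\lambda^i\tau^i$ on $[0,1]\times(0,T)$ for some continuous functions $\lambda^i$; here $\tau^i$, $\nu^i$, $k^i$ are the unit tangent, the unit normal and the curvature of $\gamma^i(\cdot,t)$. **Proposition.** Let $\mathbb S_t$, $t\in[0,T)$, be a motion by curvature of a regular $C^2$ network $\mathbb S_0$ with two triple junctions in $\Omega$ (for instance the smooth one on its maximal time interval $[0,T)$), with $0<T\le+\infty$. Suppose that $\mathbb S_0$ has a loop, that is, it contains a Jordan curve $\ell$, and let $A(0)$ be the area of the region enclosed by $\ell$. Then $\ell$ is the union of $m\in\{1,2\}$ of the curves $\sigma^i$, $i\in J$, and, denoting by $L(t)$ the length of the loop at time $t$, that is, the sum of the lengths of the $m$ curves $\gamma^i(\cdot,t)$, $i\in J$: 1. $T$ is finite and $$T\le\frac{3A(0)}{(6-m)\pi};$$ 2. for every $t\in[0,T)$, $$\int_{\mathbb S_t}k^2\,ds\ \ge\ \frac{(6-m)^2\pi^2}{9L(t)};$$ 3. if $\lim_{t\to T}L(t)=0$, then $\lim_{t\to T}\int_{\mathbb S_t}k^2\,ds=+\infty$.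 -/

import Mathlib

open Set Filter Topology MeasureTheory

noncomputable section

namespace CurveNetwork

/-! The Euclidean plane is `ℂ`, with its real inner product, its Lebesgue measure, and the
counterclockwise rotation by a right angle given by multiplication by `Complex.I`.
A parametrized curve is a map `σ : ℝ → ℂ` of which only the restriction to `[0,1]` matters;
all derivatives in the space parameter are one-sided at `0` and `1`. -/

/-- The derivative `σ_x`. -/
def velocity (σ : ℝ → ℂ) (x : ℝ) : ℂ := derivWithin σ (Icc 0 1) x

/-- The unit tangent vector `τ = σ_x / |σ_x|`. -/
def unitTangent (σ : ℝ → ℂ) (x : ℝ) : ℂ := ‖velocity σ x‖⁻¹ • velocity σ x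

/-- The unit normal vector `ν = R τ`. -/
def unitNormal (σ : ℝ → ℂ) (x : ℝ) : ℂ := Complex.I * unitTangent σ x

/-- The curvature vector `τ_x / |σ_x|`. -/
def curvatureVector (σ : ℝ → ℂ) (x : ℝ) : ℂ :=
  ‖velocity σ x‖⁻¹ • derivWithin (unitTangent σ) (Icc 0 1) x

/-- The (signed) curvature `k`, the component of the curvature vector along `ν`. -/
def curvature (σ : ℝ → ℂ) (x : ℝ) : ℝ := inner ℝ (curvatureVector σ x) (unitNormal σ x)

/-- The length of a curve. -/
def length (σ : ℝ → ℂ) : ℝ := ∫ x in (0 : ℝ)..1, ‖velocity σ x‖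

/-- The integral of `k²` with respect to arclength along a curve. -/
def curveEnergy (σ : ℝ → ℂ) : ℝ := ∫ x in (0 : ℝ)..1, curvature σ x ^ 2 * ‖velocity σ x‖

/-- The integral of `k²` with respect to arclength over a family of curves. -/
def energy {n : ℕ} (σ : Fin n → ℝ → ℂ) : ℝ := ∑ i, curveEnergy (σ i)

/-- The set covered by a family of curves. -/
def support {n : ℕ} (σ : Fin n → ℝ → ℂ) : Set ℂ := ⋃ i, σ i '' Icc 0 1

/-- The parameter of an end of a curve: `false` is the end `x = 0`, `true` the end `x = 1`. -/
def endParam (b : Bool) : ℝ := if b then 1 else 0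

/-- The exterior unit tangent vector of a curve at one of its ends. -/
def exteriorTangent (σ : ℝ → ℂ) (b : Bool) : ℂ :=
  if b then unitTangent σ 1 else -unitTangent σ 0

/-- `σ` is a network in `Ω` with exactly the two triple junctions `O 0` and `O 1`.
The map `v` records the combinatorics: the end `(i, b)` of the curve `i` is at the triple
junction `O p` if `v (i, b) = some p`, and is an end-point of the network, on the boundary of
`Ω`, if `v (i, b) = none`. -/
structure IsNetwork (Ω : Set ℂ) {n : ℕ} (v : Fin n × Bool → Option (Fin 2)) (O : Fin 2 → ℂ)
    (σ : Fin n → ℝ → ℂ) : Prop where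
  contDiffOn : ∀ i, ContDiffOn ℝ 1 (σ i) (Icc 0 1)
  velocity_ne_zero : ∀ i, ∀ x ∈ Icc (0 : ℝ) 1, velocity (σ i) x ≠ 0
  mapsTo : ∀ i, MapsTo (σ i) (Icc 0 1) (closure Ω)
  connected : IsConnected (support σ)
  /-- A curve has no self-intersection, except that it may close up at its ends. -/
  embedded : ∀ i, ∀ x ∈ Icc (0 : ℝ) 1, ∀ y ∈ Icc (0 : ℝ) 1, x < y → σ i x = σ i y →
    x = 0 ∧ y = 1
  /-- Two different curves meet only at their ends. -/
  inter : ∀ i j, i ≠ j → ∀ x ∈ Icc (0 : ℝ) 1, ∀ y ∈ Icc (0 : ℝ) 1, σ i x = σ j y →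
    (x = 0 ∨ x = 1) ∧ (y = 0 ∨ y = 1)
  junction_ne : O 0 ≠ O 1
  junction_mem : ∀ p, O p ∈ Ω
  junction_eq : ∀ i b p, v (i, b) = some p → σ i (endParam b) = O p
  /-- Three ends of curves concur at each triple junction (a closed curve counts twice). -/
  junction_card : ∀ p, (Finset.univ.filter fun e : Fin n × Bool => v e = some p).card = 3
  endpoint_mem : ∀ i b, v (i, b) = none → σ i (endParam b) ∈ frontier Ω
  endpoint_unique : ∀ i b, v (i, b) = none → ∀ j c, (j, c) ≠ (i, b) →
    σ j (endParam c) ≠ σ i (endParam b)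
  /-- A curve touches the boundary of `Ω` only at its ends, and at one of them at most. -/
  boundary_end : ∀ i, ∀ x ∈ Icc (0 : ℝ) 1, σ i x ∈ frontier Ω → x = 0 ∨ x = 1
  boundary_one : ∀ i, ¬(v (i, false) = none ∧ v (i, true) = none)

/-- The Herring condition: at each triple junction the exterior unit tangent vectors of the three
concurring curves sum up to zero. -/
def Herring {n : ℕ} (v : Fin n × Bool → Option (Fin 2)) (σ : Fin n → ℝ → ℂ) : Prop :=
  ∀ p : Fin 2, ∑ e : Fin n × Bool with v e = some p, exteriorTangent (σ e.1) e.2 = 0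

/-- The pairs (time, space parameter) in `(0,T) × [0,1]`. -/
def openCylinder (T : EReal) : Set (ℝ × ℝ) :=
  {q | 0 < q.1 ∧ (q.1 : EReal) < T ∧ q.2 ∈ Icc (0 : ℝ) 1}

/-- The family `γ t i` (time `t`, curve `i`) is a solution in the time interval `[0,T)`, where
`0 < T ≤ ∞`, of the motion by curvature with fixed end-points in `Ω`, starting from the regular
`C²` network `γ 0`; the triple junctions at time `t` are `O t 0` and `O t 1`, and `v` is the
combinatorics of the network, constant in time. -/
structure IsCurvatureFlow (Ω : Set ℂ) (T : EReal) {n : ℕ} (v : Fin n × Bool → Option (Fin 2))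
    (O : ℝ → Fin 2 → ℂ) (γ : ℝ → Fin n → ℝ → ℂ) : Prop where
  network : ∀ t : ℝ, 0 ≤ t → (t : EReal) < T → IsNetwork Ω v (O t) (γ t)
  herring : ∀ t : ℝ, 0 ≤ t → (t : EReal) < T → Herring v (γ t)
  initial_contDiffOn : ∀ i, ContDiffOn ℝ 2 (γ 0 i) (Icc 0 1)
  continuousOn : ∀ i, ContinuousOn (fun q : ℝ × ℝ => γ q.1 i q.2)
    {q | 0 ≤ q.1 ∧ (q.1 : EReal) < T ∧ q.2 ∈ Icc (0 : ℝ) 1}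
  /-- `γ` is `C²` in space for positive times. -/
  contDiffOn : ∀ i, ∀ t : ℝ, 0 < t → (t : EReal) < T → ContDiffOn ℝ 2 (γ t i) (Icc 0 1)
  continuousOn_velocity : ∀ i,
    ContinuousOn (fun q : ℝ × ℝ => velocity (γ q.1 i) q.2) (openCylinder T)
  continuousOn_second : ∀ i,
    ContinuousOn (fun q : ℝ × ℝ => derivWithin (velocity (γ q.1 i)) (Icc 0 1) q.2)
      (openCylinder T)
  /-- `γ` is `C¹` in time for positive times. -/
  differentiableAt_time : ∀ i, ∀ q ∈ openCylinder T,
    DifferentiableAt ℝ (fun s => γ s i q.2) q.1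
  continuousOn_time : ∀ i,
    ContinuousOn (fun q : ℝ × ℝ => deriv (fun s => γ s i q.2) q.1) (openCylinder T)
  endpoint_fixed : ∀ i b, v (i, b) = none → ∀ t : ℝ, 0 ≤ t → (t : EReal) < T →
    γ t i (endParam b) = γ 0 i (endParam b)
  /-- Motion by curvature: `γ_t = k ν + λ τ` for some continuous functions `λ`. -/
  motion : ∃ lam : Fin n → ℝ × ℝ → ℝ, (∀ i, ContinuousOn (lam i) (openCylinder T)) ∧
    ∀ i, ∀ q ∈ openCylinder T, deriv (fun s => γ s i q.2) q.1 =
      curvature (γ q.1 i) q.2 • unitNormal (γ q.1 i) q.2 +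
        lam i q • unitTangent (γ q.1 i) q.2

/-- A Jordan curve: a homeomorphic image of the circle in the plane. -/
def IsJordanCurve (Γ : Set ℂ) : Prop :=
  ∃ f : Circle → ℂ, Continuous f ∧ Function.Injective f ∧ range f = Γ

/-- The region enclosed by `Γ`: the bounded connected components of the complement. -/
def enclosedRegion (Γ : Set ℂ) : Set ℂ :=
  {z | z ∉ Γ ∧ Bornology.IsBounded (connectedComponentIn Γᶜ z)}

/-- The area of the region enclosed by `Γ`. -/
def enclosedArea (Γ : Set ℂ) : ℝ := volume.real (enclosedRegion Γ)

end CurveNetwork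

end

open Set Filter Topology MeasureTheory

noncomputable section

/-! Traversed once, the loop is a piecewise C² simple closed curve with m corners. Three unit
vectors with zero sum make angles 2π/3, so each exterior angle is π/3 in absolute value. By the
theorem of turning tangents the whole turning, corners included, is 2πρ with ρ = ±1. Hence the total
curvature K of the arcs satisfies ρK ≥ 2π − mπ/3 = (6 − m)π/3
(`IsArcLoop.abs_sum_totalCurvature_sub_le`, `IsCurvatureFlow.exists_rotation`). Since K² ≤ L ∫k² by
Cauchy–Schwarz, this is the energy bound, and it forces blow-up when L tends to 0. Along the flow
the signed area S of the loop satisfies S' = −K (`IsCurvatureFlow.hasDerivAt_loopArea`). As S and K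
have the same sign, |S| decreases at rate at least (6 − m)π/3, and the initial area bounds the
lifetime.

The turning theorem is proved as by Hopf, by following the argument of the secants G(t) − G(s) over
the convex strip s < t < s + P (`SimpleClosed.exists_isSecantLog`). The same logarithm shows that
winding numbers are 0 or ρ: the point is moved straight to the nearest point of the curve
(`SimpleClosed.winding_mem`). The signed area is the integral of the winding number: Cauchy
integrals are integrated over a large disc, using Fubini and the Cauchy transform of the disc
(`integral_cauchyIntegral`). So 0 ≤ ρS, and ρS is at most the area of any set of finite measure that
contains all points of nonzero winding number. The Jordan curve theorem is not needed, only that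
nonzero winding number implies a bounded component.

Two points need care. The sign ρ is chosen separately at each time, with no continuity in time;
`mul_sub_le_abs` copes with this by showing that S never vanishes. At time 0 the curves converge
uniformly but their velocities need not, so the initial area is reached through winding numbers:
away from a thin neighbourhood of the initial loop they are unchanged for small times
(`IsCurvatureFlow.abs_loopArea_le`).

That a Jordan curve in the network is one closed curve or two arcs between the junctions is pure
connectedness: one point does not separate a circle, two points do (`IsNetwork.exists_loop`). -/

/-! ### Continuous logarithms -/

/-- A nonvanishing continuous function on a convex set has a continuous logarithm. -/
lemma Convex.exists_continuousOn_log {E : Type*} [NormedAddCommGroup E] [NormedSpace ℝ E]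
    {S : Set E} (hS : Convex ℝ S) {f : E → ℂ} (hf : ContinuousOn f S) (h0 : ∀ x ∈ S, f x ≠ 0) :
    ∃ φ : E → ℂ, ContinuousOn φ S ∧ ∀ x ∈ S, Complex.exp (φ x) = f x := by
  classical
  rcases S.eq_empty_or_nonempty with rfl | hne
  · exact ⟨fun _ => 0, by simp, by simp⟩
  have := hS.locallyPathConnectedSpace
  have := hS.contractibleSpace hne
  obtain ⟨x₀, hx₀⟩ := hne
  -- The exponential is a covering of the punctured plane, and a convex set is contractible and
  -- locally path connected, so `f` lifts once the value over one point is fixed.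
  rcases Complex.isCoveringMapOn_exp.existsUnique_continuousMap_lifts
    ⟨S.domRestrict f, continuousOn_iff_continuous_domRestrict.mp hf⟩
    (a₀ := ⟨x₀, hx₀⟩) (Complex.exp_log (h0 x₀ hx₀))
    (fun x ↦ h0 x x.2) with ⟨F, ⟨-, hF⟩, -⟩
  obtain ⟨g, hg⟩ : ∃ g : E → ℂ, ∀ z : S, g z = F z :=
    ⟨fun z ↦ if hz : z ∈ S then F ⟨z, hz⟩ else 0, by simp⟩
  refine ⟨g, ?_, ?_⟩
  · rw [continuousOn_iff_continuous_domRestrict]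
    convert! map_continuous F
    ext z
    exact hg z
  · intro x hx
    lift x to S using hx
    simpa [hg] using congr($hF x)

section Preconnected

variable {X : Type*} [TopologicalSpace X] {S : Set X}

/-- A continuous function with constant exponential is constant on a preconnected set. -/
lemma IsPreconnected.eq_of_exp_eq (hS : IsPreconnected S) {χ : X → ℂ} (hχ : ContinuousOn χ S)
    (h : ∀ x ∈ S, ∀ y ∈ S, Complex.exp (χ x) = Complex.exp (χ y)) :
    ∀ x ∈ S, ∀ y ∈ S, χ x = χ y := by
  intro x hx y hy
  -- The values lie in a coset of 2πiℤ; a countable set is totally disconnected, while the image of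
  -- `S` is preconnected.
  have hc : (χ '' S).Countable := by
    refine (countable_range fun n : ℤ => χ x + n * (2 * Real.pi * Complex.I)).mono ?_
    rintro _ ⟨z, hz, rfl⟩
    obtain ⟨n, hn⟩ := Complex.exp_eq_exp_iff_exists_int.1 (h z hz x hx)
    exact ⟨n, hn.symm⟩
  exact hc.isTotallyDisconnected _ subset_rfl (hS.image χ hχ) (mem_image_of_mem _ hx) (mem_image_of_mem _ hy)

/-! ### How far the argument can sweep. -/

lemma exists_cos_add_eq_zero (b α : ℝ) : ∃ θ ∈ Icc b (b + Real.pi), Real.cos (θ + α) = 0 := by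
  have hc : ContinuousOn (fun θ => Real.cos (θ + α)) (uIcc b (b + Real.pi)) := by fun_prop
  have h := intermediate_value_uIcc hc
  have e : Real.cos (b + Real.pi + α) = - Real.cos (b + α) := by
    rw [show b + Real.pi + α = b + α + Real.pi by ring, Real.cos_add_pi]
  have : (0 : ℝ) ∈ uIcc (Real.cos (b + α)) (Real.cos (b + Real.pi + α)) := by
    rw [e, mem_uIcc]
    rcases le_total 0 (Real.cos (b + α)) with h | h
    · right; constructor <;> linarith
    · left; constructor <;> linarith
  obtain ⟨θ, hθ, h0⟩ := h this
  rw [uIcc_of_le (by linarith [Real.pi_pos])] at hθ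
  exact ⟨θ, hθ, h0⟩

lemma re_exp_mul (w a : ℂ) : (Complex.exp w * a).re =
    Real.exp w.re * ‖a‖ * Real.cos (w.im + a.arg) := by
  conv_lhs => rw [← Complex.norm_mul_exp_arg_mul_I a]
  rw [show Complex.exp w * (‖a‖ * Complex.exp (a.arg * Complex.I)) =
    ‖a‖ * (Complex.exp (w + a.arg * Complex.I)) by rw [Complex.exp_add]; ring]
  rw [Complex.re_ofReal_mul, Complex.exp_re]
  simp
  ring

section Sweep

variable {φ : X → ℂ} {a : ℂ}

/-- Every interval of length π contains a zero of cos(θ + arg a), so by the intermediate value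
theorem a sweep of π or more would leave the open half-plane. -/
lemma IsPreconnected.abs_im_sub_lt_pi (hS : IsPreconnected S) (hφ : ContinuousOn φ S)
    (h : ∀ x ∈ S, 0 < (Complex.exp (φ x) * a).re) :
    ∀ x ∈ S, ∀ y ∈ S, |(φ x).im - (φ y).im| < Real.pi := by
  have hc : ContinuousOn (fun x => (φ x).im) S := Complex.continuous_im.comp_continuousOn hφ
  have key : ∀ x ∈ S, ∀ y ∈ S, (φ y).im - (φ x).im < Real.pi := by
    intro x hx y hy
    by_contra! hlt
    obtain ⟨θ, hθ, h0⟩ := exists_cos_add_eq_zero (φ x).im a.arg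
    obtain ⟨z, hz, rfl⟩ := hS.intermediate_value hx hy hc (⟨hθ.1, by linarith [hθ.2]⟩ : θ ∈ Icc _ _)
    have := h z hz
    rw [re_exp_mul, h0] at this
    simp at this
  intro x hx y hy
  rw [abs_lt]
  constructor <;> linarith [key x hx y hy, key y hy x hx]

lemma IsPreconnected.abs_im_sub_le_pi (hS : IsPreconnected S) (hφ : ContinuousOn φ S)
    (ha : a ≠ 0) (h : ∀ x ∈ S, 0 ≤ (Complex.exp (φ x) * a).re) :
    ∀ x ∈ S, ∀ y ∈ S, |(φ x).im - (φ y).im| ≤ Real.pi := by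
  have hc : ContinuousOn (fun x => (φ x).im) S := Complex.continuous_im.comp_continuousOn hφ
  have key : ∀ x ∈ S, ∀ y ∈ S, (φ y).im - (φ x).im ≤ Real.pi := by
    intro x hx y hy
    by_contra! hlt
    have hcos : ∀ θ ∈ Icc (φ x).im (φ y).im, 0 ≤ Real.cos (θ + a.arg) := by
      intro θ hθ
      obtain ⟨z, hz, rfl⟩ := hS.intermediate_value hx hy hc hθ
      have := h z hz
      rw [re_exp_mul] at this
      exact nonneg_of_mul_nonneg_right this (by have := norm_pos_iff.2 ha; positivity)
    -- A shift by π changes the sign of the cosine, so on the part of the interval whose shift is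
    -- still inside, the cosine is both ≥ 0 and ≤ 0. Two of its zeros at distance ε ≤ 1 < π then
    -- give sin ε = 0.
    have hzero : ∀ θ ∈ Icc (φ x).im ((φ y).im - Real.pi), Real.cos (θ + a.arg) = 0 := by
      intro θ hθ
      have h1 := hcos θ ⟨hθ.1, by linarith [hθ.2, Real.pi_pos]⟩
      have h2 := hcos (θ + Real.pi) ⟨by linarith [hθ.1, Real.pi_pos], by linarith [hθ.2]⟩
      rw [show θ + Real.pi + a.arg = θ + a.arg + Real.pi by ring, Real.cos_add_pi] at h2
      linarith
    set ε := min ((φ y).im - Real.pi - (φ x).im) 1 with hε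
    have hε0 : 0 < ε := lt_min (by linarith) one_pos
    have hε1 : ε ≤ 1 := min_le_right _ _
    have e1 := hzero (φ x).im ⟨le_rfl, by linarith⟩
    have e2 := hzero ((φ x).im + ε)
      ⟨by linarith, by linarith [min_le_left ((φ y).im - Real.pi - (φ x).im) 1]⟩
    have : Real.sin (((φ x).im + ε + a.arg) - ((φ x).im + a.arg)) = 0 := by
      rw [Real.sin_sub, e1, e2]; ring
    rw [show ((φ x).im + ε + a.arg) - ((φ x).im + a.arg) = ε by ring] at this
    exact (Real.sin_pos_of_pos_of_lt_pi hε0 (by linarith [Real.pi_gt_three])).ne' this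
  intro x hx y hy
  rw [abs_le]
  constructor <;> linarith [key x hx y hy, key y hy x hx]

/-- A sweep of 2π would cross the line Re(wa) = 0 at two arguments π apart, hence at two different
points of `S`. It serves a short piece of curve that is monotone in one direction and so crosses
that line at most once. -/
lemma IsPreconnected.abs_im_sub_lt_two_pi (hS : IsPreconnected S) (hφ : ContinuousOn φ S)
    (h : ∀ x ∈ S, ∀ y ∈ S, (Complex.exp (φ x) * a).re = 0 → (Complex.exp (φ y) * a).re = 0 → x = y) :
    ∀ x ∈ S, ∀ y ∈ S, |(φ x).im - (φ y).im| < 2 * Real.pi := by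
  have hc : ContinuousOn (fun x => (φ x).im) S := Complex.continuous_im.comp_continuousOn hφ
  have key : ∀ x ∈ S, ∀ y ∈ S, (φ y).im - (φ x).im < 2 * Real.pi := by
    intro x hx y hy
    by_contra! hlt
    obtain ⟨θ, hθ, h0⟩ := exists_cos_add_eq_zero (φ x).im a.arg
    have h0' : Real.cos (θ + Real.pi + a.arg) = 0 := by
      rw [show θ + Real.pi + a.arg = θ + a.arg + Real.pi by ring, Real.cos_add_pi, h0, neg_zero]
    have hpi := Real.pi_pos
    obtain ⟨z, hz, hzθ⟩ := hS.intermediate_value hx hy hc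
      (⟨hθ.1, by linarith [hθ.2]⟩ : θ ∈ Icc _ _)
    obtain ⟨z', hz', hzθ'⟩ := hS.intermediate_value hx hy hc
      (⟨by linarith [hθ.1], by linarith [hθ.2]⟩ : θ + Real.pi ∈ Icc _ _)
    have hzz := h z hz z' hz' (by rw [re_exp_mul]; simp only at hzθ; rw [hzθ, h0, mul_zero])
      (by rw [re_exp_mul]; simp only at hzθ'; rw [hzθ', h0', mul_zero])
    subst hzz
    linarith
  intro x hx y hy
  rw [abs_lt]
  constructor <;> linarith [key x hx y hy, key y hy x hx]

end Sweep

/-- The variation of a continuous logarithm of a differentiable function. -/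
lemma log_sub_log_eq_integral {p q φ : ℝ → ℂ} (hp : ∀ x ∈ Icc (0 : ℝ) 1,
    HasDerivWithinAt p (q x) (Icc 0 1) x) (hq : ContinuousOn q (Icc 0 1))
    (h0 : ∀ x ∈ Icc (0 : ℝ) 1, p x ≠ 0)
    (hφ : ContinuousOn φ (Icc 0 1)) (hφp : ∀ x ∈ Icc (0 : ℝ) 1, Complex.exp (φ x) = p x) :
    φ 1 - φ 0 = ∫ x in (0 : ℝ)..1, q x / p x := by
  have hpc : ContinuousOn p (Icc 0 1) := fun x hx => (hp x hx).continuousWithinAt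
  have hr : ContinuousOn (fun x => q x / p x) (Icc 0 1) := hq.div hpc h0
  have hri : IntervalIntegrable (fun x => q x / p x) volume 0 1 :=
    (hr.mono (by rw [uIcc_of_le zero_le_one])).intervalIntegrable
  -- The primitive of q/p is a logarithm of p up to a constant, because p exp(−ψ) has zero
  -- derivative; two continuous logarithms differ by a constant.
  set ψ : ℝ → ℂ := fun x => ∫ y in (0 : ℝ)..x, q y / p y with hψ
  have hψd : ∀ x ∈ Icc (0 : ℝ) 1, HasDerivWithinAt ψ (q x / p x) (Icc 0 1) x := by
    intro x hx
    have : Fact (x ∈ Icc (0 : ℝ) 1) := ⟨hx⟩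
    refine intervalIntegral.integral_hasDerivWithinAt_right
      (hri.mono_set ?_) ?_ (hr x hx)
    · rw [uIcc_of_le hx.1, uIcc_of_le zero_le_one]; exact Icc_subset_Icc_right hx.2
    · exact hr.stronglyMeasurableAtFilter_nhdsWithin measurableSet_Icc x
  have hψc : ContinuousOn ψ (Icc 0 1) := fun x hx => (hψd x hx).continuousWithinAt
  have hconst : ∀ x ∈ Icc (0 : ℝ) 1, p x * Complex.exp (-ψ x) = p 0 * Complex.exp (-ψ 0) := by
    have hd : ∀ x ∈ Icc (0 : ℝ) 1,
        HasDerivWithinAt (fun x => p x * Complex.exp (-ψ x)) 0 (Icc 0 1) x := by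
      intro x hx
      have := (hp x hx).mul ((hψd x hx).neg.cexp)
      convert! this using 1
      field_simp [h0 x hx]
      ring
    refine constant_of_has_deriv_right_zero (fun x hx => (hd x hx).continuousWithinAt)
      fun x hx => ?_
    exact ((hd x (Ico_subset_Icc_self hx)).mono_of_mem_nhdsWithin
      (Icc_mem_nhdsGE_of_mem hx))
  have hψ0 : ψ 0 = 0 := by simp [hψ]
  have := isPreconnected_Icc.eq_of_exp_eq (hφ.sub hψc) (fun x hx y hy => by
    have e : ∀ x ∈ Icc (0 : ℝ) 1, Complex.exp (φ x - ψ x) = p 0 * Complex.exp (-ψ 0) := by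
      intro x hx
      rw [sub_eq_add_neg, Complex.exp_add, hφp x hx, hconst x hx]
    simp only [Pi.sub_apply]
    rw [e x hx, e y hy]) 1 (by simp) 0 (by simp)
  simp only [Pi.sub_apply, hψ0, sub_zero] at this
  rw [← this]
  ring_nf
  rfl

end Preconnected

/-! ### Simple closed curves -/

/-- A simple closed curve of period `P`, given as a periodic function, which near every parameter
is strictly monotone in some direction. -/
structure SimpleClosed (G : ℝ → ℂ) (P : ℝ) : Prop where
  pos : 0 < P
  cont : Continuous G
  periodic : ∀ t, G (t + P) = G t
  inj : ∀ s t, s < t → t < s + P → G s ≠ G t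
  cone : ∀ s, ∃ u : ℂ, ∃ δ > 0, ∀ a b, s - δ < a → a < b → b < s + δ →
    0 < ((G b - G a) * u).re

/-- The parameters of the proper secants of a closed curve of period `P`. -/
def secantStrip (P : ℝ) : Set (ℝ × ℝ) := {p | p.1 < p.2 ∧ p.2 < p.1 + P}

lemma convex_secantStrip (P : ℝ) : Convex ℝ (secantStrip P) := by
  rintro ⟨x1, x2⟩ ⟨h1, h2⟩ ⟨y1, y2⟩ ⟨h3, h4⟩ a b ha hb hab
  simp only at h1 h2 h3 h4
  simp only [secantStrip, Prod.smul_mk, Prod.mk_add_mk, smul_eq_mul, mem_ofPred_eq]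
  obtain rfl : b = 1 - a := by linarith
  rcases ha.eq_or_lt with rfl | ha
  · constructor <;> linarith
  constructor <;> nlinarith [mul_pos ha (sub_pos.2 h1), mul_pos ha (sub_pos.2 h2),
    mul_nonneg hb (sub_pos.2 h3).le, mul_nonneg hb (sub_pos.2 h4).le]

/-- `θ` is a continuous logarithm of the secants of the closed curve `G`; the argument of the
secants increases by `2 π ρ` as the end-points run once along the curve. -/
structure IsSecantLog (G : ℝ → ℂ) (P : ℝ) (θ : ℝ × ℝ → ℂ) (ρ : ℤ) : Prop where
  cont : ContinuousOn θ (secantStrip P)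
  exp : ∀ p ∈ secantStrip P, Complex.exp (θ p) = G p.2 - G p.1
  shift : ∀ p ∈ secantStrip P, θ (p.2, p.1 + P) = θ p + ρ * (Real.pi * Complex.I)

/-! ### Winding numbers. -/

/-- The number of turns of a closed curve around a point. -/
def HasWinding (G : ℝ → ℂ) (P : ℝ) (z : ℂ) (w : ℤ) : Prop :=
  ∃ φ : ℝ → ℂ, Continuous φ ∧ (∀ t, Complex.exp (φ t) = G t - z) ∧
    ∀ t, φ (t + P) = φ t + w * (2 * Real.pi * Complex.I)

lemma exists_hasWinding {G : ℝ → ℂ} {P : ℝ} (hG : Continuous G) (hP : ∀ t, G (t + P) = G t)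
    {z : ℂ} (hz : ∀ t, G t ≠ z) : ∃ w, HasWinding G P z w := by
  obtain ⟨φ, hφ, he⟩ := (convex_univ (𝕜 := ℝ) (E := ℝ)).exists_continuousOn_log
    (f := fun t => G t - z) (by fun_prop) (fun t _ => sub_ne_zero.2 (hz t))
  rw [continuousOn_univ] at hφ
  have he' : ∀ t, Complex.exp (φ t) = G t - z := fun t => he t trivial
  have h1 : ∀ t, Complex.exp (φ (t + P) - φ t) = 1 := by
    intro t
    rw [Complex.exp_sub, he', he', hP, div_self (sub_ne_zero.2 (hz t))]
  obtain ⟨w, hw⟩ := Complex.exp_eq_one_iff.1 (h1 0)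
  refine ⟨w, φ, hφ, he', fun t => ?_⟩
  have := (isPreconnected_univ (α := ℝ)).eq_of_exp_eq (χ := fun t => φ (t + P) - φ t)
    (by fun_prop) (fun x _ y _ => by rw [h1, h1]) t trivial 0 trivial
  rw [hw] at this
  linear_combination this

/-- Rouché's argument: the quotient of the two differences stays in the disc of radius 1 about 1,
hence in a half-plane, so its argument cannot change by a nonzero multiple of 2π over a period. -/
lemma HasWinding.eq_of_norm_lt {G G' : ℝ → ℂ} {P : ℝ} {z z' : ℂ} {w w' : ℤ}
    (h : HasWinding G P z w) (h' : HasWinding G' P z' w')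
    (hlt : ∀ t, ‖(G' t - z') - (G t - z)‖ < ‖G t - z‖) : w = w' := by
  obtain ⟨φ, hφ, he, hP⟩ := h
  obtain ⟨φ', hφ', he', hP'⟩ := h'
  have key := (isPreconnected_univ (α := ℝ)).abs_im_sub_lt_pi (φ := fun t => φ' t - φ t) (a := 1)
    (by fun_prop) (fun t _ => by
      have h0 : G t - z ≠ 0 := by
        intro h
        have := hlt t
        rw [h, norm_zero] at this
        exact absurd this (norm_nonneg _).not_gt
      have h1 : ‖(G' t - z') / (G t - z) - 1‖ < 1 := by
        rw [div_sub_one h0, norm_div, div_lt_one (norm_pos_iff.2 h0)]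
        exact hlt t
      rw [mul_one, Complex.exp_sub, he, he']
      have h2 := (Complex.abs_re_le_norm _).trans_lt h1
      rw [Complex.sub_re, Complex.one_re, abs_lt] at h2
      linarith [h2.1]) (0 + P) trivial 0 trivial
  simp only [hP, hP'] at key
  have e : (φ' 0 + w' * (2 * Real.pi * Complex.I) - (φ 0 + w * (2 * Real.pi * Complex.I))).im
      - (φ' 0 - φ 0).im = ((w' - w : ℤ) : ℝ) * (2 * Real.pi) := by
    simp; ring
  rw [e, abs_mul, abs_of_pos (by positivity : 0 < 2 * Real.pi)] at key
  have h3 : |((w' - w : ℤ) : ℝ)| < 1 := by nlinarith [Real.pi_pos]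
  have h4 : |w' - w| < 1 := by exact_mod_cast h3
  rw [Int.abs_lt_one_iff] at h4
  omega

lemma HasWinding.unique {G : ℝ → ℂ} {P : ℝ} {z : ℂ} {w w' : ℤ}
    (h : HasWinding G P z w) (h' : HasWinding G P z w') : w = w' := by
  refine h.eq_of_norm_lt h' fun t => ?_
  obtain ⟨φ, -, he, -⟩ := h
  rw [sub_self, norm_zero, ← he]
  exact norm_pos_iff.2 (Complex.exp_ne_zero _)

lemma HasWinding.ne {G : ℝ → ℂ} {P : ℝ} {z : ℂ} {w : ℤ} (h : HasWinding G P z w) (t : ℝ) :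
    G t ≠ z := by
  obtain ⟨φ, -, he, -⟩ := h
  rw [← sub_ne_zero, ← he]
  exact Complex.exp_ne_zero _

/-- A continuous periodic function attains its minimum. -/
lemma exists_forall_le_of_periodic {f : ℝ → ℝ} {P : ℝ} (hP : 0 < P) (hf : Continuous f)
    (hper : ∀ t, f (t + P) = f t) : ∃ s, ∀ t, f s ≤ f t := by
  obtain ⟨s, -, hs⟩ := isCompact_Icc.exists_isMinOn (nonempty_Icc.2 hP.le) hf.continuousOn
  refine ⟨s, fun t => ?_⟩
  obtain ⟨y, hy, hty⟩ := (show Function.Periodic f P from hper).exists_mem_Ico₀ hP t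
  rw [hty]
  exact hs (Ico_subset_Icc_self hy)

/-! ### Rotation number and winding numbers of a simple closed curve. -/

namespace SimpleClosed

variable {G : ℝ → ℂ} {P : ℝ} {θ : ℝ × ℝ → ℂ} {ρ : ℤ}

/-- The secant directions near a point lie in a half-plane. -/
lemma eventually_abs_im_sub_lt_pi (hG : SimpleClosed G P) (hθ : IsSecantLog G P θ ρ) (s : ℝ) :
    ∃ δ > 0, ∀ a, 0 < a → a < δ → |(θ (s - a, s)).im - (θ (s, s + a)).im| < Real.pi := by
  obtain ⟨u, δ, hδ, hu⟩ := hG.cone s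
  refine ⟨min δ P, lt_min hδ hG.pos, fun a ha haδ => ?_⟩
  have h1 := haδ.trans_le (min_le_left _ _)
  have h2 := haδ.trans_le (min_le_right _ _)
  have hpre : IsPreconnected (secantStrip P ∩ Ioo (s - δ) (s + δ) ×ˢ Ioo (s - δ) (s + δ)) :=
    ((convex_secantStrip P).inter ((convex_Ioo _ _).prod (convex_Ioo _ _))).isPreconnected
  refine hpre.abs_im_sub_lt_pi (hθ.cont.mono inter_subset_left) (a := u) ?_ _ ?_ _ ?_
  · rintro ⟨x, y⟩ ⟨hxy, hx, hy⟩
    rw [hθ.exp _ hxy]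
    exact hu x y hx.1 hxy.1 hy.2
  · simp only [secantStrip, mem_inter_iff, mem_ofPred_eq, mem_prod, mem_Ioo]
    refine ⟨⟨?_, ?_⟩, ⟨?_, ?_⟩, ?_, ?_⟩ <;> linarith
  · simp only [secantStrip, mem_inter_iff, mem_ofPred_eq, mem_prod, mem_Ioo]
    refine ⟨⟨?_, ?_⟩, ⟨?_, ?_⟩, ?_, ?_⟩ <;> linarith

/-- The rotation number of a simple closed curve is `±1`. -/
theorem exists_isSecantLog (hG : SimpleClosed G P) :
    ∃ θ ρ, IsSecantLog G P θ ρ ∧ (ρ = 1 ∨ ρ = -1) := by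
  have hP := hG.pos
  obtain ⟨θ, hθ, he⟩ := (convex_secantStrip P).exists_continuousOn_log
    (f := fun p => G p.2 - G p.1)
    (by have := hG.cont; fun_prop) (fun p hp => sub_ne_zero.2 (hG.inj _ _ hp.1 hp.2).symm)
  have hmaps : MapsTo (fun p : ℝ × ℝ => (p.2, p.1 + P)) (secantStrip P) (secantStrip P) :=
    fun p hp => ⟨hp.2, by simpa using hp.1⟩
  have hχ : ContinuousOn (fun p : ℝ × ℝ => θ (p.2, p.1 + P) - θ p) (secantStrip P) :=
    (hθ.comp (by fun_prop) hmaps).sub hθ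
  -- Exchanging the ends reverses the secant, so the increment is an odd multiple of πi.
  have hexp : ∀ p ∈ secantStrip P, Complex.exp (θ (p.2, p.1 + P) - θ p) = -1 := by
    intro p hp
    rw [Complex.exp_sub, he _ (hmaps hp), he _ hp, div_eq_iff
      (sub_ne_zero.2 (hG.inj _ _ hp.1 hp.2).symm)]
    simp only [hG.periodic]
    ring
  have h0 : ((0 : ℝ), P / 2) ∈ secantStrip P := ⟨by simp; linarith, by simp; linarith⟩
  obtain ⟨n, hn⟩ : ∃ n : ℤ, θ (P / 2, 0 + P) - θ (0, P / 2) =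
      Real.pi * Complex.I + n * (2 * Real.pi * Complex.I) := by
    rw [← Complex.exp_eq_exp_iff_exists_int, hexp _ h0, Complex.exp_pi_mul_I]
  have hlog : IsSecantLog G P θ (2 * n + 1) := by
    refine ⟨hθ, he, fun p hp => ?_⟩
    have := (convex_secantStrip P).isPreconnected.eq_of_exp_eq hχ
      (fun x hx y hy => by rw [hexp x hx, hexp y hy]) p hp _ h0
    simp only at this
    rw [hn] at this
    push_cast
    linear_combination this
  refine ⟨θ, _, hlog, ?_⟩
  -- At a leftmost point `s` all secants issuing from `s` lie in the closed right half-plane, so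
  -- they sweep at most π. From (s − a, s) to (s, s + a) the argument changes by less than π, since
  -- the directions near `s` lie in an open half-plane. Together |ρ|π < 2π, and ρ is odd.
  obtain ⟨s, hs⟩ := exists_forall_le_of_periodic hP (f := fun t => (G t).re)
    (Complex.continuous_re.comp hG.cont) (fun t => by simp only [hG.periodic])
  obtain ⟨δ, hδ, hlt⟩ := hG.eventually_abs_im_sub_lt_pi hlog s
  obtain ⟨a, ha, haδ⟩ := exists_between (lt_min hδ (half_pos hP))
  have h1 := hlt a ha (haδ.trans_le (min_le_left _ _))
  have haP := haδ.trans_le (min_le_right _ _)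
  have h2 : |(θ (s, s - a + P)).im - (θ (s, s + a)).im| ≤ Real.pi := by
    have hpre : IsPreconnected ({s} ×ˢ Ioo s (s + P)) :=
      ((convex_singleton s).prod (convex_Ioo _ _)).isPreconnected
    have hsub : ({s} ×ˢ Ioo s (s + P)) ⊆ secantStrip P := by
      rintro ⟨x, y⟩ ⟨rfl, hy⟩
      exact hy
    refine hpre.abs_im_sub_le_pi (hθ.mono hsub) one_ne_zero ?_ _ ?_ _ ?_
    · rintro ⟨x, y⟩ hxy
      rw [he _ (hsub hxy), mul_one]
      obtain ⟨rfl, -⟩ := hxy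
      simpa using hs y
    · simp only [mem_prod, mem_singleton_iff, mem_Ioo, true_and]; constructor <;> linarith
    · simp only [mem_prod, mem_singleton_iff, mem_Ioo, true_and]; constructor <;> linarith
  have h3 := congrArg Complex.im (hlog.shift (s - a, s) ⟨by simpa using ha, by simp; linarith⟩)
  have h4 : |((2 * n + 1 : ℤ) : ℝ)| < 2 := by
    simp only [Complex.add_im, Complex.mul_im, Complex.intCast_re, Complex.intCast_im,
      Complex.mul_re, Complex.ofReal_re, Complex.ofReal_im, Complex.I_re, Complex.I_im] at h3
    rw [abs_lt] at h1 ⊢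
    rw [abs_le] at h2
    constructor <;> nlinarith [Real.pi_pos]
  have h5 : |2 * n + 1| < 2 := by exact_mod_cast h4
  rw [abs_lt] at h5
  omega

/-- The winding number of a simple closed curve is `0` or its rotation number. -/
theorem winding_mem (hG : SimpleClosed G P) (hθ : IsSecantLog G P θ ρ) (hρ : ρ = 1 ∨ ρ = -1)
    {z : ℂ} {w : ℤ} (hw : HasWinding G P z w) : w = 0 ∨ w = ρ := by
  have hP := hG.pos
  have hGc := hG.cont
  have hz := hw.ne
  obtain ⟨s, hs⟩ := exists_forall_le_of_periodic hP (f := fun t => ‖G t - z‖)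
    (by fun_prop) (fun t => by simp only [hG.periodic])
  have hsz : 0 < ‖G s - z‖ := norm_pos_iff.2 (sub_ne_zero.2 (hz s))
  -- The point moves from `z` straight to the nearest point of the curve, which it meets only at r =
  -- 1.
  set zr : ℝ → ℂ := fun r => z + r * (G s - z) with hzr
  have hzr_ne : ∀ r, 0 ≤ r → r < 1 → ∀ t, G t ≠ zr r := by
    intro r hr0 hr1 t ht
    have := hs t
    simp only [ht, hzr, add_sub_cancel_left, norm_mul, Complex.norm_real, Real.norm_eq_abs,
      abs_of_nonneg hr0] at this
    nlinarith
  have hzr1 : zr 1 = G s := by simp [hzr]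
  have hzr0 : zr 0 = z := by simp [hzr]
  -- The rectangle [s, s + P] × [0, 1] without its corners (s, 1) and (s + P, 1), where G t − zr r
  -- vanishes. It is still convex, so a single logarithm covers r < 1 and r = 1.
  set M : Set (ℝ × ℝ) := {p | 0 ≤ p.2 ∧ p.2 ≤ 1 ∧ s ≤ p.1 ∧ p.1 ≤ s + P ∧
    0 < (1 - p.2) + (p.1 - s) ∧ 0 < (1 - p.2) + (s + P - p.1)} with hM
  have hMconv : Convex ℝ M := by
    rintro ⟨x1, x2⟩ ⟨h1, h2, h3, h4, h5, h6⟩ ⟨y1, y2⟩ ⟨k1, k2, k3, k4, k5, k6⟩ a b ha hb hab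
    simp only at h1 h2 h3 h4 h5 h6 k1 k2 k3 k4 k5 k6
    simp only [hM, Prod.smul_mk, Prod.mk_add_mk, smul_eq_mul, mem_ofPred_eq]
    obtain rfl : b = 1 - a := by linarith
    rcases ha.eq_or_lt with rfl | ha
    · refine ⟨?_, ?_, ?_, ?_, ?_, ?_⟩ <;> linarith
    refine ⟨?_, ?_, ?_, ?_, ?_, ?_⟩
    · positivity
    · nlinarith
    · nlinarith
    · nlinarith
    · nlinarith [mul_pos ha h5, mul_nonneg hb k5.le]
    · nlinarith [mul_pos ha h6, mul_nonneg hb k6.le]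
  obtain ⟨φ, hφ, hφe⟩ := hMconv.exists_continuousOn_log (f := fun p => G p.1 - zr p.2)
    (by simp only [hzr]; fun_prop) (by
      rintro ⟨t, r⟩ ⟨h1, h2, h3, h4, h5, h6⟩
      simp only at h1 h2 h3 h4 h5 h6
      rcases h2.lt_or_eq with h2 | rfl
      · exact sub_ne_zero.2 (hzr_ne r h1 h2 t)
      · simp only [hzr1]
        exact sub_ne_zero.2 (hG.inj s t (by linarith) (by linarith)).symm)
  -- the total variation at distance `r`
  have htot : ∀ r, 0 ≤ r → r < 1 → HasWinding G P (zr r) w := by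
    intro r hr0 hr1
    obtain ⟨w', hw'⟩ := exists_hasWinding hGc hG.periodic (hzr_ne r hr0 hr1)
    have hcmp : ∀ r', 0 ≤ r' → r' < 1 → ∀ v, HasWinding G P (zr r') v →
        φ (s + P, r') - φ (s, r') = v * (2 * Real.pi * Complex.I) := by
      rintro r' h0 h1 v ⟨ψ, hψ, hψe, hψP⟩
      have hsub : Icc s (s + P) ×ˢ {r'} ⊆ M := by
        rintro ⟨x, y⟩ ⟨hx, rfl⟩
        simp only [mem_Icc] at hx
        refine ⟨h0, h1.le, hx.1, hx.2, ?_, ?_⟩ <;> simp only <;> linarith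
      have := ((convex_Icc s (s + P)).prod (convex_singleton r')).isPreconnected.eq_of_exp_eq
        (χ := fun p => φ p - ψ p.1) ((hφ.mono hsub).sub (by fun_prop)) (by
          have e : ∀ p ∈ Icc s (s + P) ×ˢ {r'}, Complex.exp (φ p - ψ p.1) = 1 := by
            rintro ⟨x, y⟩ hx
            rw [Complex.exp_sub, hφe _ (hsub hx), hψe]
            obtain ⟨-, rfl⟩ := hx
            exact div_self (sub_ne_zero.2 (hzr_ne _ h0 h1 _))
          intro x hx y hy
          rw [e x hx, e y hy]) (s + P, r') (by simp [hP.le]) (s, r') (by simp [hP.le])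
      simp only [hψP] at this
      linear_combination this
    have hconst := (convex_Ico (0 : ℝ) 1).isPreconnected.eq_of_exp_eq
        (χ := fun r => φ (s + P, r) - φ (s, r)) (by
          refine (hφ.comp (by fun_prop) ?_).sub (hφ.comp (by fun_prop) ?_)
          · intro r hr
            simp only [mem_Ico] at hr
            refine ⟨hr.1, hr.2.le, ?_, ?_, ?_, ?_⟩ <;> simp only <;> linarith
          · intro r hr
            simp only [mem_Ico] at hr
            refine ⟨hr.1, hr.2.le, ?_, ?_, ?_, ?_⟩ <;> simp only <;> linarith) (by
          have e : ∀ r ∈ Ico (0 : ℝ) 1, Complex.exp (φ (s + P, r) - φ (s, r)) = 1 := by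
            intro r hr
            simp only [mem_Ico] at hr
            rw [Complex.exp_sub, hφe _ ⟨hr.1, hr.2.le, by simp only; linarith, by simp only; linarith,
              by simp only; linarith, by simp only; linarith⟩, hφe _ ⟨hr.1, hr.2.le,
              by simp only; linarith, by simp only; linarith,
              by simp only; linarith, by simp only; linarith⟩]
            simp only [hG.periodic]
            exact div_self (sub_ne_zero.2 (hzr_ne _ hr.1 hr.2 _))
          intro x hx y hy
          rw [e x hx, e y hy]) r ⟨hr0, hr1⟩ 0 (by simp)
    rw [hcmp r hr0 hr1 w' hw', hcmp 0 le_rfl one_pos w (by rw [hzr0]; exact hw)] at hconst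
    have h2pi : (2 * Real.pi * Complex.I : ℂ) ≠ 0 := by simp [Real.pi_ne_zero]
    have : w' = w := by exact_mod_cast mul_right_cancel₀ h2pi hconst
    rwa [← this]
  obtain ⟨u, δ, hδ, hu⟩ := hG.cone s
  obtain ⟨δ', hδ', hlt⟩ := hG.eventually_abs_im_sub_lt_pi hθ s
  obtain ⟨a, ha, haδ⟩ := exists_between (lt_min (lt_min hδ hδ') (half_pos hP))
  have haP := haδ.trans_le (min_le_right _ _)
  have ha1 := haδ.trans_le ((min_le_left _ _).trans (min_le_left _ _))
  have h1 := hlt a ha (haδ.trans_le ((min_le_left _ _).trans (min_le_right _ _)))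
  have hmem : ∀ t ∈ Ioo s (s + P), ∀ r ∈ Icc (0 : ℝ) 1, (t, r) ∈ M := by
    intro t ht r hr
    simp only [mem_Ioo, mem_Icc] at ht hr
    refine ⟨hr.1, hr.2, ?_, ?_, ?_, ?_⟩ <;> simp only <;> linarith
  have hta : s + a ∈ Ioo s (s + P) := by constructor <;> linarith
  have htb : s - a + P ∈ Ioo s (s + P) := by constructor <;> linarith
  have hlim : φ (s - a + P, 1) - φ (s + a, 1) = θ (s, s - a + P) - θ (s, s + a) := by
    have hc1 : ContinuousOn (fun t : ℝ => φ (t, 1)) (Ioo s (s + P)) :=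
      hφ.comp (by fun_prop) fun t ht => hmem t ht 1 (by simp)
    have hc2 : ContinuousOn (fun t : ℝ => θ (s, t)) (Ioo s (s + P)) :=
      hθ.cont.comp (by fun_prop) fun t ht => ht
    have := (convex_Ioo s (s + P)).isPreconnected.eq_of_exp_eq (hc1.sub hc2) (by
      have e : ∀ t ∈ Ioo s (s + P), Complex.exp (φ (t, 1) - θ (s, t)) = 1 := by
        intro t ht
        rw [Complex.exp_sub, hφe _ (hmem t ht 1 (by simp)), hθ.exp _ ht]
        simp only [hzr1]
        exact div_self (sub_ne_zero.2 (hG.inj s t ht.1 ht.2).symm)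
      intro x hx y hy
      simp only [Pi.sub_apply]
      rw [e x hx, e y hy]) _ htb _ hta
    simp only [Pi.sub_apply] at this
    linear_combination this
  have h3 := congrArg Complex.im (hθ.shift (s - a, s) ⟨by simpa using ha, by simp; linarith⟩)
  -- With the point at G s, the differences along the long arc from s + a to s − a + P are secants
  -- from `s`; their argument changes by ρπ up to an error below π. By continuity this persists for
  -- some r < 1.
  have h4 : |(φ (s - a + P, 1) - φ (s + a, 1)).im - ρ * Real.pi| < Real.pi := by
    rw [hlim]
    simp only [Complex.add_im, Complex.mul_im, Complex.intCast_re, Complex.intCast_im,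
      Complex.mul_re, Complex.ofReal_re, Complex.ofReal_im, Complex.I_re, Complex.I_im,
      Complex.sub_im] at h3 ⊢
    rw [abs_lt] at h1 ⊢
    constructor <;> linarith
  obtain ⟨r, ⟨hr0, hr1⟩, hr⟩ : ∃ r ∈ Ico (0 : ℝ) 1,
      |(φ (s - a + P, r) - φ (s + a, r)).im - ρ * Real.pi| < Real.pi := by
    have hc : ContinuousOn (fun r : ℝ => |(φ (s - a + P, r) - φ (s + a, r)).im - ρ * Real.pi|)
        (Icc 0 1) := by
      refine (ContinuousOn.sub (Complex.continuous_im.comp_continuousOn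
        (ContinuousOn.sub ?_ ?_)) continuousOn_const).abs
      · exact hφ.comp (by fun_prop) fun r hr => hmem _ htb r hr
      · exact hφ.comp (by fun_prop) fun r hr => hmem _ hta r hr
    have hev := (hc 1 (by simp)).eventually (gt_mem_nhds h4)
    have hle : 𝓝[Ico (0 : ℝ) 1] 1 ≤ 𝓝[Icc (0 : ℝ) 1] 1 := nhdsWithin_mono _ Ico_subset_Icc_self
    have hne : (𝓝[Ico (0 : ℝ) 1] 1).NeBot := by
      rw [← mem_closure_iff_nhdsWithin_neBot, closure_Ico (by norm_num)]; simp
    obtain ⟨r, hr, hr'⟩ := ((hev.filter_mono hle).and self_mem_nhdsWithin).exists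
    exact ⟨r, hr', hr⟩
  obtain ⟨ψ, hψ, hψe, hψP⟩ := htot r hr0 hr1
  have hmid : φ (s - a + P, r) - φ (s + a, r) = ψ (s - a + P) - ψ (s + a) := by
    have hc1 : ContinuousOn (fun t : ℝ => φ (t, r)) (Ioo s (s + P)) :=
      hφ.comp (by fun_prop) fun t ht => hmem t ht r ⟨hr0, hr1.le⟩
    have := (convex_Ioo s (s + P)).isPreconnected.eq_of_exp_eq (hc1.sub hψ.continuousOn) (by
      have e : ∀ t ∈ Ioo s (s + P), Complex.exp (φ (t, r) - ψ t) = 1 := by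
        intro t ht
        rw [Complex.exp_sub, hφe _ (hmem t ht r ⟨hr0, hr1.le⟩), hψe]
        exact div_self (sub_ne_zero.2 (hzr_ne r hr0 hr1 t))
      intro x hx y hy
      simp only [Pi.sub_apply]
      rw [e x hx, e y hy]) _ htb _ hta
    simp only [Pi.sub_apply] at this
    linear_combination this
  -- Along the short arc, Re((G − zr r)u) is strictly increasing and vanishes at most once. With the
  -- long arc this gives |2πw − ρπ| < 3π, and 2w − ρ is odd.
  have hsweep : |(ψ (s + a)).im - (ψ (s - a)).im| < 2 * Real.pi := by
    refine (isPreconnected_Icc (a := s - a) (b := s + a)).abs_im_sub_lt_two_pi hψ.continuousOn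
      (a := u) ?_ _ ?_ _ ?_
    · intro x hx y hy h0 h0'
      simp only [mem_Icc] at hx hy
      rw [hψe] at h0 h0'
      by_contra hne
      rcases lt_or_gt_of_ne hne with hlt | hlt
      · have := hu x y (by linarith) hlt (by linarith)
        rw [show (G y - G x) * u = (G y - zr r) * u - (G x - zr r) * u by ring,
          Complex.sub_re, h0, h0'] at this
        simp at this
      · have := hu y x (by linarith) hlt (by linarith)
        rw [show (G x - G y) * u = (G x - zr r) * u - (G y - zr r) * u by ring,
          Complex.sub_re, h0, h0'] at this
        simp at this
    · constructor <;> linarith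
    · constructor <;> linarith
  rw [hmid, hψP] at hr
  simp only [Complex.add_im, Complex.mul_im, Complex.intCast_re, Complex.intCast_im,
    Complex.mul_re, Complex.ofReal_re, Complex.ofReal_im, Complex.I_re, Complex.I_im,
    Complex.sub_im, Complex.re_ofNat, Complex.im_ofNat] at hr
  rw [abs_lt] at hr hsweep
  have h5 : |2 * (w : ℝ) - ρ| < 3 := by
    rw [abs_lt]
    constructor <;> nlinarith [Real.pi_pos]
  have h6 : |2 * w - ρ| < 3 := by exact_mod_cast h5
  rw [abs_lt] at h6
  omega

end SimpleClosed

/-- A point with nonzero winding number lies in a bounded component of the complement. -/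
lemma HasWinding.mem_enclosedRegion {G : ℝ → ℂ} {P : ℝ} (hP : 0 < P) (hG : Continuous G)
    (hper : ∀ t, G (t + P) = G t) {z : ℂ} {w : ℤ} (hw : HasWinding G P z w) (hw0 : w ≠ 0) :
    z ∈ CurveNetwork.enclosedRegion (range G) := by
  classical
  have hz : z ∈ (range G)ᶜ := by
    rintro ⟨t, ht⟩
    exact hw.ne t ht
  refine ⟨hz, ?_⟩
  by_contra hunb
  obtain ⟨R, hR⟩ : ∃ R, ∀ t, ‖G t‖ ≤ R := by
    obtain ⟨s, hs⟩ := exists_forall_le_of_periodic hP (f := fun t => -‖G t‖) (by fun_prop)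
      (fun t => by simp only [hper])
    exact ⟨‖G s‖, fun t => by linarith [hs t]⟩
  choose! W hW using fun z' (hz' : z' ∈ (range G)ᶜ) =>
    exists_hasWinding hG hper (z := z') (fun t ht => hz' ⟨t, ht⟩)
  have hsub := connectedComponentIn_subset (range G)ᶜ z
  have hcont : ContinuousOn W (connectedComponentIn (range G)ᶜ z) := by
    intro z₁ hz₁
    refine ContinuousAt.continuousWithinAt ?_
    have h1 := hsub hz₁
    obtain ⟨s, hs⟩ := exists_forall_le_of_periodic hP (f := fun t => ‖G t - z₁‖) (by fun_prop)
      (fun t => by simp only [hper])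
    have hpos : 0 < ‖G s - z₁‖ := norm_pos_iff.2 (sub_ne_zero.2 ((hW _ h1).ne s))
    have hev : ∀ᶠ z₂ in 𝓝 z₁, W z₁ = W z₂ := by
      filter_upwards [Metric.ball_mem_nhds z₁ hpos] with z₂ hz₂
      rw [Metric.mem_ball, dist_eq_norm] at hz₂
      have h2 : z₂ ∈ (range G)ᶜ := by
        rintro ⟨t, rfl⟩
        exact absurd hz₂ (hs t).not_gt
      refine (hW _ h1).eq_of_norm_lt (hW _ h2) fun t => ?_
      rw [show G t - z₂ - (G t - z₁) = -(z₂ - z₁) by ring, norm_neg]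
      exact hz₂.trans_le (hs t)
    exact (continuousAt_const (y := W z₁)).congr hev
  obtain ⟨z', hz', hz'R⟩ : ∃ z' ∈ connectedComponentIn (range G)ᶜ z, R < ‖z'‖ := by
    by_contra! h
    exact hunb (isBounded_iff_forall_norm_le.2 ⟨R, h⟩)
  have hzz := isPreconnected_connectedComponentIn.constant hcont (mem_connectedComponentIn hz) hz'
  have hWz : W z = w := (hW z hz).unique hw
  -- Seen from a point outside a disc about 0 that contains the curve, the curve winds like the
  -- constant curve 0. The winding number is locally constant, so it would vanish on an unbounded
  -- component.
  have h0 : HasWinding (fun _ => (0 : ℂ)) P z' 0 := by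
    refine ⟨fun _ => Complex.log (0 - z'), continuous_const, fun t => Complex.exp_log ?_, by simp⟩
    rw [zero_sub, neg_ne_zero]
    rintro rfl
    rw [norm_zero] at hz'R
    exact absurd ((norm_nonneg _).trans (hR 0)) hz'R.not_ge
  have := h0.eq_of_norm_lt (hW _ (hsub hz')) fun t => by
    rw [show G t - z' - (0 - z') = G t by ring, zero_sub, norm_neg]
    exact (hR t).trans_lt hz'R
  omega

namespace CurveNetwork

/-! ### Regular arcs -/

/-- The integral of the signed curvature with respect to arclength. -/
def totalCurvature (σ : ℝ → ℂ) : ℝ := ∫ x in (0 : ℝ)..1, curvature σ x * ‖velocity σ x‖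

section Arc

variable {σ : ℝ → ℂ}

lemma continuousOn_velocity (h : ContDiffOn ℝ 1 σ (Icc 0 1)) :
    ContinuousOn (velocity σ) (Icc 0 1) :=
  h.continuousOn_derivWithin (uniqueDiffOn_Icc one_pos) le_rfl

lemma hasDerivWithinAt_velocity (h : ContDiffOn ℝ 1 σ (Icc 0 1)) {x : ℝ} (hx : x ∈ Icc (0 : ℝ) 1) :
    HasDerivWithinAt σ (velocity σ x) (Icc 0 1) x :=
  (h.differentiableOn one_ne_zero x hx).hasDerivWithinAt

/-- The continuous extension of the velocity to all parameters. -/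
def extendedVelocity (σ : ℝ → ℂ) : ℝ → ℂ := fun x => velocity σ (projIcc 0 1 zero_le_one x)

lemma continuous_extendedVelocity (h : ContDiffOn ℝ 1 σ (Icc 0 1)) :
    Continuous (extendedVelocity σ) :=
  (continuousOn_velocity h).comp_continuous (by fun_prop) fun x => (projIcc 0 1 zero_le_one x).2

lemma extendedVelocity_of_mem {x : ℝ} (hx : x ∈ Icc (0 : ℝ) 1) :
    extendedVelocity σ x = velocity σ x := by
  rw [extendedVelocity, projIcc_of_mem _ hx]

lemma integral_extendedVelocity (h : ContDiffOn ℝ 1 σ (Icc 0 1)) {s t : ℝ}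
    (hs : s ∈ Icc (0 : ℝ) 1) (ht : t ∈ Icc (0 : ℝ) 1) :
    ∫ x in s..t, extendedVelocity σ x = σ t - σ s := by
  wlog hst : s ≤ t generalizing s t
  · rw [intervalIntegral.integral_symm, this ht hs (le_of_not_ge hst)]; ring
  refine intervalIntegral.integral_eq_sub_of_hasDerivAt_of_le hst
    (h.continuousOn.mono (Icc_subset_Icc hs.1 ht.2)) (fun x hx => ?_)
    ((continuous_extendedVelocity h).intervalIntegrable _ _)
  have hx' : x ∈ Icc (0 : ℝ) 1 := ⟨hs.1.trans hx.1.le, hx.2.le.trans ht.2⟩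
  rw [extendedVelocity_of_mem hx']
  exact (hasDerivWithinAt_velocity h hx').hasDerivAt
    (Icc_mem_nhds (hs.1.trans_lt hx.1) (hx.2.trans_le ht.2))

/-- Near a point, a regular curve is strictly monotone in the directions that form an acute angle
with its tangent. -/
lemma exists_monotone_direction (h : ContDiffOn ℝ 1 σ (Icc 0 1)) {x₀ : ℝ}
    (hx₀ : x₀ ∈ Icc (0 : ℝ) 1) {u : ℂ} (hu : 0 < (velocity σ x₀ * u).re) :
    ∃ δ > 0, ∀ a ∈ Icc (0 : ℝ) 1, ∀ b ∈ Icc (0 : ℝ) 1, |a - x₀| < δ → |b - x₀| < δ → a < b →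
      0 < ((σ b - σ a) * u).re := by
  have hc : Continuous fun x => (extendedVelocity σ x * u).re :=
    Complex.continuous_re.comp ((continuous_extendedVelocity h).mul continuous_const)
  have hev := hc.continuousAt.eventually (lt_mem_nhds (show 0 < (extendedVelocity σ x₀ * u).re by
    rwa [extendedVelocity_of_mem hx₀]))
  obtain ⟨δ, hδ, hball⟩ := Metric.eventually_nhds_iff.1 hev
  refine ⟨δ, hδ, fun a ha b hb haδ hbδ hab => ?_⟩
  rw [← integral_extendedVelocity h ha hb, ← intervalIntegral.integral_mul_const,
    ← Complex.reCLM_apply, ← ContinuousLinearMap.intervalIntegral_comp_comm]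
  · refine intervalIntegral.intervalIntegral_pos_of_pos_on (hc.intervalIntegrable _ _)
      (fun x hx => ?_) hab
    refine hball ?_
    rw [Real.dist_eq, abs_lt]
    rw [abs_lt] at haδ hbδ
    constructor <;> linarith [hx.1, hx.2]
  · exact ((continuous_extendedVelocity h).mul continuous_const).intervalIntegrable _ _

/-- A continuous logarithm of the secants of a regular arc extends to its tangents. -/
lemma exists_log_velocity (h : ContDiffOn ℝ 1 σ (Icc 0 1))
    (hv : ∀ x ∈ Icc (0 : ℝ) 1, velocity σ x ≠ 0) {ψ : ℝ × ℝ → ℂ}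
    (hψ : ContinuousOn ψ {p | 0 ≤ p.1 ∧ p.1 < p.2 ∧ p.2 ≤ 1 ∧ p.2 - p.1 < 1})
    (hψe : ∀ p : ℝ × ℝ, 0 ≤ p.1 → p.1 < p.2 → p.2 ≤ 1 → p.2 - p.1 < 1 →
      Complex.exp (ψ p) = σ p.2 - σ p.1) :
    ∃ Θ : ℝ → ℂ, ContinuousOn Θ (Icc 0 1) ∧
      (∀ x ∈ Icc (0 : ℝ) 1, Complex.exp (Θ x) = velocity σ x) ∧
      Tendsto (fun a => (ψ (0, a)).im) (𝓝[>] 0) (𝓝 (Θ 0).im) ∧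
      Tendsto (fun a => (ψ (1 - a, 1)).im) (𝓝[>] 0) (𝓝 (Θ 1).im) := by
  have hVc := continuous_extendedVelocity h
  -- The difference quotient of σ, written as a mean of velocities so that it is continuous up to
  -- the diagonal, where it equals the velocity. The corner (0, 1) is left out below because the arc
  -- may be closed.
  set g : ℝ × ℝ → ℂ := fun p => ∫ r in (0 : ℝ)..1, extendedVelocity σ (p.1 + (p.2 - p.1) * r)
  have hg : Continuous g :=
    intervalIntegral.continuous_parametric_intervalIntegral_of_continuous' (by fun_prop) 0 1
  set T : Set (ℝ × ℝ) := {p | 0 ≤ p.1 ∧ p.1 ≤ p.2 ∧ p.2 ≤ 1 ∧ p.2 - p.1 < 1} with hT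
  set T' : Set (ℝ × ℝ) := {p | 0 ≤ p.1 ∧ p.1 < p.2 ∧ p.2 ≤ 1 ∧ p.2 - p.1 < 1} with hT'
  have hTc : Convex ℝ T := by
    rintro ⟨x1, x2⟩ ⟨h1, h2, h3, h4⟩ ⟨y1, y2⟩ ⟨k1, k2, k3, k4⟩ a b ha hb hab
    simp only at h1 h2 h3 h4 k1 k2 k3 k4
    simp only [hT, Prod.smul_mk, Prod.mk_add_mk, smul_eq_mul, mem_ofPred_eq]
    obtain rfl : b = 1 - a := by linarith
    rcases ha.eq_or_lt with rfl | ha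
    · refine ⟨?_, ?_, ?_, ?_⟩ <;> linarith
    refine ⟨by positivity, by nlinarith, by nlinarith, ?_⟩
    nlinarith [mul_pos ha (sub_pos.2 h4), mul_nonneg hb (sub_pos.2 k4).le]
  have hT'c : Convex ℝ T' := by
    rintro ⟨x1, x2⟩ ⟨h1, h2, h3, h4⟩ ⟨y1, y2⟩ ⟨k1, k2, k3, k4⟩ a b ha hb hab
    simp only at h1 h2 h3 h4 k1 k2 k3 k4
    simp only [hT', Prod.smul_mk, Prod.mk_add_mk, smul_eq_mul, mem_ofPred_eq]
    obtain rfl : b = 1 - a := by linarith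
    rcases ha.eq_or_lt with rfl | ha
    · refine ⟨?_, ?_, ?_, ?_⟩ <;> linarith
    refine ⟨by positivity, ?_, by nlinarith, ?_⟩
    · nlinarith [mul_pos ha (sub_pos.2 h2), mul_nonneg hb (sub_pos.2 k2).le]
    · nlinarith [mul_pos ha (sub_pos.2 h4), mul_nonneg hb (sub_pos.2 k4).le]
  have hTT' : T' ⊆ T := fun p hp => ⟨hp.1, hp.2.1.le, hp.2.2.1, hp.2.2.2⟩
  have hgs : ∀ p ∈ T, ((p.2 - p.1 : ℝ) : ℂ) * g p = σ p.2 - σ p.1 := by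
    rintro ⟨s, t⟩ ⟨h1, h2, h3, h4⟩
    simp only at h1 h2 h3 h4
    rw [← integral_extendedVelocity h (s := s) (t := t) ⟨h1, h2.trans h3⟩ ⟨h1.trans h2, h3⟩,
      ← Complex.real_smul]
    have := intervalIntegral.smul_integral_comp_add_mul (a := 0) (b := 1)
      (fun x => extendedVelocity σ x) (t - s) s
    rw [mul_zero, mul_one, add_zero, add_sub_cancel] at this
    exact this
  have hgd : ∀ x ∈ Icc (0 : ℝ) 1, g (x, x) = velocity σ x := by
    intro x hx
    simp [g, extendedVelocity_of_mem hx]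
  have hg0 : ∀ p ∈ T, g p ≠ 0 := by
    rintro ⟨s, t⟩ hp hg0
    rcases hp.2.1.lt_or_eq with hlt | heq
    · have := hgs _ hp
      rw [hg0, mul_zero, ← hψe (s, t) hp.1 hlt hp.2.2.1 hp.2.2.2] at this
      exact Complex.exp_ne_zero _ this.symm
    · simp only at heq
      subst heq
      have hs : s ∈ Icc (0 : ℝ) 1 := ⟨hp.1, hp.2.2.1⟩
      exact hv s hs (by rw [← hgd s hs, hg0])
  obtain ⟨φ, hφ, hφe⟩ := hTc.exists_continuousOn_log hg.continuousOn hg0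
  -- The secant is the positive number t − s times the quotient, so the two logarithms differ by a
  -- real logarithm and a constant; the imaginary parts differ by a constant only.
  have hconst : ∀ p ∈ T', ∀ q ∈ T', ψ p - φ p - (Real.log (p.2 - p.1) : ℂ) =
      ψ q - φ q - (Real.log (q.2 - q.1) : ℂ) := by
    refine hT'c.isPreconnected.eq_of_exp_eq ((hψ.sub (hφ.mono hTT')).sub
      (Complex.continuous_ofReal.comp_continuousOn (ContinuousOn.log (by fun_prop)
        fun p hp => (sub_pos.2 hp.2.1).ne'))) ?_
    have e : ∀ p ∈ T', Complex.exp (ψ p - φ p - (Real.log (p.2 - p.1) : ℂ)) = 1 := by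
      intro p hp
      have hpos := sub_pos.2 hp.2.1
      rw [Complex.exp_sub, Complex.exp_sub, hψe p hp.1 hp.2.1 hp.2.2.1 hp.2.2.2,
        hφe p (hTT' hp), ← Complex.ofReal_exp, Real.exp_log hpos, ← hgs p (hTT' hp)]
      have h1 := hg0 p (hTT' hp)
      have h2 : ((p.2 - p.1 : ℝ) : ℂ) ≠ 0 := by exact_mod_cast hpos.ne'
      field_simp
    intro p hp q hq
    rw [e p hp, e q hq]
  have hb : ((1 / 4 : ℝ), (3 / 4 : ℝ)) ∈ T' := by
    refine ⟨?_, ?_, ?_, ?_⟩ <;> norm_num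
  set C : ℂ := ψ (1 / 4, 3 / 4) - φ (1 / 4, 3 / 4) - (Real.log (3 / 4 - 1 / 4) : ℂ) with hC
  have hexpC : Complex.exp C = 1 := by
    have hpos : (0 : ℝ) < 3 / 4 - 1 / 4 := by norm_num
    rw [hC, Complex.exp_sub, Complex.exp_sub, hψe _ hb.1 hb.2.1 hb.2.2.1 hb.2.2.2,
      hφe _ (hTT' hb), ← Complex.ofReal_exp, Real.exp_log hpos, ← hgs _ (hTT' hb)]
    have h1 := hg0 _ (hTT' hb)
    have h2 : ((3 / 4 - 1 / 4 : ℝ) : ℂ) ≠ 0 := by exact_mod_cast hpos.ne'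
    rw [mul_div_cancel_right₀ _ h1, div_self h2]
  have him : ∀ p ∈ T', (ψ p).im = (φ p + C).im := by
    intro p hp
    have := congrArg Complex.im (hconst p hp _ hb)
    simp only [← hC, Complex.sub_im, Complex.ofReal_im] at this
    rw [Complex.add_im]
    linarith
  have hcont : ContinuousOn (fun p => (φ p + C).im) T :=
    Complex.continuous_im.comp_continuousOn (hφ.add continuousOn_const)
  have hev : ∀ᶠ a in 𝓝[>] (0 : ℝ), 0 < a ∧ a < 1 := Ioo_mem_nhdsGT one_pos
  refine ⟨fun x => φ (x, x) + C, ?_, ?_, ?_, ?_⟩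
  · exact (hφ.comp (by fun_prop) fun x hx => ⟨hx.1, le_rfl, hx.2, by simp⟩).add continuousOn_const
  · intro x hx
    rw [Complex.exp_add, hexpC, mul_one, hφe _ ⟨hx.1, le_rfl, hx.2, by simp⟩, hgd x hx]
  · have hd : Tendsto (fun a : ℝ => ((0 : ℝ), a)) (𝓝[>] 0) (𝓝[T] (0, 0)) := by
      refine tendsto_nhdsWithin_iff.2 ⟨?_, ?_⟩
      · exact (Continuous.tendsto' (by fun_prop) _ _ rfl).mono_left nhdsWithin_le_nhds
      · filter_upwards [hev] with a ha
        exact ⟨le_rfl, ha.1.le, ha.2.le, by simpa using ha.2⟩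
    refine (((hcont (0, 0) ⟨le_rfl, le_rfl, zero_le_one, by simp⟩).tendsto.comp hd)).congr' ?_
    filter_upwards [hev] with a ha
    exact (him (0, a) ⟨le_rfl, ha.1, ha.2.le, by simpa using ha.2⟩).symm
  · have hd : Tendsto (fun a : ℝ => (1 - a, (1 : ℝ))) (𝓝[>] 0) (𝓝[T] (1, 1)) := by
      refine tendsto_nhdsWithin_iff.2 ⟨?_, ?_⟩
      · exact (Continuous.tendsto' (by fun_prop) _ _ (by simp)).mono_left nhdsWithin_le_nhds
      · filter_upwards [hev] with a ha
        refine ⟨?_, ?_, ?_, ?_⟩ <;> simp only <;> linarith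
    refine (((hcont (1, 1) ⟨zero_le_one, le_rfl, le_rfl, by simp⟩).tendsto.comp hd)).congr' ?_
    filter_upwards [hev] with a ha
    refine (him (1 - a, 1) ⟨?_, ?_, ?_, ?_⟩).symm <;> simp only <;> linarith

lemma contDiffOn_velocity (h : ContDiffOn ℝ 2 σ (Icc 0 1)) :
    ContDiffOn ℝ 1 (velocity σ) (Icc 0 1) :=
  h.derivWithin (uniqueDiffOn_Icc one_pos) (by norm_num)

lemma contDiffOn_unitTangent (h : ContDiffOn ℝ 2 σ (Icc 0 1))
    (hv : ∀ x ∈ Icc (0 : ℝ) 1, velocity σ x ≠ 0) : ContDiffOn ℝ 1 (unitTangent σ) (Icc 0 1) := by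
  have h1 := contDiffOn_velocity h
  exact ((h1.norm ℝ hv).inv fun x hx => norm_ne_zero_iff.2 (hv x hx)).smul h1

lemma norm_unitTangent {x : ℝ} (hv : velocity σ x ≠ 0) : ‖unitTangent σ x‖ = 1 := by
  rw [unitTangent, norm_smul, norm_inv, norm_norm, inv_mul_cancel₀ (norm_ne_zero_iff.2 hv)]

/-- For a unit vector τ, division by τ is multiplication by its conjugate, so the component of τ_x
along iτ is the imaginary part of τ_x/τ, the derivative of the angle. -/
lemma curvature_mul_norm_velocity {x : ℝ} (hv : velocity σ x ≠ 0) :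
    curvature σ x * ‖velocity σ x‖ =
      (derivWithin (unitTangent σ) (Icc 0 1) x / unitTangent σ x).im := by
  have hn := norm_ne_zero_iff.2 hv
  have h1 := norm_unitTangent hv
  rw [curvature, curvatureVector, unitNormal, real_inner_smul_left, Complex.div_im,
    Complex.normSq_eq_norm_sq, h1, Complex.inner]
  field_simp
  simp
  ring

/-- The total curvature of a regular arc is the variation of the argument of its tangent. -/
lemma totalCurvature_eq (h : ContDiffOn ℝ 2 σ (Icc 0 1))
    (hv : ∀ x ∈ Icc (0 : ℝ) 1, velocity σ x ≠ 0) {Θ : ℝ → ℂ} (hΘ : ContinuousOn Θ (Icc 0 1))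
    (hΘe : ∀ x ∈ Icc (0 : ℝ) 1, Complex.exp (Θ x) = velocity σ x) :
    totalCurvature σ = (Θ 1).im - (Θ 0).im := by
  have hτ := contDiffOn_unitTangent h hv
  have hne : ∀ x ∈ Icc (0 : ℝ) 1, unitTangent σ x ≠ 0 := by
    intro x hx h0
    have := norm_unitTangent (hv x hx)
    rw [h0, norm_zero] at this
    exact zero_ne_one this
  have hq := hτ.continuousOn_derivWithin (uniqueDiffOn_Icc one_pos) le_rfl
  have hvc : ContinuousOn (velocity σ) (Icc 0 1) := (contDiffOn_velocity h).continuousOn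
  have := log_sub_log_eq_integral (p := unitTangent σ) (q := derivWithin (unitTangent σ) (Icc 0 1))
    (φ := fun x => Θ x - (Real.log ‖velocity σ x‖ : ℂ))
    (fun x hx => (hτ.differentiableOn one_ne_zero x hx).hasDerivWithinAt) hq hne
    (hΘ.sub (Complex.continuous_ofReal.comp_continuousOn
      (hvc.norm.log fun x hx => norm_ne_zero_iff.2 (hv x hx))))
    (fun x hx => by
      have hn := norm_pos_iff.2 (hv x hx)
      rw [Complex.exp_sub, hΘe x hx, ← Complex.ofReal_exp, Real.exp_log hn, unitTangent,
        Complex.real_smul, Complex.ofReal_inv, div_eq_inv_mul])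
  have h2 := congrArg Complex.im this
  simp only [Complex.sub_im, Complex.ofReal_im, sub_zero] at h2
  rw [h2, totalCurvature, ← Complex.imCLM_apply, ← ContinuousLinearMap.intervalIntegral_comp_comm]
  · refine intervalIntegral.integral_congr fun x hx => ?_
    rw [uIcc_of_le zero_le_one] at hx
    exact curvature_mul_norm_velocity (hv x hx)
  · refine ContinuousOn.intervalIntegrable ?_
    rw [uIcc_of_le zero_le_one]
    exact hq.div hτ.continuousOn hne

end Arc

/-! ### Closed chains of arcs -/

/-- The arcs `c 0, …, c (m - 1)`, repeated periodically, form a simple closed curve, with an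
exterior angle of amplitude `π / 3` between two consecutive arcs. -/
structure IsArcLoop (c : ℤ → ℝ → ℂ) (m : ℕ) : Prop where
  pos : 0 < m
  periodic : ∀ j, c (j + m) = c j
  contDiffOn : ∀ j, ContDiffOn ℝ 1 (c j) (Icc 0 1)
  velocity_ne_zero : ∀ j, ∀ x ∈ Icc (0 : ℝ) 1, velocity (c j) x ≠ 0
  join : ∀ j, c j 1 = c (j + 1) 0
  inj : ∀ j k : ℤ, 0 ≤ j → j < m → 0 ≤ k → k < m → ∀ x ∈ Ico (0 : ℝ) 1, ∀ y ∈ Ico (0 : ℝ) 1,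
    c j x = c k y → j = k ∧ x = y
  corner : ∀ j, (unitTangent (c (j + 1)) 0 * starRingEnd ℂ (unitTangent (c j) 1)).re = 1 / 2

/-- The concatenation of the arcs `c j`, with `c j` on the interval `[j, j + 1]`. -/
def concat (c : ℤ → ℝ → ℂ) (x : ℝ) : ℂ := c ⌊x⌋ (Int.fract x)

namespace IsArcLoop

variable {c : ℤ → ℝ → ℂ} {m : ℕ}

/-- The end x = 1 is included: there the floor already selects the next arc, and `join` identifies
the values. -/
lemma concat_add (h : IsArcLoop c m) (j : ℤ) {x : ℝ} (hx : x ∈ Icc (0 : ℝ) 1) :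
    concat c (j + x) = c j x := by
  rcases hx.2.lt_or_eq with hlt | rfl
  · rw [concat, Int.floor_intCast_add, Int.fract_intCast_add,
      Int.floor_eq_zero_iff.2 ⟨hx.1, hlt⟩, add_zero, Int.fract_eq_self.2 ⟨hx.1, hlt⟩]
  · rw [concat, h.join j]
    have : (j : ℝ) + 1 = ((j + 1 : ℤ) : ℝ) := by push_cast; ring
    rw [this, Int.floor_intCast, Int.fract_intCast]

lemma concat_eq (h : IsArcLoop c m) (j : ℤ) {x : ℝ} (hx : x ∈ Icc (j : ℝ) (j + 1)) :
    concat c x = c j (x - j) := by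
  have := h.concat_add j (x := x - j) ⟨by linarith [hx.1], by linarith [hx.2]⟩
  rwa [add_sub_cancel] at this

lemma concat_periodic (h : IsArcLoop c m) (x : ℝ) : concat c (x + m) = concat c x := by
  have : (m : ℝ) = ((m : ℤ) : ℝ) := by simp
  rw [concat, concat, this, Int.floor_add_intCast, Int.fract_add_intCast, h.periodic]

lemma continuous_concat (h : IsArcLoop c m) : Continuous (concat c) := by
  have hj : ∀ j : ℤ, ContinuousOn (concat c) (Icc (j : ℝ) (j + 1)) := by
    intro j
    refine ContinuousOn.congr (f := fun x => c j (x - j)) ?_ fun x hx => h.concat_eq j hx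
    exact (h.contDiffOn j).continuousOn.comp (by fun_prop)
      fun x hx => ⟨by linarith [hx.1], by linarith [hx.2]⟩
  rw [continuous_iff_continuousAt]
  intro x
  have hu : ContinuousOn (concat c) (Icc ((⌊x⌋ - 1 : ℤ) : ℝ) ((⌊x⌋ - 1 : ℤ) + 1) ∪
      Icc (⌊x⌋ : ℝ) (⌊x⌋ + 1)) :=
    (hj _).union_of_isClosed (hj _) isClosed_Icc isClosed_Icc
  push_cast at hu
  rw [sub_add_cancel, Icc_union_Icc_eq_Icc (by linarith) (by linarith)] at hu
  exact hu.continuousAt (Icc_mem_nhds (by linarith [Int.floor_le x]) (Int.lt_floor_add_one x))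

lemma periodic_mod (h : IsArcLoop c m) (j : ℤ) : c (j % m) = c j := by
  have : Function.Periodic c (m : ℤ) := h.periodic
  rw [Int.emod_def, mul_comm]
  exact this.sub_int_mul_eq (j / m)

lemma simpleClosed (h : IsArcLoop c m) : SimpleClosed (concat c) m := by
  have hm : (0 : ℤ) < m := by exact_mod_cast h.pos
  refine ⟨by exact_mod_cast h.pos, h.continuous_concat, h.concat_periodic, ?_, ?_⟩
  · intro s t hst hts heq
    rw [concat, concat, ← h.periodic_mod ⌊s⌋, ← h.periodic_mod ⌊t⌋] at heq
    obtain ⟨h1, h2⟩ := h.inj _ _ (Int.emod_nonneg _ hm.ne') (Int.emod_lt_of_pos _ hm)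
      (Int.emod_nonneg _ hm.ne') (Int.emod_lt_of_pos _ hm) _
      ⟨Int.fract_nonneg _, Int.fract_lt_one _⟩ _ ⟨Int.fract_nonneg _, Int.fract_lt_one _⟩ heq
    have hd := Int.ModEq.dvd (show ⌊s⌋ ≡ ⌊t⌋ [ZMOD m] from h1)
    have e1 : t - s = ((⌊t⌋ - ⌊s⌋ : ℤ) : ℝ) := by
      have := Int.floor_add_fract s
      have := Int.floor_add_fract t
      push_cast
      linarith
    have h3 : (0 : ℝ) < ((⌊t⌋ - ⌊s⌋ : ℤ) : ℝ) := by linarith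
    have h4 : ((⌊t⌋ - ⌊s⌋ : ℤ) : ℝ) < ((m : ℤ) : ℝ) := by rw [← e1]; push_cast; linarith
    have := Int.le_of_dvd (by exact_mod_cast h3) hd
    have h4' : ⌊t⌋ - ⌊s⌋ < m := by exact_mod_cast h4
    omega
  · intro s
    rcases (Int.fract_nonneg s).eq_or_lt with h0 | hpos
    · obtain ⟨j, rfl⟩ : ∃ j : ℤ, s = ((j + 1 : ℤ) : ℝ) :=
        ⟨⌊s⌋ - 1, by have := Int.floor_add_fract s; rw [← h0] at this; push_cast; linarith⟩
      set v₁ := unitTangent (c j) 1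
      set v₂ := unitTangent (c (j + 1)) 0
      have hv₁ : velocity (c j) 1 ≠ 0 := h.velocity_ne_zero j 1 (by simp)
      have hv₂ : velocity (c (j + 1)) 0 ≠ 0 := h.velocity_ne_zero (j + 1) 0 (by simp)
      have e₁ : velocity (c j) 1 = ‖velocity (c j) 1‖ * v₁ := by
        simp [v₁, unitTangent, hv₁]
      have e₂ : velocity (c (j + 1)) 0 = ‖velocity (c (j + 1)) 0‖ * v₂ := by
        simp [v₂, unitTangent, hv₂]
      have hc : (v₂ * starRingEnd ℂ v₁).re = 1 / 2 := h.corner j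
      have hc' : (v₁ * starRingEnd ℂ v₂).re = 1 / 2 := by
        rw [← hc]; simp; ring
      have n₁ : (v₁ * starRingEnd ℂ v₁).re = 1 := by
        rw [Complex.mul_conj, Complex.normSq_eq_norm_sq, norm_unitTangent hv₁]; simp
      have n₂ : (v₂ * starRingEnd ℂ v₂).re = 1 := by
        rw [Complex.mul_conj, Complex.normSq_eq_norm_sq, norm_unitTangent hv₂]; simp
      -- The bisector of the two unit tangents makes an acute angle with both, the inner products
      -- being 1 + 1/2; so the curve is monotone in this direction across the corner.
      set u := starRingEnd ℂ v₁ + starRingEnd ℂ v₂ with hu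
      obtain ⟨δ₁, hδ₁, H₁⟩ := exists_monotone_direction (h.contDiffOn j) (x₀ := 1) (by simp)
        (u := u) (by
          rw [e₁, mul_assoc, Complex.re_ofReal_mul, hu, mul_add, Complex.add_re, n₁, hc']
          have := norm_pos_iff.2 hv₁
          positivity)
      obtain ⟨δ₂, hδ₂, H₂⟩ := exists_monotone_direction (h.contDiffOn (j + 1)) (x₀ := 0) (by simp)
        (u := u) (by
          rw [e₂, mul_assoc, Complex.re_ofReal_mul, hu, mul_add, Complex.add_re, n₂, hc]
          have := norm_pos_iff.2 hv₂
          positivity)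
      set s : ℝ := ((j + 1 : ℤ) : ℝ) with hs
      have hsj : s = j + 1 := by rw [hs]; push_cast; ring
      set δ := min (min δ₁ δ₂) 1 with hδ
      have hδ0 : 0 < δ := lt_min (lt_min hδ₁ hδ₂) one_pos
      have d₁ : δ ≤ δ₁ := (min_le_left _ _).trans (min_le_left _ _)
      have d₂ : δ ≤ δ₂ := (min_le_left _ _).trans (min_le_right _ _)
      have d₃ : δ ≤ 1 := min_le_right _ _
      have hL : ∀ a b, s - δ < a → a < b → b ≤ s → 0 < ((concat c b - concat c a) * u).re := by
        intro a b ha hab hb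
        rw [h.concat_eq j (x := a) ⟨by linarith, by linarith⟩,
          h.concat_eq j (x := b) ⟨by linarith, by linarith⟩]
        refine H₁ _ ⟨by linarith, by linarith⟩ _ ⟨by linarith, by linarith⟩ ?_ ?_ (by linarith)
        · rw [abs_lt]; constructor <;> linarith
        · rw [abs_lt]; constructor <;> linarith
      have hR : ∀ a b, s ≤ a → a < b → b < s + δ → 0 < ((concat c b - concat c a) * u).re := by
        intro a b ha hab hb
        rw [h.concat_eq (j + 1) (x := a) ⟨by linarith, by linarith⟩,
          h.concat_eq (j + 1) (x := b) ⟨by linarith, by linarith⟩]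
        refine H₂ _ ⟨by linarith, by linarith⟩ _ ⟨by linarith, by linarith⟩ ?_ ?_ (by linarith)
        · rw [abs_lt]; constructor <;> linarith
        · rw [abs_lt]; constructor <;> linarith
      refine ⟨u, δ, hδ0, fun a b ha hab hb => ?_⟩
      rcases le_or_gt b s with hbs | hbs
      · exact hL a b ha hab hbs
      rcases le_or_gt s a with has | has
      · exact hR a b has hab hb
      have k1 := hL a s ha has le_rfl
      have k2 := hR s b le_rfl hbs hb
      rw [show (concat c b - concat c a) * u = (concat c s - concat c a) * u +
        (concat c b - concat c s) * u by ring, Complex.add_re]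
      linarith
    · have hx : Int.fract s ∈ Icc (0 : ℝ) 1 := ⟨hpos.le, (Int.fract_lt_one s).le⟩
      have hv := h.velocity_ne_zero ⌊s⌋ _ hx
      obtain ⟨δ, hδ, H⟩ := exists_monotone_direction (h.contDiffOn ⌊s⌋) hx
        (u := starRingEnd ℂ (velocity (c ⌊s⌋) (Int.fract s))) (by
          rw [Complex.mul_conj, Complex.ofReal_re]
          exact Complex.normSq_pos.2 hv)
      have h1 := Int.fract_lt_one s
      have h2 := Int.floor_add_fract s
      set δ' := min δ (min (Int.fract s) (1 - Int.fract s)) with hδ'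
      have d₁ : δ' ≤ δ := min_le_left _ _
      have d₂ : δ' ≤ Int.fract s := (min_le_right _ _).trans (min_le_left _ _)
      have d₃ : δ' ≤ 1 - Int.fract s := (min_le_right _ _).trans (min_le_right _ _)
      refine ⟨starRingEnd ℂ (velocity (c ⌊s⌋) (Int.fract s)), δ',
        lt_min hδ (lt_min hpos (by linarith)), fun a b ha hab hb => ?_⟩
      rw [h.concat_eq ⌊s⌋ (x := a) ⟨by linarith, by linarith⟩,
        h.concat_eq ⌊s⌋ (x := b) ⟨by linarith, by linarith⟩]
      refine H _ ⟨by linarith, by linarith⟩ _ ⟨by linarith, by linarith⟩ ?_ ?_ (by linarith)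
      · rw [abs_lt]; constructor <;> linarith
      · rw [abs_lt]; constructor <;> linarith

/-- The total curvature of a closed chain of arcs differs from `2 π` times its rotation number by
the exterior angles. -/
theorem abs_sum_totalCurvature_sub_le (h : IsArcLoop c m)
    (h2 : ∀ j, ContDiffOn ℝ 2 (c j) (Icc 0 1)) {θ : ℝ × ℝ → ℂ} {ρ : ℤ}
    (hθ : IsSecantLog (concat c) m θ ρ) :
    |∑ j ∈ Finset.range m, totalCurvature (c j) - 2 * Real.pi * ρ| ≤ m * (Real.pi / 3) := by
  have hG := h.simpleClosed
  have hm : (1 : ℝ) ≤ m := by exact_mod_cast h.pos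
  have hstrip : ∀ (j : ℤ) (p : ℝ × ℝ), 0 ≤ p.1 → p.1 < p.2 → p.2 ≤ 1 → p.2 - p.1 < 1 →
      ((j : ℝ) + p.1, (j : ℝ) + p.2) ∈ secantStrip m := by
    intro j p h1 h2 h3 h4
    refine ⟨?_, ?_⟩ <;> simp only <;> linarith
  have harc : ∀ j : ℤ, ∃ Θ : ℝ → ℂ, ContinuousOn Θ (Icc 0 1) ∧
      (∀ x ∈ Icc (0 : ℝ) 1, Complex.exp (Θ x) = velocity (c j) x) ∧
      Tendsto (fun a : ℝ => (θ (j, j + a)).im) (𝓝[>] 0) (𝓝 (Θ 0).im) ∧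
      Tendsto (fun a : ℝ => (θ ((j + 1 : ℤ) - a, (j + 1 : ℤ))).im) (𝓝[>] 0) (𝓝 (Θ 1).im) := by
    intro j
    obtain ⟨Θ, k1, k2, k3, k4⟩ := exists_log_velocity (h.contDiffOn j) (h.velocity_ne_zero j)
      (ψ := fun p => θ (j + p.1, j + p.2))
      (hθ.cont.comp (by fun_prop) fun p hp => hstrip j p hp.1 hp.2.1 hp.2.2.1 hp.2.2.2)
      (fun p h1 h2 h3 h4 => by
        rw [hθ.exp _ (hstrip j p h1 h2 h3 h4)]
        simp only
        rw [h.concat_add j ⟨h1.trans h2.le, h3⟩, h.concat_add j ⟨h1, h2.le.trans h3⟩])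
    refine ⟨Θ, k1, k2, ?_, ?_⟩
    · simpa using k3
    · refine k4.congr fun a => ?_
      simp only [Int.cast_add, Int.cast_one]
      rw [add_sub_assoc]
  choose Θ hΘc hΘe hΘ0 hΘ1 using harc
  -- Two shifts, (0, a) to (a, m) to (m, a + m), contribute πρ each.
  have hshift : (Θ m 0).im = (Θ 0 0).im + 2 * Real.pi * ρ := by
    have hev : ∀ᶠ a in 𝓝[>] (0 : ℝ), 0 < a ∧ a < 1 := Ioo_mem_nhdsGT one_pos
    refine tendsto_nhds_unique (hΘ0 m) (((hΘ0 0).add_const _).congr' ?_)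
    filter_upwards [hev] with a ha
    have e1 := hθ.shift (0, a) ⟨by simpa using ha.1, by simp; linarith⟩
    have e2 := hθ.shift (a, 0 + m) ⟨by simp; linarith, by simpa using ha.1⟩
    simp only at e1 e2
    have e3 := congrArg Complex.im (e2.trans (by rw [e1]))
    simp only [Complex.add_im, Complex.mul_im, Complex.intCast_re, Complex.intCast_im,
      Complex.mul_re, Complex.ofReal_re, Complex.ofReal_im, Complex.I_re, Complex.I_im] at e3
    simp only [Int.cast_natCast, Int.cast_zero, zero_add]
    rw [zero_add] at e3
    rw [add_comm (m : ℝ) a, e3]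
    ring
  -- The cosine of the jump is 1/2, and the jump is at most π because the secants near the corner
  -- lie in a half-plane; the cosine is injective on [0, π].
  have hcorner : ∀ j : ℤ, |(Θ (j + 1) 0).im - (Θ j 1).im| = Real.pi / 3 := by
    intro j
    have hle : |(Θ (j + 1) 0).im - (Θ j 1).im| ≤ Real.pi := by
      obtain ⟨δ, hδ, hlt⟩ := hG.eventually_abs_im_sub_lt_pi hθ ((j + 1 : ℤ) : ℝ)
      refine le_of_tendsto ((hΘ0 (j + 1)).sub (hΘ1 j)).abs ?_
      filter_upwards [Ioo_mem_nhdsGT hδ] with a ha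
      rw [abs_sub_comm]
      exact (hlt a ha.1 ha.2).le
    have hcos : Real.cos |(Θ (j + 1) 0).im - (Θ j 1).im| = Real.cos (Real.pi / 3) := by
      have hτ : ∀ (j : ℤ), ∀ x ∈ Icc (0 : ℝ) 1,
          unitTangent (c j) x = Complex.exp ((Θ j x).im * Complex.I) := by
        intro j x hx
        rw [unitTangent, ← hΘe j x hx, Complex.norm_exp, Complex.real_smul, Complex.ofReal_inv,
          Complex.ofReal_exp, ← Complex.exp_neg, ← Complex.exp_add]
        congr 1
        apply Complex.ext <;> simp
      have := h.corner j
      rw [hτ _ 0 (by simp), hτ _ 1 (by simp), ← Complex.exp_conj, ← Complex.exp_add] at this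
      rw [Real.cos_abs, Real.cos_pi_div_three, ← this, ← Complex.exp_ofReal_mul_I_re]
      congr 2
      simp
      ring
    exact Real.injOn_cos ⟨abs_nonneg _, hle⟩
      ⟨by positivity, by linarith [Real.pi_pos]⟩ hcos
  have hsum : ∑ j ∈ Finset.range m, totalCurvature (c j) - 2 * Real.pi * ρ =
      -∑ j ∈ Finset.range m, ((Θ (j + 1) 0).im - (Θ j 1).im) := by
    have e1 : ∀ j : ℕ, totalCurvature (c j) = ((Θ ((j + 1 : ℕ) : ℤ) 0).im - (Θ (j : ℤ) 0).im) -
        ((Θ (j + 1) 0).im - (Θ j 1).im) := by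
      intro j
      rw [totalCurvature_eq (h2 j) (h.velocity_ne_zero j) (hΘc j) (hΘe j)]
      push_cast
      ring
    simp only [e1]
    rw [Finset.sum_sub_distrib, Finset.sum_range_sub (fun j : ℕ => (Θ (j : ℤ) 0).im), hshift]
    push_cast
    ring
  rw [hsum, abs_neg]
  refine (Finset.abs_sum_le_sum_abs _ _).trans ?_
  simp [hcorner]

end IsArcLoop

end CurveNetwork

/-! ### The Cauchy transform of a disc -/

lemma integral_inv_sub_circleMap_of_lt {ζ : ℂ} {r : ℝ} (hr : 0 < r) (h : r < ‖ζ‖) :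
    ∫ θ in (0 : ℝ)..2 * Real.pi, (ζ - circleMap 0 r θ)⁻¹ = 2 * Real.pi * ζ⁻¹ := by
  have hd : DiffContOnCl ℂ (fun w => (ζ - w)⁻¹) (Metric.ball 0 |r|) := by
    refine DifferentiableOn.diffContOnCl fun w hw => ?_
    rw [abs_of_pos hr, closure_ball _ hr.ne', mem_closedBall_zero_iff] at hw
    refine DifferentiableAt.differentiableWithinAt ?_
    refine DifferentiableAt.inv (by fun_prop) (sub_ne_zero.2 ?_)
    rintro rfl
    linarith
  have := hd.circleAverage
  rw [Real.circleAverage_def, sub_zero, inv_smul_eq_iff₀ (by positivity)] at this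
  rw [this, Complex.real_smul]
  push_cast
  ring

lemma integral_inv_sub_circleMap_of_gt {ζ : ℂ} {r : ℝ} (hr : 0 < r) (h : ‖ζ‖ < r) :
    ∫ θ in (0 : ℝ)..2 * Real.pi, (ζ - circleMap 0 r θ)⁻¹ = 0 := by
  have hne : ∀ w : ℂ, ‖w‖ ≤ r → starRingEnd ℂ ζ * w - r ^ 2 ≠ 0 := by
    intro w hw h0
    have := congrArg norm (sub_eq_zero.1 h0)
    rw [norm_mul, Complex.norm_conj, norm_pow, Complex.norm_real, Real.norm_eq_abs,
      abs_of_pos hr] at this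
    nlinarith [norm_nonneg ζ, norm_nonneg w]
  -- On |w| = r the conjugate of w is r²/w, so this function is the conjugate of 1/(ζ − w) there. It
  -- is holomorphic in the disc and vanishes at the centre, so its mean is 0.
  have hd : DiffContOnCl ℂ (fun w => w / (starRingEnd ℂ ζ * w - r ^ 2)) (Metric.ball 0 |r|) := by
    refine DifferentiableOn.diffContOnCl fun w hw => ?_
    rw [abs_of_pos hr, closure_ball _ hr.ne', mem_closedBall_zero_iff] at hw
    refine DifferentiableAt.differentiableWithinAt ?_
    exact DifferentiableAt.div (by fun_prop) (by fun_prop) (hne w hw)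
  have := hd.circleAverage
  rw [Real.circleAverage_def, zero_div, inv_smul_eq_iff₀ (by positivity), smul_zero] at this
  have h2 := congrArg (starRingEnd ℂ) this
  rw [← intervalIntegral.intervalIntegral_conj, map_zero] at h2
  refine Eq.trans (intervalIntegral.integral_congr fun θ _ => ?_) h2
  have hn : ‖circleMap 0 r θ‖ = r := by simp [abs_of_pos hr]
  have hw : circleMap 0 r θ * starRingEnd ℂ (circleMap 0 r θ) = r ^ 2 := by
    rw [Complex.mul_conj, Complex.normSq_eq_norm_sq, hn]
    push_cast
    rfl
  have hw0 : circleMap 0 r θ ≠ 0 := by rw [← norm_pos_iff, hn]; exact hr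
  have h1 : ζ - circleMap 0 r θ ≠ 0 := by
    rw [sub_ne_zero]
    rintro rfl
    rw [hn] at h
    exact lt_irrefl _ h
  have h3 := hne _ hn.le
  apply (starRingEnd ℂ).injective
  rw [Complex.conj_conj, map_inv₀, eq_div_iff h3, map_sub, ← hw]
  have h4 : starRingEnd ℂ ζ - starRingEnd ℂ (circleMap 0 r θ) ≠ 0 := by
    rw [← map_sub]; exact (map_ne_zero _).2 h1
  field_simp

lemma integrableOn_inv_ball (R : ℝ) : IntegrableOn (fun z : ℂ => z⁻¹) (Metric.ball 0 R) := by
  have h1 : Integrable (fun z : ℂ => (Iio R).indicator (fun y => y⁻¹) ‖z‖) := by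
    rw [integrable_fun_norm_addHaar volume (f := (Iio R).indicator fun y => y⁻¹)]
    have h2 : IntegrableOn ((Iio R).indicator (1 : ℝ → ℝ)) (Ioi 0) := by
      rw [IntegrableOn, integrable_indicator_iff measurableSet_Iio, IntegrableOn,
        Measure.restrict_restrict measurableSet_Iio, Iio_inter_Ioi]
      exact integrableOn_const (by simp)
    refine h2.congr_fun (fun x hx => ?_) measurableSet_Ioi
    have hx' : x ≠ 0 := (mem_Ioi.1 hx).ne'
    by_cases hxR : x < R <;> simp [hxR, hx', Complex.finrank_real_complex]
  have h3 : Integrable ((Metric.ball (0 : ℂ) R).indicator fun z : ℂ => z⁻¹) := by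
    refine h1.mono' ?_ (Eventually.of_forall fun z => ?_)
    · exact (measurable_inv.indicator measurableSet_ball).aestronglyMeasurable
    · by_cases hz : ‖z‖ < R <;> simp [hz]
  rwa [integrable_indicator_iff measurableSet_ball] at h3

lemma integrableOn_inv_sub_ball (ζ : ℂ) (R : ℝ) :
    IntegrableOn (fun z : ℂ => (ζ - z)⁻¹) (Metric.ball 0 R) := by
  have h := (integrableOn_inv_ball (‖ζ‖ + R))
  have h2 := (Measure.measurePreserving_sub_left (volume : Measure ℂ) ζ).integrableOn_comp_preimage
    (measurableEmbedding_subLeft ζ) (f := fun z : ℂ => z⁻¹) (s := Metric.ball 0 (‖ζ‖ + R))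
  refine (h2.2 h).mono_set fun z hz => ?_
  rw [mem_ball_zero_iff] at hz
  rw [mem_preimage, mem_ball_zero_iff]
  exact (norm_sub_le _ _).trans_lt (by linarith)

/-- The substitution z ↦ ζ − z maps the disc of radius R into that of radius 2R, so one bound serves
all ζ. This uniformity is what Fubini requires. -/
lemma exists_integral_norm_inv_sub_le (R : ℝ) : ∃ K : ℝ, ∀ ζ : ℂ, ‖ζ‖ < R →
    ∫ z in Metric.ball 0 R, ‖(ζ - z)⁻¹‖ ≤ K := by
  refine ⟨∫ z in Metric.ball (0 : ℂ) (R + R), ‖z⁻¹‖, fun ζ hζ => ?_⟩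
  have h2 := (Measure.measurePreserving_sub_left (volume : Measure ℂ) ζ).setIntegral_preimage_emb
    (measurableEmbedding_subLeft ζ) (fun z : ℂ => ‖z⁻¹‖) (Metric.ball 0 (R + R))
  rw [← h2]
  refine setIntegral_mono_set ?_ (Eventually.of_forall fun z => norm_nonneg _)
    (Eventually.of_forall fun z (hz : z ∈ Metric.ball 0 R) => ?_)
  · exact ((Measure.measurePreserving_sub_left (volume : Measure ℂ) ζ).integrableOn_comp_preimage
      (measurableEmbedding_subLeft ζ) (f := fun z : ℂ => ‖z⁻¹‖)).2 (integrableOn_inv_ball _).norm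
  · rw [mem_ball_zero_iff] at hz
    exact mem_ball_zero_iff.2 ((norm_sub_le _ _).trans_lt (by linarith))

/-- In polar coordinates only the circles of radius r < |ζ| contribute, each giving 2πr/ζ, and
π|ζ|²/ζ is π times the conjugate of ζ. -/
lemma integral_inv_sub_ball {ζ : ℂ} {R : ℝ} (hζ : ‖ζ‖ < R) :
    ∫ z in Metric.ball 0 R, (ζ - z)⁻¹ = Real.pi * starRingEnd ℂ ζ := by
  set f : ℂ → ℂ := (Metric.ball 0 R).indicator fun z => (ζ - z)⁻¹ with hf
  have hfm : Measurable f := Measurable.indicator (by fun_prop) measurableSet_ball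
  have hfi : Integrable f := by
    rw [hf, integrable_indicator_iff measurableSet_ball]
    exact integrableOn_inv_sub_ball ζ R
  set g : ℝ × ℝ → ℂ := fun p => p.1 • f (Complex.polarCoord.symm p) with hg
  have hsymm : ∀ p : ℝ × ℝ, Complex.polarCoord.symm p = circleMap 0 p.1 p.2 := by
    intro p
    rw [Complex.polarCoord_symm_apply, circleMap_zero, Complex.exp_mul_I]
    push_cast
    rfl
  have hgm : Measurable g := by
    refine Measurable.smul measurable_fst (hfm.comp ?_)
    rw [show ⇑Complex.polarCoord.symm = fun p : ℝ × ℝ => circleMap 0 p.1 p.2 from funext hsymm]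
    simp only [circleMap]
    fun_prop
  have hgi : IntegrableOn g (Ioi 0 ×ˢ Ioo (-Real.pi) Real.pi) (volume.prod volume) := by
    refine ⟨hgm.aestronglyMeasurable, ?_⟩
    have h1 := Complex.lintegral_comp_polarCoord_symm fun z => ‖f z‖ₑ
    rw [HasFiniteIntegral]
    rw [polarCoord_target] at h1
    refine lt_of_le_of_lt (le_of_eq ?_) (h1.trans_lt hfi.2)
    refine setLIntegral_congr_fun (measurableSet_Ioi.prod measurableSet_Ioo) fun p hp => ?_
    simp only [hg, enorm_smul, smul_eq_mul]
    rw [Real.enorm_eq_ofReal (le_of_lt hp.1)]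
  have hinner : ∀ r ∈ Ioi (0 : ℝ), r ≠ ‖ζ‖ → ∫ θ in Ioo (-Real.pi) Real.pi, g (r, θ) =
      (Iio ‖ζ‖).indicator (fun r : ℝ => (r : ℂ) * (2 * Real.pi * ζ⁻¹)) r := by
    intro r hr hrζ
    rw [mem_Ioi] at hr
    by_cases hrR : r < R
    · have e : ∀ θ, g (r, θ) = r * (ζ - circleMap 0 r θ)⁻¹ := by
        intro θ
        simp only [hg, hsymm, hf]
        rw [indicator_of_mem (by simp [abs_of_pos hr, hrR]), Complex.real_smul]
      simp only [e]
      rw [← integral_Ioc_eq_integral_Ioo, ← intervalIntegral.integral_of_le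
        (by linarith [Real.pi_pos]), intervalIntegral.integral_const_mul]
      have hper : Function.Periodic (fun θ => (ζ - circleMap 0 r θ)⁻¹) (2 * Real.pi) := by
        intro θ
        simp only [periodic_circleMap 0 r θ]
      have := hper.intervalIntegral_add_eq (-Real.pi) 0
      rw [zero_add, show -Real.pi + 2 * Real.pi = Real.pi by ring] at this
      rw [this]
      rcases lt_or_gt_of_ne hrζ with hlt | hlt
      · rw [integral_inv_sub_circleMap_of_lt hr hlt, indicator_of_mem (mem_Iio.2 hlt)]
      · rw [integral_inv_sub_circleMap_of_gt hr hlt, indicator_of_notMem (by simpa using hlt.le),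
          mul_zero]
    · have e : ∀ θ, g (r, θ) = 0 := by
        intro θ
        simp only [hg, hsymm, hf]
        rw [indicator_of_notMem (by simpa [abs_of_pos hr] using hrR), smul_zero]
      simp only [e, integral_zero]
      rw [indicator_of_notMem]
      simp only [mem_Iio, not_lt]
      linarith
  calc ∫ z in Metric.ball 0 R, (ζ - z)⁻¹ = ∫ z, f z := by
        rw [hf, integral_indicator measurableSet_ball]
    _ = ∫ p in Ioi 0 ×ˢ Ioo (-Real.pi) Real.pi, g p ∂(volume.prod volume) := by
        rw [← Complex.integral_comp_polarCoord_symm, polarCoord_target]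
        rfl
    _ = ∫ r in Ioi (0 : ℝ), ∫ θ in Ioo (-Real.pi) Real.pi, g (r, θ) := setIntegral_prod g hgi
    _ = ∫ r in Ioi (0 : ℝ),
          (Iio ‖ζ‖).indicator (fun r : ℝ => (r : ℂ) * (2 * Real.pi * ζ⁻¹)) r := by
        refine integral_congr_ae ?_
        filter_upwards [ae_restrict_mem measurableSet_Ioi,
          ae_restrict_of_ae (Measure.ae_ne volume ‖ζ‖)] with r hr hne
        exact hinner r hr hne
    _ = ∫ r in (0 : ℝ)..‖ζ‖, (r : ℂ) * (2 * Real.pi * ζ⁻¹) := by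
        rw [setIntegral_indicator measurableSet_Iio, Ioi_inter_Iio, ← integral_Ioc_eq_integral_Ioo,
          intervalIntegral.integral_of_le (norm_nonneg _)]
    _ = Real.pi * starRingEnd ℂ ζ := by
        rw [intervalIntegral.integral_mul_const, intervalIntegral.integral_ofReal, integral_id]
        rcases eq_or_ne ζ 0 with rfl | h0
        · simp
        · have : ((‖ζ‖ ^ 2 : ℝ) : ℂ) = ζ * starRingEnd ℂ ζ := by
            rw [Complex.mul_conj, Complex.normSq_eq_norm_sq]
          push_cast at this ⊢
          field_simp
          rw [this]
          ring

namespace CurveNetwork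

/-! ### The area enclosed by a closed chain of arcs -/

/-- The contribution of an arc to the signed area enclosed by a closed chain. -/
def signedArea (σ : ℝ → ℂ) : ℝ := 2⁻¹ * ∫ x in (0 : ℝ)..1, (starRingEnd ℂ (σ x) * velocity σ x).im

/-- The contribution of an arc to the winding number, as a Cauchy integral. -/
def cauchyIntegral (σ : ℝ → ℂ) (z : ℂ) : ℂ := ∫ x in (0 : ℝ)..1, velocity σ x / (σ x - z)

section Arc

variable {σ : ℝ → ℂ} {R : ℝ}

lemma integrable_cauchyKernel (h : ContDiffOn ℝ 1 σ (Icc 0 1))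
    (hR : ∀ x ∈ Icc (0 : ℝ) 1, ‖σ x‖ < R) :
    Integrable (Function.uncurry fun (z : ℂ) (x : ℝ) =>
      extendedVelocity σ x / (σ (projIcc 0 1 zero_le_one x) - z))
      ((volume.restrict (Metric.ball 0 R)).prod (volume.restrict (Ioc (0 : ℝ) 1))) := by
  have hV := continuous_extendedVelocity h
  have hC : Continuous fun x : ℝ => σ (projIcc 0 1 zero_le_one x) :=
    h.continuousOn.comp_continuous (by fun_prop) fun x => (projIcc (0 : ℝ) 1 zero_le_one x).2
  have hRp : ∀ x : ℝ, ‖σ (projIcc 0 1 zero_le_one x)‖ < R := fun x => hR _ (projIcc 0 1 _ x).2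
  have hm : Measurable (Function.uncurry fun (z : ℂ) (x : ℝ) =>
      extendedVelocity σ x / (σ (projIcc 0 1 zero_le_one x) - z)) :=
    Measurable.div (hV.measurable.comp measurable_snd)
      (Measurable.sub (hC.measurable.comp measurable_snd) measurable_fst)
  rw [integrable_prod_iff' hm.aestronglyMeasurable]
  simp only [Function.uncurry_apply_pair, div_eq_mul_inv]
  refine ⟨Eventually.of_forall fun x => (integrableOn_inv_sub_ball _ R).const_mul _, ?_⟩
  obtain ⟨K, hK⟩ := exists_integral_norm_inv_sub_le R
  obtain ⟨B, hB⟩ := isCompact_Icc.exists_bound_of_continuousOn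
    (hV.continuousOn (s := Icc (0 : ℝ) 1))
  simp only [norm_mul, integral_const_mul]
  refine Integrable.of_bound (C := B * K) ?_ ?_
  · refine (hV.norm.measurable.aestronglyMeasurable).mul ?_
    have : StronglyMeasurable (Function.uncurry fun (x : ℝ) (z : ℂ) =>
        ‖(σ (projIcc 0 1 zero_le_one x) - z)⁻¹‖) :=
      (Measurable.norm (Measurable.inv (Measurable.sub (hC.measurable.comp measurable_fst)
        measurable_snd))).stronglyMeasurable
    exact this.integral_prod_right.aestronglyMeasurable
  · filter_upwards [ae_restrict_mem measurableSet_Ioc] with x hx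
    have h1 := hB x (Ioc_subset_Icc_self hx)
    have h2 := hK _ (hRp x)
    have h3 : 0 ≤ ∫ z in Metric.ball 0 R, ‖(σ (projIcc 0 1 zero_le_one x) - z)⁻¹‖ :=
      integral_nonneg fun z => norm_nonneg _
    rw [norm_mul, norm_norm, Real.norm_of_nonneg h3]
    exact mul_le_mul h1 h2 h3 ((norm_nonneg _).trans h1)

lemma cauchyIntegral_eq (z : ℂ) : cauchyIntegral σ z = ∫ x in Ioc (0 : ℝ) 1,
    extendedVelocity σ x / (σ (projIcc 0 1 zero_le_one x) - z) := by
  rw [cauchyIntegral, intervalIntegral.integral_of_le zero_le_one]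
  refine setIntegral_congr_fun measurableSet_Ioc fun x hx => ?_
  have hx' := Ioc_subset_Icc_self hx
  simp only [extendedVelocity, projIcc_of_mem zero_le_one hx']

lemma integrableOn_cauchyIntegral (h : ContDiffOn ℝ 1 σ (Icc 0 1))
    (hR : ∀ x ∈ Icc (0 : ℝ) 1, ‖σ x‖ < R) :
    IntegrableOn (cauchyIntegral σ) (Metric.ball 0 R) :=
  (integrable_cauchyKernel h hR).integral_prod_left.congr
    (Eventually.of_forall fun z => (cauchyIntegral_eq z).symm)

/-- The substitute for Green's theorem: integrating the kernel 1/(σ − z) over z first leaves π times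
the conjugate of σ. -/
lemma integral_cauchyIntegral (h : ContDiffOn ℝ 1 σ (Icc 0 1))
    (hR : ∀ x ∈ Icc (0 : ℝ) 1, ‖σ x‖ < R) :
    ∫ z in Metric.ball 0 R, (cauchyIntegral σ z).im = 2 * Real.pi * signedArea σ := by
  have h1 : ∫ z in Metric.ball 0 R, cauchyIntegral σ z =
      ∫ x in (0 : ℝ)..1, Real.pi * (starRingEnd ℂ (σ x) * velocity σ x) := by
    simp only [cauchyIntegral_eq]
    rw [integral_integral_swap (integrable_cauchyKernel h hR),
      intervalIntegral.integral_of_le zero_le_one]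
    refine setIntegral_congr_fun measurableSet_Ioc fun x hx => ?_
    have hx' := Ioc_subset_Icc_self hx
    simp only [div_eq_mul_inv, integral_const_mul]
    rw [integral_inv_sub_ball (hR _ (projIcc 0 1 _ x).2), extendedVelocity_of_mem hx',
      projIcc_of_mem zero_le_one hx']
    ring
  have h2 := congrArg Complex.im h1
  rw [intervalIntegral.integral_const_mul, ← Complex.imCLM_apply, ← Complex.imCLM_apply,
    ← ContinuousLinearMap.integral_comp_comm _ (integrableOn_cauchyIntegral h hR)] at h2
  simp only [Complex.imCLM_apply] at h2
  rw [h2, Complex.im_ofReal_mul, signedArea, ← Complex.imCLM_apply,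
    ← ContinuousLinearMap.intervalIntegral_comp_comm]
  · simp only [Complex.imCLM_apply]
    ring
  · refine ContinuousOn.intervalIntegrable ?_
    rw [uIcc_of_le zero_le_one]
    exact (Complex.continuous_conj.comp_continuousOn h.continuousOn).mul (continuousOn_velocity h)

/-- A `C¹` arc is negligible. -/
lemma volume_image_eq_zero (h : ContDiffOn ℝ 1 σ (Icc 0 1)) :
    volume (σ '' Icc 0 1) = 0 := by
  -- The arc is the image of a null segment of the plane under z ↦ σ(Re z), and differentiable maps
  -- preserve null sets.
  have h1 : volume (Complex.re ⁻¹' Icc 0 1 ∩ Complex.im ⁻¹' {0}) = 0 := by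
    rw [← Complex.volume_preserving_equiv_real_prod.symm.measure_preimage_equiv]
    have : Complex.measurableEquivRealProd.symm ⁻¹' (Complex.re ⁻¹' Icc 0 1 ∩ Complex.im ⁻¹' {0}) =
        Icc (0 : ℝ) 1 ×ˢ {(0 : ℝ)} := by
      ext p
      simp [Complex.measurableEquivRealProd]
    rw [this, Measure.volume_eq_prod, Measure.prod_prod]
    simp
  have h2 := addHaar_image_eq_zero_of_differentiableOn_of_addHaar_eq_zero (volume : Measure ℂ)
    (f := fun z : ℂ => σ z.re) (s := Complex.re ⁻¹' Icc 0 1 ∩ Complex.im ⁻¹' {0})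
    ((h.differentiableOn one_ne_zero).comp Complex.reCLM.differentiableOn fun z hz => hz.1) h1
  refine measure_mono_null ?_ h2
  rintro _ ⟨x, hx, rfl⟩
  exact ⟨(x : ℂ), ⟨by simpa using hx, by simp⟩, by simp⟩

end Arc

namespace IsArcLoop

variable {c : ℤ → ℝ → ℂ} {m : ℕ}

lemma range_concat (h : IsArcLoop c m) :
    range (concat c) = ⋃ j ∈ Finset.range m, c (j : ℤ) '' Icc 0 1 := by
  have hm : (0 : ℤ) < m := by exact_mod_cast h.pos
  ext z
  simp only [mem_range, mem_iUnion, Finset.mem_range, mem_image]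
  constructor
  · rintro ⟨t, rfl⟩
    obtain ⟨k, hk⟩ := Int.eq_ofNat_of_zero_le (Int.emod_nonneg ⌊t⌋ hm.ne')
    refine ⟨k, ?_, Int.fract t, ⟨Int.fract_nonneg _, (Int.fract_lt_one _).le⟩, ?_⟩
    · have := Int.emod_lt_of_pos ⌊t⌋ hm
      omega
    · rw [concat, ← h.periodic_mod ⌊t⌋, hk]
  · rintro ⟨k, -, x, hx, rfl⟩
    exact ⟨k + x, by exact_mod_cast h.concat_add k hx⟩

/-- The winding number as a Cauchy integral. -/
lemma winding_eq (h : IsArcLoop c m) {z : ℂ} {w : ℤ} (hw : HasWinding (concat c) m z w) :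
    ∑ j ∈ Finset.range m, (cauchyIntegral (c j) z).im = 2 * Real.pi * w := by
  have hne := hw.ne
  obtain ⟨φ, hφ, hφe, hφP⟩ := hw
  have harc : ∀ j : ℕ, cauchyIntegral (c j) z = φ ((j + 1 : ℕ) : ℝ) - φ (j : ℕ) := by
    intro j
    have hd := h.contDiffOn j
    have := log_sub_log_eq_integral (p := fun x => c j x - z) (q := velocity (c j))
      (φ := fun x => φ (j + x)) (fun x hx => (hasDerivWithinAt_velocity hd hx).sub_const z)
      (continuousOn_velocity hd) (fun x hx => by
        have := hne ((j : ℤ) + x)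
        rw [h.concat_add j hx] at this
        exact sub_ne_zero.2 this) (by fun_prop) (fun x hx => by
        rw [hφe, ← h.concat_add j hx]; simp)
    rw [cauchyIntegral, ← this]
    simp
  simp only [harc]
  rw [← Complex.im_sum, Finset.sum_range_sub (fun j : ℕ => φ (j : ℝ))]
  have := hφP 0
  rw [zero_add] at this
  rw [this]
  simp
  ring

/-- The signed area of a closed chain of arcs has the sign of its rotation number, and is at most
the area of the set of the points with nonzero winding number. -/
theorem signedArea_bounds (h : IsArcLoop c m) {θ : ℝ × ℝ → ℂ} {ρ : ℤ}
    (hθ : IsSecantLog (concat c) m θ ρ) (hρ : ρ = 1 ∨ ρ = -1) :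
    0 ≤ ρ * ∑ j ∈ Finset.range m, signedArea (c j) ∧
    ∀ E : Set ℂ, volume E ≠ ⊤ →
      (∀ z w, HasWinding (concat c) m z w → w ≠ 0 → z ∈ E) →
      ρ * ∑ j ∈ Finset.range m, signedArea (c j) ≤ volume.real E := by
  have hG := h.simpleClosed
  obtain ⟨R, hR⟩ : ∃ R, ∀ t, ‖concat c t‖ < R := by
    have hc := h.continuous_concat
    obtain ⟨s, hs⟩ := exists_forall_le_of_periodic hG.pos (f := fun t => -‖concat c t‖)
      (by fun_prop) (fun t => by simp only [hG.periodic])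
    exact ⟨‖concat c s‖ + 1, fun t => by linarith [hs t]⟩
  have hRj : ∀ j : ℕ, ∀ x ∈ Icc (0 : ℝ) 1, ‖c j x‖ < R := fun j x hx => by
    rw [← h.concat_add j hx]; exact hR _
  -- Off the curve, a null set, `W` is the winding number, so ρW takes only the values 0 and 1; its
  -- integral is ρ times the signed area.
  set W : ℂ → ℝ := fun z => (2 * Real.pi)⁻¹ *
    ∑ j ∈ Finset.range m, (cauchyIntegral (c j) z).im with hW
  have hint : ∀ j : ℕ, IntegrableOn (fun z => (cauchyIntegral (c j) z).im) (Metric.ball 0 R) :=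
    fun j => (integrableOn_cauchyIntegral (h.contDiffOn j) (hRj j)).im
  have hWi : IntegrableOn W (Metric.ball 0 R) :=
    (integrable_finsetSum _ fun j _ => hint j).const_mul _
  have hWint : ∫ z in Metric.ball 0 R, W z = ∑ j ∈ Finset.range m, signedArea (c j) := by
    rw [hW, integral_const_mul, integral_finsetSum _ fun (j : ℕ) _ => hint j]
    simp only [integral_cauchyIntegral (h.contDiffOn _) (hRj _)]
    rw [← Finset.mul_sum, ← mul_assoc, inv_mul_cancel₀ (by positivity), one_mul]
  have hnull : volume (range (concat c)) = 0 := by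
    rw [h.range_concat]
    exact (measure_biUnion_null_iff (Finset.range m).countable_toSet).2
      fun j _ => volume_image_eq_zero (h.contDiffOn j)
  have hae : ∀ᵐ z, z ∉ range (concat c) := by
    exact measure_eq_zero_iff_ae_notMem.1 hnull
  have hval : ∀ z ∉ range (concat c), (ρ * W z = 0 ∨ ρ * W z = 1) ∧
      (ρ * W z ≠ 0 → ∃ w, HasWinding (concat c) m z w ∧ w ≠ 0) := by
    intro z hz
    obtain ⟨w, hw⟩ := exists_hasWinding h.continuous_concat h.concat_periodic (z := z)
      (fun t ht => hz ⟨t, ht⟩)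
    have e : W z = w := by
      rw [hW]
      simp only
      rw [h.winding_eq hw, ← mul_assoc, inv_mul_cancel₀ (by positivity), one_mul]
    rw [e]
    refine ⟨?_, fun h0 => ⟨w, hw, fun h1 => h0 (by simp [h1])⟩⟩
    rcases hG.winding_mem hθ hρ hw with rfl | rfl
    · left; simp
    · right; rcases hρ with rfl | rfl <;> simp
  rw [← hWint, ← integral_const_mul]
  refine ⟨?_, fun E hE hsub => ?_⟩
  · refine integral_nonneg_of_ae (ae_restrict_of_ae ?_)
    filter_upwards [hae] with z hz
    rcases (hval z hz).1 with h0 | h0 <;> simp [h0]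
  · have hEm := measurableSet_toMeasurable volume E
    have hEt : volume (toMeasurable volume E) ≠ ⊤ := by rwa [measure_toMeasurable]
    calc ∫ z in Metric.ball 0 R, ρ * W z
        ≤ ∫ z in Metric.ball 0 R, (toMeasurable volume E).indicator 1 z := by
          refine integral_mono_ae (hWi.const_mul _) ?_ (ae_restrict_of_ae ?_)
          · exact ((integrable_indicator_iff hEm).2 (integrableOn_const hEt)).integrableOn
          · filter_upwards [hae] with z hz
            obtain ⟨h0, h1⟩ := hval z hz
            rcases h0 with h0 | h0
            · rw [h0]
              exact indicator_nonneg (fun _ _ => zero_le_one) z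
            · obtain ⟨w, hw, hw0⟩ := h1 (by rw [h0]; exact one_ne_zero)
              rw [h0, indicator_of_mem (subset_toMeasurable _ _ (hsub z w hw hw0))]
              rfl
      _ ≤ volume.real E := by
          rw [integral_indicator_one hEm, measureReal_def, measureReal_def,
            ← measure_toMeasurable E]
          exact ENNReal.toReal_mono hEt (Measure.restrict_apply_le _ _)

end IsArcLoop

end CurveNetwork

namespace CurveNetwork

/-! ### Jordan curves in a union of arcs -/

namespace IsJordanCurve

variable {Γ : Set ℂ}

/-- Rotating the circle puts the base point anywhere, so that removing `p` leaves the image of an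
open interval. -/
lemma exists_param (hΓ : IsJordanCurve Γ) {p : ℂ} (hp : p ∈ Γ) :
    ∃ g : ℝ → ℂ, Continuous g ∧ g 0 = p ∧ g 1 = p ∧ InjOn g (Ico 0 1) ∧ g '' Icc 0 1 = Γ := by
  obtain ⟨f, hf, hinj, rfl⟩ := hΓ
  obtain ⟨a, rfl⟩ := hp
  refine ⟨fun x => f (a * Circle.exp (2 * Real.pi * x)), by fun_prop, by simp, by simp, ?_, ?_⟩
  · intro x hx y hy hxy
    have h1 := mul_left_cancel (hinj hxy)
    rw [Circle.exp_eq_exp] at h1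
    obtain ⟨n, hn⟩ := h1
    have h2 : x = y + n := by
      have := Real.pi_pos
      have h3 : 2 * Real.pi * (x - (y + n)) = 0 := by linear_combination hn
      rcases mul_eq_zero.1 h3 with h4 | h4
      · linarith
      · linarith
    have h3 : (-1 : ℝ) < n := by linarith [hx.1, hy.2]
    have h4 : (n : ℝ) < 1 := by linarith [hx.2, hy.1]
    have h5 : -1 < n := by exact_mod_cast h3
    have h6 : n < 1 := by exact_mod_cast h4
    have h7 : n = 0 := by omega
    rw [h2, h7]; simp
  · ext z
    constructor
    · rintro ⟨x, -, rfl⟩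
      exact ⟨_, rfl⟩
    · rintro ⟨b, rfl⟩
      obtain ⟨x, hx⟩ : ∃ x : ℝ, Circle.exp x = a⁻¹ * b := ⟨_, Circle.exp_arg _⟩
      have hper : Function.Periodic (fun x : ℝ => Circle.exp (2 * Real.pi * x)) 1 := by
        intro x
        simp only [mul_add, mul_one]
        exact Circle.periodic_exp _
      obtain ⟨y, hy, hxy⟩ := hper.exists_mem_Ico₀ one_pos (x / (2 * Real.pi))
      refine ⟨y, Ico_subset_Icc_self hy, ?_⟩
      simp only at hxy ⊢
      rw [← hxy, mul_div_cancel₀ _ (by positivity), hx, mul_inv_cancel_left]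

lemma isPreconnected_diff_singleton (hΓ : IsJordanCurve Γ) {p : ℂ} (hp : p ∈ Γ) :
    IsPreconnected (Γ \ {p}) ∧ p ∈ closure (Γ \ {p}) := by
  obtain ⟨g, hg, h0, h1, hinj, himg⟩ := hΓ.exists_param hp
  have : Γ \ {p} = g '' Ioo 0 1 := by
    ext z
    simp only [← himg, Set.mem_sdiff, mem_image, mem_singleton_iff]
    constructor
    · rintro ⟨⟨x, hx, rfl⟩, hne⟩
      refine ⟨x, ⟨hx.1.lt_of_ne ?_, hx.2.lt_of_ne ?_⟩, rfl⟩
      · rintro rfl; exact hne h0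
      · rintro rfl; exact hne h1
    · rintro ⟨x, hx, rfl⟩
      refine ⟨⟨x, Ioo_subset_Icc_self hx, rfl⟩, fun h => ?_⟩
      have := hinj (Ioo_subset_Ico_self hx) ⟨le_rfl, one_pos⟩ (h.trans h0.symm)
      exact hx.1.ne' this
  rw [this]
  refine ⟨isPreconnected_Ioo.image g hg.continuousOn, ?_⟩
  rw [← h0]
  refine image_closure_subset_closure_image hg ⟨0, ?_, rfl⟩
  rw [closure_Ioo (by norm_num)]
  simp

lemma not_isPreconnected_diff_pair (hΓ : IsJordanCurve Γ) {p q : ℂ} (hp : p ∈ Γ) (hq : q ∈ Γ)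
    (hpq : p ≠ q) : ¬IsPreconnected (Γ \ {p, q}) := by
  obtain ⟨g, hg, h0, h1, hinj, himg⟩ := hΓ.exists_param hp
  intro hpre
  rw [← himg] at hq
  obtain ⟨φ, hφ, rfl⟩ := hq
  have hφ0 : 0 < φ := hφ.1.lt_of_ne (by rintro rfl; exact hpq h0.symm)
  have hφ1 : φ < 1 := hφ.2.lt_of_ne (by rintro rfl; exact hpq h1.symm)
  rw [isPreconnected_closed_iff] at hpre
  have hne : ∀ x ∈ Ioo (0 : ℝ) 1, x ≠ φ → g x ∈ Γ \ {p, g φ} := by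
    intro x hx hxφ
    refine ⟨himg ▸ ⟨x, Ioo_subset_Icc_self hx, rfl⟩, ?_⟩
    rintro (h | h)
    · exact hx.1.ne' (hinj (Ioo_subset_Ico_self hx) ⟨le_rfl, one_pos⟩ (h.trans h0.symm))
    · exact hxφ (hinj (Ioo_subset_Ico_self hx) ⟨hφ0.le, hφ1⟩ h)
  obtain ⟨z, ⟨-, hz⟩, ⟨x, hx, rfl⟩, y, hy, hxy⟩ := hpre (g '' Icc 0 φ) (g '' Icc φ 1)
    (isCompact_Icc.image hg).isClosed (isCompact_Icc.image hg).isClosed (by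
      rintro z ⟨hz, -⟩
      rw [← himg] at hz
      obtain ⟨x, hx, rfl⟩ := hz
      rcases le_total x φ with h | h
      · exact Or.inl ⟨x, ⟨hx.1, h⟩, rfl⟩
      · exact Or.inr ⟨x, ⟨h, hx.2⟩, rfl⟩)
    ⟨g (φ / 2), hne _ ⟨by linarith, by linarith⟩ (by linarith), φ / 2,
      ⟨by linarith, by linarith⟩, rfl⟩
    ⟨g ((φ + 1) / 2), hne _ ⟨by linarith, by linarith⟩ (by linarith), (φ + 1) / 2,
      ⟨by linarith, by linarith⟩, rfl⟩
  simp only [mem_insert_iff, mem_singleton_iff, not_or] at hz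
  have hy1 : y < 1 := hy.2.lt_of_ne (by rintro rfl; exact hz.1 (hxy.symm.trans h1))
  have := hinj (x₁ := x) (x₂ := y) ⟨hx.1, hx.2.trans_lt hφ1⟩ ⟨hφ0.le.trans hy.1, hy1⟩ hxy.symm
  have hxφ : x = φ := le_antisymm hx.2 (by rw [this]; exact hy.1)
  exact hz.2 (by rw [hxφ])

lemma isClosed (hΓ : IsJordanCurve Γ) : IsClosed Γ := by
  obtain ⟨f, hf, -, rfl⟩ := hΓ
  exact (isCompact_range hf).isClosed

lemma nonempty (hΓ : IsJordanCurve Γ) : Γ.Nonempty := by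
  obtain ⟨f, -, -, rfl⟩ := hΓ
  exact range_nonempty f

/-- A Jordan curve has no free end. -/
lemma not_free_end (hΓ : IsJordanCurve Γ) {σ : ℝ → ℂ} {a e : ℝ} (hae : a < e)
    (hσ : ContinuousOn σ (Icc a e)) (hinj : InjOn σ (Ioc a e)) (he : σ e ∈ Γ)
    (hopen : ∀ x ∈ Ico a e, ∃ U, IsOpen U ∧ U ∩ Γ = σ '' Ioc x e ∩ Γ) : False := by
  have pick : ∀ x ∈ Ico a e, ∃ y ∈ Ioo x e, σ y ∈ Γ := by
    intro x hx
    obtain ⟨U, hU, hUΓ⟩ := hopen x hx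
    have heU : σ e ∈ U := by
      have : σ e ∈ U ∩ Γ := by rw [hUΓ]; exact ⟨⟨e, ⟨hx.2, le_rfl⟩, rfl⟩, he⟩
      exact this.1
    obtain ⟨q, hqU, hqΓ, hqe⟩ :=
      mem_closure_iff.1 (hΓ.isPreconnected_diff_singleton he).2 U hU heU
    have : q ∈ σ '' Ioc x e ∩ Γ := by rw [← hUΓ]; exact ⟨hqU, hqΓ⟩
    obtain ⟨⟨y, hy, rfl⟩, -⟩ := this
    exact ⟨y, ⟨hy.1, hy.2.lt_of_ne (by rintro rfl; exact hqe rfl)⟩, hqΓ⟩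
  obtain ⟨x₁, h₁, hx₁⟩ := pick a ⟨le_rfl, hae⟩
  obtain ⟨x₂, h₂, hx₂⟩ := pick x₁ ⟨h₁.1.le, h₁.2⟩
  have ha₂ : a < x₂ := h₁.1.trans h₂.1
  obtain ⟨U, hU, hUΓ⟩ := hopen x₂ ⟨ha₂.le, h₂.2⟩
  have hV : IsOpen (σ '' Icc x₂ e)ᶜ :=
    (isCompact_Icc.image_of_continuousOn (hσ.mono (Icc_subset_Icc_left ha₂.le))).isClosed.isOpen_compl
  have hmem : ∀ x ∈ Ioc x₂ e, σ x ∈ Γ → σ x ∈ U := by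
    intro x hx hxΓ
    have : σ x ∈ U ∩ Γ := by rw [hUΓ]; exact ⟨⟨x, hx, rfl⟩, hxΓ⟩
    exact this.1
  -- Without σ x₂, the part of Γ on the arc beyond x₂ is open and closed; it contains σ e and not σ
  -- x₁, yet one point does not separate a Jordan curve.
  obtain ⟨z, ⟨hzΓ, -⟩, hzU, hzV⟩ := (hΓ.isPreconnected_diff_singleton hx₂).1 U _ hU hV (by
      rintro z ⟨hzΓ, hz⟩
      by_cases hzI : z ∈ σ '' Icc x₂ e
      · obtain ⟨x, hx, rfl⟩ := hzI
        refine Or.inl (hmem x ⟨hx.1.lt_of_ne ?_, hx.2⟩ hzΓ)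
        rintro rfl
        exact hz rfl
      · exact Or.inr hzI)
    ⟨σ e, ⟨he, fun h => h₂.2.ne' (hinj ⟨hae, le_rfl⟩ ⟨ha₂, h₂.2.le⟩ h)⟩,
      hmem e ⟨h₂.2, le_rfl⟩ he⟩
    ⟨σ x₁, ⟨hx₁, fun h => h₂.1.ne (hinj ⟨h₁.1, h₁.2.le⟩ ⟨ha₂, h₂.2.le⟩ h)⟩, by
      rintro ⟨x, hx, hxx⟩
      have := hinj ⟨ha₂.trans_le hx.1, hx.2⟩ ⟨h₁.1, h₁.2.le⟩ hxx
      linarith [hx.1, h₂.1]⟩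
  have : z ∈ σ '' Ioc x₂ e ∩ Γ := by rw [← hUΓ]; exact ⟨hzU, hzΓ⟩
  obtain ⟨⟨x, hx, rfl⟩, -⟩ := this
  exact hzV ⟨x, Ioc_subset_Icc_self hx, rfl⟩

end IsJordanCurve

/-- A finite family of arcs and closed curves that meet only at their ends. -/
structure IsArcSystem {n : ℕ} (σ : Fin n → ℝ → ℂ) : Prop where
  continuousOn : ∀ i, ContinuousOn (σ i) (Icc 0 1)
  embedded : ∀ i, ∀ x ∈ Icc (0 : ℝ) 1, ∀ y ∈ Icc (0 : ℝ) 1, x < y → σ i x = σ i y →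
    x = 0 ∧ y = 1
  inter : ∀ i j, i ≠ j → ∀ x ∈ Icc (0 : ℝ) 1, ∀ y ∈ Icc (0 : ℝ) 1, σ i x = σ j y →
    (x = 0 ∨ x = 1) ∧ (y = 0 ∨ y = 1)

namespace IsArcSystem

variable {n : ℕ} {σ : Fin n → ℝ → ℂ} {Γ : Set ℂ}

lemma reverse (h : IsArcSystem σ) : IsArcSystem fun i x => σ i (1 - x) where
  continuousOn i := (h.continuousOn i).comp (by fun_prop)
    fun x hx => ⟨by linarith [hx.2], by linarith [hx.1]⟩
  embedded i x hx y hy hxy he := by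
    obtain ⟨h1, h2⟩ := h.embedded i (1 - y) ⟨by linarith [hy.2], by linarith [hy.1]⟩ (1 - x)
      ⟨by linarith [hx.2], by linarith [hx.1]⟩ (by linarith) he.symm
    constructor <;> linarith
  inter i j hij x hx y hy he := by
    obtain ⟨h1, h2⟩ := h.inter i j hij (1 - x) ⟨by linarith [hx.2], by linarith [hx.1]⟩ (1 - y)
      ⟨by linarith [hy.2], by linarith [hy.1]⟩ he
    constructor
    · rcases h1 with h1 | h1
      · right; linarith
      · left; linarith
    · rcases h2 with h2 | h2
      · right; linarith
      · left; linarith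

lemma support_reverse : support (fun i x => σ i (1 - x)) = support σ := by
  have : ∀ i, (fun x => σ i (1 - x)) '' Icc 0 1 = σ i '' Icc 0 1 := by
    intro i
    rw [← image_image (σ i) (fun x : ℝ => 1 - x)]
    simp
  simp only [support, this]

lemma isCompact_image (h : IsArcSystem σ) (i : Fin n) : IsCompact (σ i '' Icc 0 1) :=
  isCompact_Icc.image_of_continuousOn (h.continuousOn i)

lemma isClosed_others (h : IsArcSystem σ) (i : Fin n) :
    IsClosed (⋃ j ∈ ({i}ᶜ : Set (Fin n)), σ j '' Icc 0 1) :=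
  (toFinite ({i}ᶜ : Set (Fin n))).isClosed_biUnion fun j _ => (h.isCompact_image j).isClosed

lemma eq_of_mem_Ioo (h : IsArcSystem σ) {i j : Fin n} {x y : ℝ} (hx : x ∈ Ioo (0 : ℝ) 1)
    (hy : y ∈ Icc (0 : ℝ) 1) (he : σ i x = σ j y) : i = j ∧ x = y := by
  obtain rfl : i = j := by
    by_contra hij
    rcases (h.inter i j hij x (Ioo_subset_Icc_self hx) y hy he).1 with rfl | rfl
    · exact lt_irrefl _ hx.1
    · exact lt_irrefl _ hx.2
  refine ⟨rfl, ?_⟩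
  rcases lt_trichotomy x y with hlt | heq | hlt
  · have := (h.embedded i x (Ioo_subset_Icc_self hx) y hy hlt he).1
    linarith [hx.1]
  · exact heq
  · have := (h.embedded i y hy x (Ioo_subset_Icc_self hx) hlt he.symm).2
    linarith [hx.2]

/-- If Γ missed a later point `y` of the arc, its last point before `y` would be a free end of Γ. -/
lemma forall_mem_of_le (h : IsArcSystem σ) (hΓ : IsJordanCurve Γ) (hsub : Γ ⊆ support σ)
    {i : Fin n} {x : ℝ} (hx : x ∈ Ioo (0 : ℝ) 1) (hxΓ : σ i x ∈ Γ) :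
    ∀ y, x ≤ y → y ≤ 1 → σ i y ∈ Γ := by
  intro y hxy hy1
  by_contra hyΓ
  have hc : IsCompact (Icc x y ∩ σ i ⁻¹' Γ) := by
    have : ContinuousOn (σ i) (Icc x y) :=
      (h.continuousOn i).mono (Icc_subset_Icc hx.1.le hy1)
    exact isCompact_Icc.of_isClosed_subset
      (this.preimage_isClosed_of_isClosed isClosed_Icc hΓ.isClosed) inter_subset_left
  obtain ⟨e, ⟨he, heΓ⟩, hmax⟩ := hc.exists_isGreatest ⟨x, ⟨le_rfl, hxy⟩, hxΓ⟩
  have hey : e < y := he.2.lt_of_ne (by rintro rfl; exact hyΓ heΓ)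
  have he0 : 0 < e := hx.1.trans_le he.1
  refine hΓ.not_free_end (σ := σ i) he0
    ((h.continuousOn i).mono (Icc_subset_Icc_right (by linarith))) ?_ heΓ ?_
  · intro a ha b hb hab
    exact (h.eq_of_mem_Ioo ⟨ha.1, by linarith [ha.2]⟩ ⟨hb.1.le, by linarith [hb.2]⟩ hab).2
  · intro a ha
    refine ⟨(σ i '' Icc 0 a ∪ σ i '' Icc y 1 ∪ ⋃ j ∈ ({i}ᶜ : Set (Fin n)), σ j '' Icc 0 1)ᶜ,
      IsClosed.isOpen_compl (self := ?_), ?_⟩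
    · refine (IsClosed.union ?_ ?_).union (h.isClosed_others i)
      · exact (isCompact_Icc.image_of_continuousOn ((h.continuousOn i).mono
          (Icc_subset_Icc_right (by linarith [ha.2])))).isClosed
      · exact (isCompact_Icc.image_of_continuousOn ((h.continuousOn i).mono
          (Icc_subset_Icc_left (by linarith)))).isClosed
    · ext z
      simp only [mem_inter_iff, mem_compl_iff, mem_union, not_or, mem_iUnion, mem_singleton_iff,
        not_exists]
      refine and_congr_left fun hz => ⟨?_, ?_⟩
      · rintro ⟨⟨h1, h2⟩, h3⟩
        obtain ⟨j, b, hb, rfl⟩ := mem_iUnion.1 (hsub hz)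
        obtain rfl : j = i := by
          by_contra hj
          exact h3 j hj ⟨b, hb, rfl⟩
        have hab : a < b := by
          by_contra! hle
          exact h1 ⟨b, ⟨hb.1, hle⟩, rfl⟩
        have hby : b < y := by
          by_contra! hle
          exact h2 ⟨b, ⟨hle, hb.2⟩, rfl⟩
        refine ⟨b, ⟨hab, ?_⟩, rfl⟩
        rcases le_total x b with hxb | hbx
        · exact hmax ⟨⟨hxb, hby.le⟩, hz⟩
        · exact hbx.trans he.1
      · rintro ⟨b, hb, rfl⟩
        have hb' : b ∈ Ioo (0 : ℝ) 1 := ⟨ha.1.trans_lt hb.1, by linarith [hb.2]⟩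
        refine ⟨⟨?_, ?_⟩, ?_⟩
        · rintro ⟨d, hd, hdb⟩
          have := (h.eq_of_mem_Ioo hb' ⟨hd.1, by linarith [hd.2, hb.1, hb'.2]⟩ hdb.symm).2
          linarith [hd.2, hb.1]
        · rintro ⟨d, hd, hdb⟩
          have := (h.eq_of_mem_Ioo hb' ⟨by linarith [hd.1], hd.2⟩ hdb.symm).2
          linarith [hd.1, hb.2]
        · rintro j hj ⟨d, hd, hdb⟩
          exact hj (h.eq_of_mem_Ioo hb' hd hdb.symm).1.symm

/-- A Jordan curve that meets the interior of an arc contains the arc. -/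
lemma image_subset (h : IsArcSystem σ) (hΓ : IsJordanCurve Γ) (hsub : Γ ⊆ support σ)
    {i : Fin n} {x : ℝ} (hx : x ∈ Ioo (0 : ℝ) 1) (hxΓ : σ i x ∈ Γ) : σ i '' Icc 0 1 ⊆ Γ := by
  rintro _ ⟨y, hy, rfl⟩
  rcases le_total x y with hxy | hyx
  · exact h.forall_mem_of_le hΓ hsub hx hxΓ y hxy hy.2
  · have := h.reverse.forall_mem_of_le hΓ (by rwa [support_reverse]) (i := i) (x := 1 - x)
      ⟨by linarith [hx.2], by linarith [hx.1]⟩ (by simpa using hxΓ) (1 - y) (by linarith)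
      (by linarith [hy.1])
    simpa using this

/-- A Jordan curve in a system of arcs is a union of arcs. -/
lemma exists_eq_biUnion (h : IsArcSystem σ) (hΓ : IsJordanCurve Γ) (hsub : Γ ⊆ support σ) :
    ∃ J : Finset (Fin n), Γ = ⋃ i ∈ J, σ i '' Icc 0 1 := by
  classical
  set J : Finset (Fin n) := Finset.univ.filter fun i => ∃ x ∈ Ioo (0 : ℝ) 1, σ i x ∈ Γ with hJ
  have hJΓ : (⋃ i ∈ J, σ i '' Icc 0 1) ⊆ Γ := by
    refine iUnion₂_subset fun i hi => ?_
    obtain ⟨x, hx, hxΓ⟩ := (Finset.mem_filter.1 hi).2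
    exact h.image_subset hΓ hsub hx hxΓ
  refine ⟨J, (Subset.antisymm hJΓ fun p hp => ?_).symm⟩
  by_contra hpJ
  set F : Set ℂ := (range fun e : Fin n × Bool => σ e.1 (endParam e.2)) \ {p} with hF
  have hFfin : F.Finite := (finite_range _).subset sdiff_subset
  have hU : IsOpen ((⋃ i ∈ J, σ i '' Icc 0 1) ∪ F)ᶜ := by
    refine (IsClosed.union ?_ hFfin.isClosed).isOpen_compl
    exact (Finset.finite_toSet J).isClosed_biUnion fun i _ => (h.isCompact_image i).isClosed
  -- A point of Γ on no arc of `J` would be an end of an arc. It is not isolated in Γ, but near it Γ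
  -- could contain only other points of the same kind, and these are finitely many.
  obtain ⟨q, hqU, hqΓ, hqp⟩ :=
    mem_closure_iff.1 (hΓ.isPreconnected_diff_singleton hp).2 _ hU (by
      rintro (h1 | h1)
      · exact hpJ h1
      · exact h1.2 rfl)
  apply hqU
  obtain ⟨i, x, hx, rfl⟩ := mem_iUnion.1 (hsub hqΓ)
  rcases hx.1.eq_or_lt with rfl | h0
  · exact Or.inr ⟨⟨(i, false), rfl⟩, hqp⟩
  rcases hx.2.eq_or_lt with rfl | h1
  · exact Or.inr ⟨⟨(i, true), rfl⟩, hqp⟩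
  refine Or.inl (mem_biUnion (x := i) ?_ ⟨x, hx, rfl⟩)
  exact Finset.mem_filter.2 ⟨Finset.mem_univ _, x, ⟨h0, h1⟩, hqΓ⟩

/-- A Jordan curve in a system of arcs contains no arc with a free end. -/
lemma not_mem_of_free (h : IsArcSystem σ) (hΓ : IsJordanCurve Γ) (hsub : Γ ⊆ support σ)
    {i : Fin n} (hi : ∀ j c, (j, c) ≠ (i, true) → σ j (endParam c) ≠ σ i 1) : σ i 1 ∉ Γ := by
  intro hΓ1
  have h1 : ∀ j, ∀ y ∈ Icc (0 : ℝ) 1, σ j y = σ i 1 → j = i ∧ y = 1 := by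
    intro j y hy he
    rcases hy.1.eq_or_lt with rfl | h0
    · exact absurd he (hi j false (by simp))
    rcases hy.2.eq_or_lt with rfl | h1
    · refine ⟨?_, rfl⟩
      by_contra hj
      exact hi j true (by simpa using hj) he
    · exact h.eq_of_mem_Ioo ⟨h0, h1⟩ (by simp) he
  refine hΓ.not_free_end (σ := σ i) one_pos (h.continuousOn i) ?_ hΓ1 ?_
  · intro a ha b hb hab
    rcases ha.2.eq_or_lt with rfl | ha1
    · exact (h1 i b (Ioc_subset_Icc_self hb) hab.symm).2.symm
    · exact (h.eq_of_mem_Ioo ⟨ha.1, ha1⟩ (Ioc_subset_Icc_self hb) hab).2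
  · intro a ha
    refine ⟨(σ i '' Icc 0 a ∪ ⋃ j ∈ ({i}ᶜ : Set (Fin n)), σ j '' Icc 0 1)ᶜ,
      IsClosed.isOpen_compl (self := ?_), ?_⟩
    · refine IsClosed.union ?_ (h.isClosed_others i)
      exact (isCompact_Icc.image_of_continuousOn ((h.continuousOn i).mono
          (Icc_subset_Icc_right ha.2.le))).isClosed
    · ext z
      simp only [mem_inter_iff, mem_compl_iff, mem_union, not_or, mem_iUnion, mem_singleton_iff,
        not_exists]
      refine and_congr_left fun hz => ⟨?_, ?_⟩
      · rintro ⟨h2, h3⟩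
        obtain ⟨j, b, hb, rfl⟩ := mem_iUnion.1 (hsub hz)
        obtain rfl : j = i := by
          by_contra hj
          exact h3 j hj ⟨b, hb, rfl⟩
        refine ⟨b, ⟨?_, hb.2⟩, rfl⟩
        by_contra! hle
        exact h2 ⟨b, ⟨hb.1, hle⟩, rfl⟩
      · rintro ⟨b, hb, rfl⟩
        have hb0 : 0 < b := ha.1.trans_lt hb.1
        have key : ∀ j, ∀ d ∈ Icc (0 : ℝ) 1, σ j d = σ i b → j = i ∧ d = b := by
          intro j d hd he
          rcases hb.2.eq_or_lt with rfl | hb1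
          · exact h1 j d hd he
          · have := h.eq_of_mem_Ioo ⟨hb0, hb1⟩ hd he.symm
            exact ⟨this.1.symm, this.2.symm⟩
        refine ⟨?_, ?_⟩
        · rintro ⟨d, hd, hdb⟩
          have := (key i d ⟨hd.1, hd.2.trans ha.2.le⟩ hdb).2
          linarith [hd.2, hb.1]
        · rintro j hj ⟨d, hd, hdb⟩
          exact hj (key j d hd hdb).1

/-- If a Jordan curve contains a closed curve of a system of arcs, it is that curve. -/
lemma eq_singleton_of_closed (h : IsArcSystem σ) (hΓ : IsJordanCurve Γ) {J : Finset (Fin n)}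
    (hJ : Γ = ⋃ i ∈ J, σ i '' Icc 0 1) {i : Fin n} (hi : i ∈ J) (hcl : σ i 0 = σ i 1) :
    J = {i} := by
  have hmem : ∀ k ∈ J, ∀ x ∈ Icc (0 : ℝ) 1, σ k x ∈ Γ := fun k hk x hx => by
    rw [hJ]; exact mem_biUnion hk ⟨x, hx, rfl⟩
  rw [Finset.eq_singleton_iff_unique_mem]
  refine ⟨hi, fun j hj => ?_⟩
  by_contra hji
  have half : (1 / 2 : ℝ) ∈ Ioo (0 : ℝ) 1 := by norm_num
  have hne : ∀ k, σ k (1 / 2) ≠ σ i 0 := fun k he => by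
    have := (h.eq_of_mem_Ioo half (by simp) he).2
    norm_num at this
  -- Once its base point is removed, the closed curve meets no other arc, so another arc in Γ would
  -- disconnect Γ minus that point.
  obtain ⟨z, ⟨hzΓ, -⟩, hzU, hzV⟩ := (hΓ.isPreconnected_diff_singleton (hmem i hi 0 (by simp))).1
    _ _ (h.isClosed_others i).isOpen_compl (h.isCompact_image i).isClosed.isOpen_compl (by
      rintro z ⟨hz, hz0⟩
      by_cases hzi : z ∈ σ i '' Icc 0 1
      · left
        obtain ⟨x, hx, rfl⟩ := hzi
        have hx' : x ∈ Ioo (0 : ℝ) 1 := by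
          refine ⟨hx.1.lt_of_ne ?_, hx.2.lt_of_ne ?_⟩
          · rintro rfl; exact hz0 rfl
          · rintro rfl; exact hz0 hcl.symm
        simp only [mem_compl_iff, mem_iUnion, not_exists, mem_singleton_iff]
        rintro k hk ⟨y, hy, hyx⟩
        exact hk (h.eq_of_mem_Ioo hx' hy hyx.symm).1.symm
      · exact Or.inr hzi)
    ⟨σ i (1 / 2), ⟨hmem i hi _ (Ioo_subset_Icc_self half), hne i⟩, by
      simp only [mem_compl_iff, mem_iUnion, not_exists, mem_singleton_iff]
      rintro k hk ⟨y, hy, hyx⟩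
      exact hk (h.eq_of_mem_Ioo half hy hyx.symm).1.symm⟩
    ⟨σ j (1 / 2), ⟨hmem j hj _ (Ioo_subset_Icc_self half), hne j⟩, by
      rintro ⟨y, hy, hyx⟩
      exact hji (h.eq_of_mem_Ioo half hy hyx.symm).1⟩
  rw [hJ] at hzΓ
  obtain ⟨k, hk, hkz⟩ := mem_iUnion₂.1 hzΓ
  by_cases hki : k = i
  · subst hki; exact hzV hkz
  · exact hzU (mem_biUnion (x := k) hki hkz)

/-- A Jordan curve that is a union of arcs with the same two ends consists of two arcs. -/
lemma card_eq_two (h : IsArcSystem σ) (hΓ : IsJordanCurve Γ) {J : Finset (Fin n)}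
    (hJ : Γ = ⋃ i ∈ J, σ i '' Icc 0 1) {O : Fin 2 → ℂ} (hO : O 0 ≠ O 1)
    (hends : ∀ i ∈ J, ∃ p q : Fin 2, p ≠ q ∧ σ i 0 = O p ∧ σ i 1 = O q) : J.card = 2 := by
  have hmem : ∀ k ∈ J, ∀ x ∈ Icc (0 : ℝ) 1, σ k x ∈ Γ := fun k hk x hx => by
    rw [hJ]; exact mem_biUnion hk ⟨x, hx, rfl⟩
  have half : (1 / 2 : ℝ) ∈ Ioo (0 : ℝ) 1 := by norm_num
  have hOmem : ∀ i ∈ J, ∀ r : Fin 2, O r ∈ σ i '' Icc 0 1 := by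
    intro i hi r
    obtain ⟨p, q, hpq, h0, h1⟩ := hends i hi
    rcases eq_or_ne r p with rfl | hr
    · exact ⟨0, by simp, h0⟩
    · have : r = q := by omega
      subst this
      exact ⟨1, by simp, h1⟩
  -- An arc with distinct ends is separated by its midpoint.
  have hne1 : J.card ≠ 1 := by
    intro h1
    obtain ⟨i, rfl⟩ := Finset.card_eq_one.1 h1
    simp only [Finset.mem_singleton, iUnion_iUnion_eq_left] at hJ
    have hi : i ∈ ({i} : Finset (Fin n)) := Finset.mem_singleton_self i
    have hpre := (hΓ.isPreconnected_diff_singleton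
      (hmem i hi _ (Ioo_subset_Icc_self half))).1
    rw [isPreconnected_closed_iff] at hpre
    have hcl : ∀ a b : ℝ, 0 ≤ a → b ≤ 1 → IsClosed (σ i '' Icc a b) := fun a b ha hb =>
      (isCompact_Icc.image_of_continuousOn
        ((h.continuousOn i).mono (Icc_subset_Icc ha hb))).isClosed
    obtain ⟨z, ⟨-, hz⟩, ⟨x, hx, rfl⟩, y, hy, hxy⟩ := hpre (σ i '' Icc 0 (1 / 2))
      (σ i '' Icc (1 / 2) 1) (hcl _ _ le_rfl (by norm_num)) (hcl _ _ (by norm_num) le_rfl) (by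
        rintro z ⟨hz, -⟩
        rw [hJ] at hz
        obtain ⟨x, hx, rfl⟩ := hz
        rcases le_total x (1 / 2) with h | h
        · exact Or.inl ⟨x, ⟨hx.1, h⟩, rfl⟩
        · exact Or.inr ⟨x, ⟨h, hx.2⟩, rfl⟩)
      ⟨σ i 0, ⟨hmem i hi 0 (by simp), fun he => by
        have := (h.eq_of_mem_Ioo half (by simp) (Eq.symm he)).2
        norm_num at this⟩, 0, by norm_num, rfl⟩
      ⟨σ i 1, ⟨hmem i hi 1 (by simp), fun he => by
        have := (h.eq_of_mem_Ioo half (by simp) (Eq.symm he)).2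
        norm_num at this⟩, 1, by norm_num, rfl⟩
    have hxlt : x < 1 / 2 := hx.2.lt_of_ne (by rintro rfl; exact hz rfl)
    obtain ⟨rfl, rfl⟩ := h.embedded i x ⟨hx.1, by linarith⟩ y ⟨by linarith [hy.1], hy.2⟩
      (hxlt.trans_le hy.1) hxy.symm
    obtain ⟨p, q, hpq, h0, h1⟩ := hends i hi
    rw [h0, h1] at hxy
    apply hO
    rcases Fin.exists_fin_two.1 ⟨p, rfl⟩ with rfl | rfl <;>
      rcases Fin.exists_fin_two.1 ⟨q, rfl⟩ with rfl | rfl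
    · exact absurd rfl hpq
    · exact hxy.symm
    · exact hxy
    · exact absurd rfl hpq
  have hne0 : J.card ≠ 0 := by
    intro h0
    rw [Finset.card_eq_zero] at h0
    subst h0
    simp only [Finset.notMem_empty, iUnion_of_empty, iUnion_empty] at hJ
    exact hΓ.nonempty.ne_empty hJ
  have hle : J.card ≤ 2 := by
    -- With the midpoints of two arcs removed, every remaining point still runs along its own arc to
    -- a junction and hence to the intact third arc. The rest is connected, whereas two points
    -- separate a Jordan curve.
    by_contra! hlt
    obtain ⟨i₁, i₂, i₃, h₁, h₂, h₃, h12, h13, h23⟩ := Finset.two_lt_card_iff.1 hlt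
    refine hΓ.not_isPreconnected_diff_pair (hmem i₁ h₁ _ (Ioo_subset_Icc_self half))
      (hmem i₂ h₂ _ (Ioo_subset_Icc_self half))
      (fun he => h12 (h.eq_of_mem_Ioo half (Ioo_subset_Icc_self half) he).1) ?_
    have hK : ∀ a b : ℝ, ∀ k ∈ J, 0 ≤ a → b ≤ 1 →
        (∀ x ∈ Icc a b, ¬(x = 1 / 2 ∧ (k = i₁ ∨ k = i₂))) →
        σ k '' Icc a b ⊆ Γ \ {σ i₁ (1 / 2), σ i₂ (1 / 2)} := by
      rintro a b k hk ha hb hx _ ⟨x, hxab, rfl⟩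
      have hx01 : x ∈ Icc (0 : ℝ) 1 := ⟨ha.trans hxab.1, hxab.2.trans hb⟩
      refine ⟨hmem k hk x hx01, ?_⟩
      rintro (he | he)
      · obtain ⟨e1, e2⟩ := h.eq_of_mem_Ioo half hx01 (Eq.symm he)
        exact hx x hxab ⟨e2.symm, Or.inl e1.symm⟩
      · obtain ⟨e1, e2⟩ := h.eq_of_mem_Ioo half hx01 (Eq.symm he)
        exact hx x hxab ⟨e2.symm, Or.inr e1.symm⟩
    have hK₃ : σ i₃ '' Icc 0 1 ⊆ Γ \ {σ i₁ (1 / 2), σ i₂ (1 / 2)} := by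
      refine hK 0 1 i₃ h₃ le_rfl le_rfl ?_
      rintro x - ⟨-, rfl | rfl⟩
      · exact h13 rfl
      · exact h23 rfl
    have hend : ∀ k ∈ J, ∀ t ∈ ({0, 1} : Set ℝ), σ k t ∈ σ i₃ '' Icc 0 1 := by
      intro k hk t ht
      obtain ⟨p, q, -, h0, h1⟩ := hends k hk
      rcases ht with rfl | rfl
      · rw [h0]; exact hOmem i₃ h₃ p
      · rw [h1]; exact hOmem i₃ h₃ q
    refine isPreconnected_of_forall (σ i₃ 0) ?_
    rintro z ⟨hz, hz'⟩
    rw [hJ] at hz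
    obtain ⟨k, hk, x, hx, rfl⟩ := mem_iUnion₂.1 hz
    have hxk : ¬(x = 1 / 2 ∧ (k = i₁ ∨ k = i₂)) := by
      rintro ⟨rfl, rfl | rfl⟩
      · exact hz' (Or.inl rfl)
      · exact hz' (Or.inr rfl)
    have hpreK : ∀ a b : ℝ, 0 ≤ a → b ≤ 1 → ∀ k, IsPreconnected (σ k '' Icc a b) :=
      fun a b ha hb k => isPreconnected_Icc.image _ ((h.continuousOn k).mono (Icc_subset_Icc ha hb))
    rcases le_total x (1 / 2) with hle | hle
    · refine ⟨σ k '' Icc 0 x ∪ σ i₃ '' Icc 0 1, union_subset (hK 0 x k hk le_rfl hx.2 ?_) hK₃,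
        Or.inr ⟨0, by simp, rfl⟩, Or.inl ⟨x, ⟨hx.1, le_rfl⟩, rfl⟩, ?_⟩
      · rintro y hy ⟨rfl, hy'⟩
        exact hxk ⟨le_antisymm hle hy.2, hy'⟩
      · exact (hpreK 0 x le_rfl hx.2 k).union (σ k 0) ⟨0, ⟨le_rfl, hx.1⟩, rfl⟩
          (hend k hk 0 (by simp)) (hpreK 0 1 le_rfl le_rfl i₃)
    · refine ⟨σ k '' Icc x 1 ∪ σ i₃ '' Icc 0 1, union_subset (hK x 1 k hk hx.1 le_rfl ?_) hK₃,
        Or.inr ⟨0, by simp, rfl⟩, Or.inl ⟨x, ⟨le_rfl, hx.2⟩, rfl⟩, ?_⟩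
      · rintro y hy ⟨rfl, hy'⟩
        exact hxk ⟨le_antisymm hy.1 hle, hy'⟩
      · exact (hpreK x 1 hx.1 le_rfl k).union (σ k 1) ⟨1, ⟨hx.2, le_rfl⟩, rfl⟩
          (hend k hk 1 (by simp)) (hpreK 0 1 le_rfl le_rfl i₃)
  omega

end IsArcSystem

/-- The loops of a network with two triple junctions: a closed curve, or two curves that connect
the two junctions. -/
theorem IsNetwork.exists_loop {Ω : Set ℂ} {n : ℕ} {v : Fin n × Bool → Option (Fin 2)}
    {O : Fin 2 → ℂ} {σ : Fin n → ℝ → ℂ} (h : IsNetwork Ω v O σ) {Γ : Set ℂ}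
    (hΓ : IsJordanCurve Γ) (hsub : Γ ⊆ support σ) :
    ∃ J : Finset (Fin n), Γ = (⋃ i ∈ J, σ i '' Icc 0 1) ∧
      ((∃ i p, J = {i} ∧ v (i, false) = some p ∧ v (i, true) = some p) ∨
       (∃ i j, i ≠ j ∧ J = {i, j} ∧ ∀ k ∈ J, ∃ p q : Fin 2, p ≠ q ∧
          v (k, false) = some p ∧ v (k, true) = some q)) := by
  have hA : IsArcSystem σ := ⟨fun i => (h.contDiffOn i).continuousOn, h.embedded, h.inter⟩
  obtain ⟨J, hJ⟩ := hA.exists_eq_biUnion hΓ hsub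
  have hmem : ∀ k ∈ J, ∀ x ∈ Icc (0 : ℝ) 1, σ k x ∈ Γ := fun k hk x hx => by
    rw [hJ]; exact mem_biUnion hk ⟨x, hx, rfl⟩
  have hsome : ∀ i ∈ J, ∀ b, ∃ p, v (i, b) = some p := by
    intro i hi b
    rw [← Option.ne_none_iff_exists']
    intro hnone
    have hu := h.endpoint_unique i b hnone
    cases b with
    | true =>
      exact hA.not_mem_of_free hΓ hsub (i := i) (fun j c hjc => hu j c hjc)
        (hmem i hi 1 (by simp))
    | false =>
      refine hA.reverse.not_mem_of_free hΓ (by rwa [IsArcSystem.support_reverse]) (i := i)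
        (fun j c hjc => ?_) (by simpa using hmem i hi 0 (by simp))
      have := hu j (!c) (by
        intro he
        apply hjc
        simp only [Prod.mk.injEq] at he ⊢
        exact ⟨he.1, by simpa using he.2⟩)
      cases c <;> simpa [endParam] using this
  refine ⟨J, hJ, ?_⟩
  by_cases hcl : ∃ i ∈ J, v (i, false) = v (i, true)
  · left
    obtain ⟨i, hi, he⟩ := hcl
    obtain ⟨p, hp⟩ := hsome i hi true
    refine ⟨i, p, hA.eq_singleton_of_closed hΓ hJ hi ?_, he.trans hp, hp⟩
    have h0 := h.junction_eq i false p (he.trans hp)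
    have h1 := h.junction_eq i true p hp
    exact h0.trans h1.symm
  · right
    push Not at hcl
    have hends : ∀ k ∈ J, ∃ p q : Fin 2, p ≠ q ∧ v (k, false) = some p ∧ v (k, true) = some q := by
      intro k hk
      obtain ⟨p, hp⟩ := hsome k hk false
      obtain ⟨q, hq⟩ := hsome k hk true
      refine ⟨p, q, ?_, hp, hq⟩
      rintro rfl
      exact hcl k hk (hp.trans hq.symm)
    have h2 := hA.card_eq_two hΓ hJ h.junction_ne fun k hk => by
      obtain ⟨p, q, hpq, hp, hq⟩ := hends k hk
      exact ⟨p, q, hpq, h.junction_eq k false p hp, h.junction_eq k true q hq⟩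
    obtain ⟨i, j, hij, rfl⟩ := Finset.card_eq_two.1 h2
    exact ⟨i, j, hij, rfl, hends⟩

end CurveNetwork

namespace CurveNetwork

/-! ### Orientation of arcs -/

/-- The arc `σ`, traversed backwards if `b` is `false`. -/
def orient (b : Bool) (σ : ℝ → ℂ) : ℝ → ℂ := fun x => if b then σ x else σ (1 - x)

/-- The sign of an orientation. -/
def orientSign (b : Bool) : ℝ := if b then 1 else -1

lemma orient_true (σ : ℝ → ℂ) : orient true σ = σ := by
  funext x; simp [orient]

lemma orient_false (σ : ℝ → ℂ) : orient false σ = fun x => σ (1 - x) := by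
  funext x; simp [orient]

lemma one_sub_mem_Icc {x : ℝ} (hx : x ∈ Icc (0 : ℝ) 1) : 1 - x ∈ Icc (0 : ℝ) 1 :=
  ⟨by linarith [hx.2], by linarith [hx.1]⟩

lemma derivWithin_reverse (f : ℝ → ℂ) (x : ℝ) :
    derivWithin (fun y => f (1 - y)) (Icc 0 1) x = -derivWithin f (Icc 0 1) (1 - x) := by
  rw [derivWithin_comp_const_sub]
  congr 2
  simp

section Arc

variable {σ : ℝ → ℂ}

lemma velocity_reverse (σ : ℝ → ℂ) (x : ℝ) :
    velocity (fun y => σ (1 - y)) x = -velocity σ (1 - x) := derivWithin_reverse σ x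

lemma unitTangent_reverse (σ : ℝ → ℂ) (x : ℝ) :
    unitTangent (fun y => σ (1 - y)) x = -unitTangent σ (1 - x) := by
  rw [unitTangent, velocity_reverse, norm_neg, smul_neg, unitTangent]

lemma curvature_reverse (σ : ℝ → ℂ) (x : ℝ) :
    curvature (fun y => σ (1 - y)) x = -curvature σ (1 - x) := by
  have h : unitTangent (fun y => σ (1 - y)) = fun y => -unitTangent σ (1 - y) :=
    funext (unitTangent_reverse σ)
  have h2 : derivWithin (unitTangent fun y => σ (1 - y)) (Icc 0 1) x =
      derivWithin (unitTangent σ) (Icc 0 1) (1 - x) := by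
    rw [h, derivWithin_reverse (fun y => -unitTangent σ y) x, derivWithin.fun_neg, neg_neg]
  rw [curvature, curvatureVector, unitNormal, h2, unitTangent_reverse, velocity_reverse, norm_neg,
    mul_neg, inner_neg_right]
  rfl

lemma totalCurvature_orient (b : Bool) (σ : ℝ → ℂ) :
    totalCurvature (orient b σ) = orientSign b * totalCurvature σ := by
  cases b
  · rw [orient_false, totalCurvature]
    simp only [curvature_reverse, velocity_reverse, norm_neg]
    have := intervalIntegral.integral_comp_sub_left (a := 0) (b := 1)
      (fun x => -curvature σ x * ‖velocity σ x‖) 1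
    rw [this]
    simp [orientSign, totalCurvature, intervalIntegral.integral_neg]
  · simp [orient_true, orientSign]

lemma contDiffOn_orient {k : WithTop ℕ∞} (h : ContDiffOn ℝ k σ (Icc 0 1)) (b : Bool) :
    ContDiffOn ℝ k (orient b σ) (Icc 0 1) := by
  cases b
  · rw [orient_false]
    exact h.comp (by fun_prop) fun x hx => one_sub_mem_Icc hx
  · rwa [orient_true]

lemma velocity_orient_ne_zero (h : ∀ x ∈ Icc (0 : ℝ) 1, velocity σ x ≠ 0) (b : Bool) :
    ∀ x ∈ Icc (0 : ℝ) 1, velocity (orient b σ) x ≠ 0 := by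
  intro x hx
  cases b
  · rw [orient_false, velocity_reverse, neg_ne_zero]
    exact h _ (one_sub_mem_Icc hx)
  · rw [orient_true]; exact h x hx

lemma unitTangent_orient_one (b : Bool) (σ : ℝ → ℂ) :
    unitTangent (orient b σ) 1 = exteriorTangent σ b := by
  cases b
  · simp [orient_false, unitTangent_reverse, exteriorTangent]
  · simp [orient_true, exteriorTangent]

lemma unitTangent_orient_zero (b : Bool) (σ : ℝ → ℂ) :
    unitTangent (orient b σ) 0 = -exteriorTangent σ !b := by
  cases b
  · simp [orient_false, unitTangent_reverse, exteriorTangent]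
  · simp [orient_true, exteriorTangent]

lemma orient_one (b : Bool) (σ : ℝ → ℂ) : orient b σ 1 = σ (endParam b) := by
  cases b <;> simp [orient, endParam]

lemma orient_zero (b : Bool) (σ : ℝ → ℂ) : orient b σ 0 = σ (endParam !b) := by
  cases b <;> simp [orient, endParam]

lemma image_orient (b : Bool) (σ : ℝ → ℂ) : orient b σ '' Icc 0 1 = σ '' Icc 0 1 := by
  cases b
  · rw [orient_false, ← image_image σ (fun x : ℝ => 1 - x)]
    simp
  · rw [orient_true]

lemma norm_exteriorTangent (h : ∀ x ∈ Icc (0 : ℝ) 1, velocity σ x ≠ 0) (b : Bool) :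
    ‖exteriorTangent σ b‖ = 1 := by
  cases b
  · simp [exteriorTangent, norm_unitTangent (h 0 (by simp))]
  · simp [exteriorTangent, norm_unitTangent (h 1 (by simp))]

lemma orientSign_sq (b : Bool) : orientSign b ^ 2 = 1 := by
  cases b <;> simp [orientSign]

/-- The integral of `(k - r)²` is nonnegative. -/
lemma curveEnergy_quadratic_nonneg (h : ContDiffOn ℝ 2 σ (Icc 0 1))
    (hv : ∀ x ∈ Icc (0 : ℝ) 1, velocity σ x ≠ 0) (r : ℝ) :
    0 ≤ curveEnergy σ - 2 * r * totalCurvature σ + r ^ 2 * length σ := by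
  have hvc : ContinuousOn (velocity σ) (Icc 0 1) := (contDiffOn_velocity h).continuousOn
  have hτ := contDiffOn_unitTangent h hv
  have hk : ContinuousOn (curvature σ) (Icc 0 1) := by
    refine ContinuousOn.inner (ContinuousOn.smul (hvc.norm.inv₀
      fun x hx => norm_ne_zero_iff.2 (hv x hx)) ?_) (continuousOn_const.mul hτ.continuousOn)
    exact hτ.continuousOn_derivWithin (uniqueDiffOn_Icc one_pos) le_rfl
  have i1 : IntervalIntegrable (fun x => curvature σ x ^ 2 * ‖velocity σ x‖) volume 0 1 := by
    refine ContinuousOn.intervalIntegrable ?_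
    rw [uIcc_of_le zero_le_one]
    exact (hk.pow 2).mul hvc.norm
  have i2 : IntervalIntegrable (fun x => curvature σ x * ‖velocity σ x‖) volume 0 1 := by
    refine ContinuousOn.intervalIntegrable ?_
    rw [uIcc_of_le zero_le_one]
    exact hk.mul hvc.norm
  have i3 : IntervalIntegrable (fun x => ‖velocity σ x‖) volume 0 1 := by
    refine ContinuousOn.intervalIntegrable ?_
    rw [uIcc_of_le zero_le_one]
    exact hvc.norm
  have e : curveEnergy σ - 2 * r * totalCurvature σ + r ^ 2 * length σ =
      ∫ x in (0 : ℝ)..1, (curvature σ x - r) ^ 2 * ‖velocity σ x‖ := by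
    rw [curveEnergy, totalCurvature, length, ← intervalIntegral.integral_const_mul,
      ← intervalIntegral.integral_const_mul, ← intervalIntegral.integral_sub i1 (i2.const_mul _),
      ← intervalIntegral.integral_add (i1.sub (i2.const_mul _)) (i3.const_mul _)]
    refine intervalIntegral.integral_congr fun x _ => ?_
    ring
  rw [e]
  exact intervalIntegral.integral_nonneg zero_le_one fun x _ => by positivity

lemma length_pos (h : ContDiffOn ℝ 1 σ (Icc 0 1))
    (hv : ∀ x ∈ Icc (0 : ℝ) 1, velocity σ x ≠ 0) : 0 < length σ := by
  have hvc := (continuousOn_velocity h).norm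
  refine intervalIntegral.intervalIntegral_pos_of_pos_on
    (ContinuousOn.intervalIntegrable (by rwa [uIcc_of_le zero_le_one]))
    (fun x hx => norm_pos_iff.2 (hv x (Ioo_subset_Icc_self hx))) one_pos

lemma curveEnergy_nonneg (σ : ℝ → ℂ) : 0 ≤ curveEnergy σ :=
  intervalIntegral.integral_nonneg zero_le_one fun x _ => by positivity

end Arc

/-! ### Loops of a network -/

/-- The combinatorics of a loop of a network: the `k`-th arc of the loop is the curve `(a k).1`,
traversed forwards if `(a k).2` is `true`, and it ends at the triple junction `p k`. -/
structure IsLoopCode {n : ℕ} (v : Fin n × Bool → Option (Fin 2)) (a : ℤ → Fin n × Bool)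
    (p : ℤ → Fin 2) (m : ℕ) : Prop where
  pos : 0 < m
  periodic : ∀ k, a (k + m) = a k
  terminal : ∀ k, v (a k) = some (p k)
  initial : ∀ k, v ((a (k + 1)).1, !(a (k + 1)).2) = some (p k)
  ne : ∀ k, a k ≠ ((a (k + 1)).1, !(a (k + 1)).2)
  dvd_of_curve : ∀ j k, (a j).1 = (a k).1 → (m : ℤ) ∣ j - k
  dvd_of_junction : ∀ j k, p j = p k → (m : ℤ) ∣ j - k

/-- The `k`-th arc of a loop. -/
def loopArc {n : ℕ} (a : ℤ → Fin n × Bool) (σ : Fin n → ℝ → ℂ) (k : ℤ) : ℝ → ℂ :=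
  orient (a k).2 (σ (a k).1)

variable {Ω : Set ℂ} {n : ℕ} {v : Fin n × Bool → Option (Fin 2)} {O : Fin 2 → ℂ}
  {σ : Fin n → ℝ → ℂ}

/-- At a triple junction of a regular network the curves form angles of `2 π / 3`. -/
lemma IsNetwork.exteriorTangent_mul_conj (h : IsNetwork Ω v O σ) (hH : Herring v σ)
    {e₁ e₂ : Fin n × Bool} {p : Fin 2} (h₁ : v e₁ = some p) (h₂ : v e₂ = some p) (hne : e₁ ≠ e₂) :
    (exteriorTangent (σ e₂.1) e₂.2 * starRingEnd ℂ (exteriorTangent (σ e₁.1) e₁.2)).re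
      = -(1 / 2) := by
  have hcard := h.junction_card p
  have hsum := hH p
  have hm₁ : e₁ ∈ Finset.univ.filter fun e => v e = some p := by simp [h₁]
  have hm₂ : e₂ ∈ (Finset.univ.filter fun e => v e = some p).erase e₁ := by simp [h₂, hne.symm]
  obtain ⟨e₃, h₃⟩ : ∃ e₃, ((Finset.univ.filter fun e => v e = some p).erase e₁).erase e₂ = {e₃} := by
    rw [← Finset.card_eq_one, Finset.card_erase_of_mem hm₂, Finset.card_erase_of_mem hm₁, hcard]
  rw [← Finset.add_sum_erase _ _ hm₁, ← Finset.add_sum_erase _ _ hm₂, h₃,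
    Finset.sum_singleton] at hsum
  set x := exteriorTangent (σ e₁.1) e₁.2
  set y := exteriorTangent (σ e₂.1) e₂.2
  set z := exteriorTangent (σ e₃.1) e₃.2
  have nx : ‖x‖ = 1 := norm_exteriorTangent (h.velocity_ne_zero _) _
  have ny : ‖y‖ = 1 := norm_exteriorTangent (h.velocity_ne_zero _) _
  have nz : ‖z‖ = 1 := norm_exteriorTangent (h.velocity_ne_zero _) _
  have hz : z = -(x + y) := by linear_combination hsum
  have hsq : ∀ w : ℂ, ‖w‖ = 1 → w.re * w.re + w.im * w.im = 1 := by
    intro w hw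
    rw [← Complex.normSq_apply, Complex.normSq_eq_norm_sq, hw, one_pow]
  have qx := hsq x nx
  have qy := hsq y ny
  have qz := hsq z nz
  -- The identity 1 = |x + y|² = 2 + 2⟨x, y⟩ yields ⟨x, y⟩ = −1/2.
  rw [hz] at qz
  simp only [Complex.neg_re, Complex.neg_im, Complex.add_re, Complex.add_im] at qz
  simp only [Complex.mul_re, Complex.conj_re, Complex.conj_im]
  linarith

/-- A loop of a regular network is a closed chain of arcs. -/
theorem IsLoopCode.isArcLoop {a : ℤ → Fin n × Bool} {p : ℤ → Fin 2} {m : ℕ}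
    (ha : IsLoopCode v a p m) (h : IsNetwork Ω v O σ) (hH : Herring v σ) :
    IsArcLoop (loopArc a σ) m := by
  have hA : IsArcSystem σ := ⟨fun i => (h.contDiffOn i).continuousOn, h.embedded, h.inter⟩
  have hone : ∀ k, loopArc a σ k 1 = O (p k) := fun k => by
    rw [loopArc, orient_one]
    exact h.junction_eq _ _ _ (ha.terminal k)
  have hzero : ∀ k, loopArc a σ (k + 1) 0 = O (p k) := fun k => by
    rw [loopArc, orient_zero]
    exact h.junction_eq _ _ _ (ha.initial k)
  have hOinj : ∀ q r : Fin 2, O q = O r → q = r := by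
    intro q r hqr
    have hne := h.junction_ne
    rcases Fin.exists_fin_two.1 ⟨q, rfl⟩ with rfl | rfl <;>
      rcases Fin.exists_fin_two.1 ⟨r, rfl⟩ with rfl | rfl
    · rfl
    · exact absurd hqr hne
    · exact absurd hqr.symm hne
    · rfl
  have heq : ∀ j k : ℤ, 0 ≤ j → j < m → 0 ≤ k → k < m → (m : ℤ) ∣ j - k → j = k := by
    intro j k hj hjm hk hkm hd
    obtain ⟨r, hr⟩ := hd
    have : r = 0 := by
      by_contra h0
      rcases lt_or_gt_of_ne h0 with h1 | h1 <;> nlinarith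
    rw [this, mul_zero] at hr
    omega
  have hraw : ∀ k x, ∃ y, loopArc a σ k x = σ (a k).1 y ∧ (x ∈ Icc (0 : ℝ) 1 → y ∈ Icc (0 : ℝ) 1) ∧
      (x ∈ Ioo (0 : ℝ) 1 → y ∈ Ioo (0 : ℝ) 1) ∧ y = if (a k).2 then x else 1 - x := by
    intro k x
    refine ⟨if (a k).2 then x else 1 - x, ?_, ?_, ?_, rfl⟩
    · rw [loopArc, orient]; split_ifs <;> rfl
    · intro hx; split_ifs
      · exact hx
      · exact one_sub_mem_Icc hx
    · intro hx; split_ifs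
      · exact hx
      · exact ⟨by linarith [hx.2], by linarith [hx.1]⟩
  have hint : ∀ j k : ℤ, 0 ≤ j → j < m → 0 ≤ k → k < m → ∀ x ∈ Ioo (0 : ℝ) 1,
      ∀ y ∈ Icc (0 : ℝ) 1, loopArc a σ j x = loopArc a σ k y → j = k ∧ x = y := by
    intro j k hj hjm hk hkm x hx y hy he
    obtain ⟨x', e1, -, hx', f1⟩ := hraw j x
    obtain ⟨y', e2, hy', -, f2⟩ := hraw k y
    rw [e1, e2] at he
    obtain ⟨h1, h2⟩ := hA.eq_of_mem_Ioo (hx' hx) (hy' hy) he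
    obtain rfl := heq j k hj hjm hk hkm (ha.dvd_of_curve j k h1)
    refine ⟨rfl, ?_⟩
    rw [f1, f2] at h2
    split_ifs at h2
    · exact h2
    · linarith
  refine ⟨ha.pos, fun k => ?_, fun k => contDiffOn_orient (h.contDiffOn _) _,
    fun k => velocity_orient_ne_zero (h.velocity_ne_zero _) _,
    fun k => (hone k).trans (hzero k).symm, ?_, fun k => ?_⟩
  · rw [loopArc, ha.periodic]; rfl
  · intro j k hj hjm hk hkm x hx y hy he
    rcases hx.1.eq_or_lt with rfl | hx0
    · rcases hy.1.eq_or_lt with rfl | hy0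
      · refine ⟨heq j k hj hjm hk hkm ?_, rfl⟩
        have e1 := hzero (j - 1)
        have e2 := hzero (k - 1)
        rw [sub_add_cancel] at e1 e2
        rw [e1, e2] at he
        have := ha.dvd_of_junction _ _ (hOinj _ _ he)
        rwa [sub_sub_sub_cancel_right] at this
      · have := hint k j hk hkm hj hjm y ⟨hy0, hy.2⟩ 0 (by simp) he.symm
        exact ⟨this.1.symm, this.2.symm⟩
    · exact hint j k hj hjm hk hkm x ⟨hx0, hx.2⟩ y (Ico_subset_Icc_self hy) he
  · rw [loopArc, loopArc, unitTangent_orient_zero, unitTangent_orient_one, neg_mul, Complex.neg_re,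
      h.exteriorTangent_mul_conj hH (ha.terminal k) (ha.initial k) (ha.ne k), neg_neg]

/-- The combinatorics of the loops of a network with two triple junctions. -/
theorem IsNetwork.exists_loopCode (h : IsNetwork Ω v O σ) {Γ : Set ℂ}
    (hΓ : IsJordanCurve Γ) (hsub : Γ ⊆ support σ) :
    ∃ (J : Finset (Fin n)) (a : ℤ → Fin n × Bool) (p : ℤ → Fin 2) (m : ℕ),
      Γ = (⋃ i ∈ J, σ i '' Icc 0 1) ∧ IsLoopCode v a p m ∧ (m = 1 ∨ m = 2) ∧ J.card = m ∧
      (∀ f : Fin n → ℝ, ∑ i ∈ J, f i = ∑ k ∈ Finset.range m, f (a k).1) ∧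
      Γ = ⋃ k ∈ Finset.range m, loopArc a σ k '' Icc 0 1 := by
  classical
  obtain ⟨J, hJ, ⟨i, q, rfl, h0, h1⟩ | ⟨i, j, hij, rfl, hends⟩⟩ := h.exists_loop hΓ hsub
  · refine ⟨{i}, fun _ => (i, true), fun _ => q, 1, hJ,
      ⟨one_pos, fun _ => rfl, fun _ => h1, fun _ => h0, by simp, by simp, by simp⟩,
      Or.inl rfl, by simp, by simp, ?_⟩
    rw [hJ]
    simp [loopArc, image_orient]
  · obtain ⟨r, s, hrs, hr, hs⟩ := hends i (by simp)
    -- The curve `i` runs from `r` to `s`; `b` orients `j` to come back from `s` to `r`. Even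
    -- indices carry `i`, odd ones `j`.
    obtain ⟨b, hb1, hb2⟩ : ∃ b, v (j, b) = some r ∧ v (j, !b) = some s := by
      obtain ⟨r', s', hrs', hr', hs'⟩ := hends j (by simp)
      rcases eq_or_ne r' r with rfl | hne
      · have : s' = s := by omega
        subst this
        exact ⟨false, hr', hs'⟩
      · have h1 : r' = s := by omega
        have h2 : s' = r := by omega
        subst h1 h2
        exact ⟨true, hs', hr'⟩
    have hpar : ∀ k : ℤ, Even k ∨ ¬Even k := fun k => em _
    have hdvd : ∀ j k : ℤ, (Even j ↔ Even k) → ((2 : ℕ) : ℤ) ∣ j - k := by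
      intro j k hjk
      have := Int.even_sub.2 hjk
      exact_mod_cast this.two_dvd
    refine ⟨{i, j}, fun k => if Even k then (i, true) else (j, b),
      fun k => if Even k then s else r, 2, hJ, ⟨two_pos, fun k => ?_, fun k => ?_, fun k => ?_,
      fun k => ?_, fun k l hkl => hdvd k l ?_, fun k l hkl => hdvd k l ?_⟩, Or.inr rfl,
      Finset.card_pair hij, fun f => ?_, ?_⟩
    · simp
    · split_ifs
      · exact hs
      · exact hb1
    · rcases hpar k with hk | hk
      · have hk1 : ¬Even (k + 1) := by rw [Int.even_add_one, not_not]; exact hk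
        simp only [hk, hk1, if_true, if_false, hb2]
      · have hk1 : Even (k + 1) := by rw [Int.even_add_one]; exact hk
        simp only [hk, hk1, if_true, if_false, Bool.not_true, hr]
    · rcases hpar k with hk | hk
      · have hk1 : ¬Even (k + 1) := by rw [Int.even_add_one, not_not]; exact hk
        simp [hk, hk1, hij]
      · have hk1 : Even (k + 1) := by rw [Int.even_add_one]; exact hk
        simp [hk, hk1, hij.symm]
    · rcases hpar k with hk | hk <;> rcases hpar l with hl | hl <;>
        simp [hk, hl, hij, hij.symm] at hkl ⊢
    · rcases hpar k with hk | hk <;> rcases hpar l with hl | hl <;>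
        simp [hk, hl, hrs, hrs.symm] at hkl ⊢
    · rw [Finset.sum_pair hij]
      simp [Finset.sum_range_succ]
    · rw [hJ]
      simp [loopArc, image_orient, Finset.range_add_one, union_comm]

end CurveNetwork

namespace CurveNetwork

/-! ### Variation of the signed area -/

/-- Up to boundary terms, twice the increment of the signed area. -/
def areaIncrement (σ σ' : ℝ → ℂ) : ℝ :=
  ∫ x in (0 : ℝ)..1, (starRingEnd ℂ (σ' x - σ x) * (velocity σ' x + velocity σ x)).im

lemma areaIncrement_self (σ : ℝ → ℂ) : areaIncrement σ σ = 0 := by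
  simp [areaIncrement]

lemma areaIncrement_orient (b : Bool) (σ σ' : ℝ → ℂ) :
    areaIncrement (orient b σ) (orient b σ') = orientSign b * areaIncrement σ σ' := by
  cases b
  · rw [orient_false, orient_false, areaIncrement]
    simp only [velocity_reverse]
    have := intervalIntegral.integral_comp_sub_left (a := 0) (b := 1)
      (fun x => (starRingEnd ℂ (σ' x - σ x) * (-velocity σ' x + -velocity σ x)).im) 1
    rw [this]
    simp only [← neg_add, mul_neg, Complex.neg_im, intervalIntegral.integral_neg]
    simp [orientSign, areaIncrement]
  · simp [orient_true, orientSign]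

/-- Integration by parts moves the space derivative off the difference of the curves, so that the
time derivative of the area needs no time derivative of the velocity. The boundary terms telescope
around a loop. -/
lemma signedArea_sub {σ σ' : ℝ → ℂ} (h : ContDiffOn ℝ 1 σ (Icc 0 1))
    (h' : ContDiffOn ℝ 1 σ' (Icc 0 1)) :
    signedArea σ' - signedArea σ = 2⁻¹ * (areaIncrement σ σ' +
      ((starRingEnd ℂ (σ 1) * (σ' 1 - σ 1)).im - (starRingEnd ℂ (σ 0) * (σ' 0 - σ 0)).im)) := by
  have hv := continuousOn_velocity h
  have hv' := continuousOn_velocity h'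
  have hc := h.continuousOn
  have hc' := h'.continuousOn
  have hconj := Complex.continuous_conj
  have hii : ∀ f : ℝ → ℂ, ContinuousOn f (Icc 0 1) →
      IntervalIntegrable (fun x => (f x).im) volume 0 1 := fun f hf => by
    refine ContinuousOn.intervalIntegrable ?_
    rw [uIcc_of_le zero_le_one]
    exact Complex.continuous_im.comp_continuousOn hf
  have i1 : IntervalIntegrable (fun x => (starRingEnd ℂ (σ' x) * velocity σ' x).im) volume 0 1 :=
    hii _ ((hconj.comp_continuousOn hc').mul hv')
  have i2 : IntervalIntegrable (fun x => (starRingEnd ℂ (σ x) * velocity σ x).im) volume 0 1 :=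
    hii _ ((hconj.comp_continuousOn hc).mul hv)
  have i3 : IntervalIntegrable (fun x => (starRingEnd ℂ (σ' x - σ x) *
      (velocity σ' x + velocity σ x)).im) volume 0 1 :=
    hii _ ((hconj.comp_continuousOn (hc'.sub hc)).mul (hv'.add hv))
  have i4 : IntervalIntegrable (fun x => (starRingEnd ℂ (velocity σ x) * (σ' x - σ x) +
      starRingEnd ℂ (σ x) * (velocity σ' x - velocity σ x)).im) volume 0 1 :=
    hii _ (((hconj.comp_continuousOn hv).mul (hc'.sub hc)).add
      ((hconj.comp_continuousOn hc).mul (hv'.sub hv)))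
  have hB : ∫ x in (0 : ℝ)..1, (starRingEnd ℂ (velocity σ x) * (σ' x - σ x) +
      starRingEnd ℂ (σ x) * (velocity σ' x - velocity σ x)).im =
      (starRingEnd ℂ (σ 1) * (σ' 1 - σ 1)).im - (starRingEnd ℂ (σ 0) * (σ' 0 - σ 0)).im := by
    refine intervalIntegral.integral_eq_sub_of_hasDerivAt_of_le
      (f := fun x => (starRingEnd ℂ (σ x) * (σ' x - σ x)).im) zero_le_one
      (Complex.continuous_im.comp_continuousOn ((hconj.comp_continuousOn hc).mul (hc'.sub hc)))
      (fun x hx => ?_) i4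
    have hn := Icc_mem_nhds hx.1 hx.2
    have d := (hasDerivWithinAt_velocity h (Ioo_subset_Icc_self hx)).hasDerivAt hn
    have d' := (hasDerivWithinAt_velocity h' (Ioo_subset_Icc_self hx)).hasDerivAt hn
    have dc : HasDerivAt (fun x => starRingEnd ℂ (σ x)) (starRingEnd ℂ (velocity σ x)) x :=
      (Complex.conjCLE : ℂ →L[ℝ] ℂ).hasFDerivAt.comp_hasDerivAt x d
    exact Complex.imCLM.hasFDerivAt.comp_hasDerivAt x (dc.mul (d'.sub d))
  rw [← hB, signedArea, signedArea, areaIncrement, ← intervalIntegral.integral_add i3 i4,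
    ← mul_sub, ← intervalIntegral.integral_sub i1 i2]
  congr 1
  refine intervalIntegral.integral_congr fun x _ => ?_
  simp only [map_sub, Complex.mul_im, Complex.add_im,
    Complex.sub_im, Complex.sub_re, Complex.conj_re, Complex.conj_im, Complex.add_re]
  ring

/-- The increment of the signed area enclosed by a closed chain of arcs. -/
lemma IsArcLoop.sum_signedArea_sub {c c' : ℤ → ℝ → ℂ} {m : ℕ} (h : IsArcLoop c m)
    (h' : IsArcLoop c' m) :
    ∑ k ∈ Finset.range m, signedArea (c' k) - ∑ k ∈ Finset.range m, signedArea (c k) =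
      2⁻¹ * ∑ k ∈ Finset.range m, areaIncrement (c k) (c' k) := by
  set B : ℕ → ℝ := fun k => (starRingEnd ℂ (c k 0) * (c' k 0 - c k 0)).im with hB
  have e : ∀ k : ℕ, signedArea (c' k) - signedArea (c k) =
      2⁻¹ * (areaIncrement (c k) (c' k) + (B (k + 1) - B k)) := by
    intro k
    rw [signedArea_sub (h.contDiffOn k) (h'.contDiffOn k), h.join, h'.join]
    simp [hB]
  rw [← Finset.sum_sub_distrib, Finset.sum_congr rfl fun k _ => e k, ← Finset.mul_sum,
    Finset.sum_add_distrib, Finset.sum_range_sub]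
  have h1 := h.periodic 0
  have h2 := h'.periodic 0
  rw [zero_add] at h1 h2
  simp [hB, h1, h2]

/-- The positive times before `T`. -/
def positiveTimes (T : EReal) : Set ℝ := {t | 0 < t ∧ (t : EReal) < T}

lemma isOpen_positiveTimes (T : EReal) : IsOpen (positiveTimes T) :=
  isOpen_Ioi.inter (isOpen_Iio.preimage continuous_coe_real_ereal)

lemma Icc_subset_positiveTimes {T : EReal} {s t : ℝ} (hs : s ∈ positiveTimes T)
    (ht : t ∈ positiveTimes T) : Icc s t ⊆ positiveTimes T := fun _ hu =>
  ⟨hs.1.trans_le hu.1, lt_of_le_of_lt (EReal.coe_le_coe_iff.2 hu.2) ht.2⟩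

section Flow

variable {Ω : Set ℂ} {T : EReal} {n : ℕ} {v : Fin n × Bool → Option (Fin 2)}
  {O : ℝ → Fin 2 → ℂ} {γ : ℝ → Fin n → ℝ → ℂ}

/-- Dominated convergence in the difference quotient. In the limit the integrand is twice the
imaginary part of the conjugate of kν + λτ times |γ_x|τ, that is −2k|γ_x|: the tangential speed λ
drops out. -/
lemma IsCurvatureFlow.hasDerivAt_areaIncrement (hγ : IsCurvatureFlow Ω T v O γ) (i : Fin n)
    {t : ℝ} (ht : t ∈ positiveTimes T) :
    HasDerivAt (fun s => areaIncrement (γ t i) (γ s i)) (-2 * totalCurvature (γ t i)) t := by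
  obtain ⟨δ, hδ, hball⟩ := Metric.isOpen_iff.1 (isOpen_positiveTimes T) t ht
  have hC : Icc (t - δ / 2) (t + δ / 2) ⊆ positiveTimes T := fun s hs => hball (by
    rw [Metric.mem_ball, Real.dist_eq, abs_lt]
    constructor <;> linarith [hs.1, hs.2])
  have hcyl : Icc (t - δ / 2) (t + δ / 2) ×ˢ Icc (0 : ℝ) 1 ⊆ openCylinder T :=
    fun q hq => ⟨(hC hq.1).1, (hC hq.1).2, hq.2⟩
  have hcomp : IsCompact (Icc (t - δ / 2) (t + δ / 2) ×ˢ Icc (0 : ℝ) 1) :=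
    isCompact_Icc.prod isCompact_Icc
  obtain ⟨M₁, hM₁⟩ := hcomp.exists_bound_of_continuousOn ((hγ.continuousOn_time i).mono hcyl)
  obtain ⟨M₂, hM₂⟩ := hcomp.exists_bound_of_continuousOn ((hγ.continuousOn_velocity i).mono hcyl)
  have htC : t ∈ Icc (t - δ / 2) (t + δ / 2) := ⟨by linarith, by linarith⟩
  have hnear : ∀ᶠ s in 𝓝[≠] t, s ∈ Icc (t - δ / 2) (t + δ / 2) :=
    nhdsWithin_le_nhds (Icc_mem_nhds (by linarith) (by linarith))
  have hnet : ∀ s ∈ positiveTimes T, IsNetwork Ω v (O s) (γ s) :=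
    fun s hs => hγ.network s hs.1.le hs.2
  rw [hasDerivAt_iff_tendsto_slope]
  have hlim : -2 * totalCurvature (γ t i) = ∫ x in (0 : ℝ)..1,
      (starRingEnd ℂ (deriv (fun s => γ s i x) t) * (velocity (γ t i) x + velocity (γ t i) x)).im := by
    obtain ⟨lam, -, hmot⟩ := hγ.motion
    rw [totalCurvature, ← intervalIntegral.integral_const_mul]
    refine intervalIntegral.integral_congr fun x hx => ?_
    rw [uIcc_of_le zero_le_one] at hx
    have hv := (hnet t ht).velocity_ne_zero i x hx
    have e1 : velocity (γ t i) x = ‖velocity (γ t i) x‖ * unitTangent (γ t i) x := by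
      simp [unitTangent, hv]
    have e2 := hmot i (t, x) ⟨ht.1, ht.2, hx⟩
    have e3 : (unitTangent (γ t i) x).re ^ 2 + (unitTangent (γ t i) x).im ^ 2 = 1 := by
      have := congrArg (· ^ 2) (norm_unitTangent hv)
      simp only [← Complex.normSq_eq_norm_sq, Complex.normSq_apply] at this
      nlinarith
    simp only at e2 ⊢
    rw [e2]
    nth_rewrite 2 [e1]
    nth_rewrite 3 [e1]
    simp only [unitNormal, Complex.real_smul, map_add, map_mul, Complex.conj_ofReal, Complex.conj_I,
      Complex.mul_im, Complex.mul_re, Complex.add_im, Complex.add_re, Complex.ofReal_re,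
      Complex.ofReal_im, Complex.conj_re, Complex.conj_im, Complex.neg_re, Complex.neg_im,
      Complex.I_re, Complex.I_im]
    linear_combination (-2 * curvature (γ t i) x * ‖velocity (γ t i) x‖) * e3.symm
  rw [hlim]
  have hslope : ∀ s, slope (fun s => areaIncrement (γ t i) (γ s i)) t s = ∫ x in (0 : ℝ)..1,
      (starRingEnd ℂ (slope (fun s => γ s i x) t s) *
        (velocity (γ s i) x + velocity (γ t i) x)).im := by
    intro s
    rw [slope_def_field, areaIncrement_self, sub_zero, areaIncrement, div_eq_inv_mul,
      ← intervalIntegral.integral_const_mul]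
    refine intervalIntegral.integral_congr fun x _ => ?_
    simp only [slope_def_module]
    rw [Complex.real_smul, map_mul, Complex.conj_ofReal, mul_assoc, Complex.im_ofReal_mul]
  simp only [funext hslope]
  have hMM : 0 ≤ M₁ := (norm_nonneg _).trans (hM₁ (t, 0) ⟨htC, by simp⟩)
  refine intervalIntegral.tendsto_integral_filter_of_dominated_convergence
    (fun _ => M₁ * (M₂ + M₂)) ?_ ?_ intervalIntegrable_const ?_
  · filter_upwards [hnear] with s hs
    refine ContinuousOn.aestronglyMeasurable ?_ measurableSet_uIoc
    rw [uIoc_of_le zero_le_one]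
    refine ContinuousOn.mono ?_ Ioc_subset_Icc_self
    have c1 := ((hnet s (hC hs)).contDiffOn i)
    have c2 := ((hnet t ht).contDiffOn i)
    refine Complex.continuous_im.comp_continuousOn (ContinuousOn.mul
      (Complex.continuous_conj.comp_continuousOn ?_)
      ((CurveNetwork.continuousOn_velocity c1).add (CurveNetwork.continuousOn_velocity c2)))
    simp only [slope_def_module]
    exact continuousOn_const.smul (c1.continuousOn.sub c2.continuousOn)
  · filter_upwards [hnear, self_mem_nhdsWithin] with s hs hst
    refine Eventually.of_forall fun x hx => ?_
    rw [uIoc_of_le zero_le_one] at hx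
    have hx' := Ioc_subset_Icc_self hx
    have h1 : ‖slope (fun s => γ s i x) t s‖ ≤ M₁ := by
      rw [slope_def_module, norm_smul, norm_inv, inv_mul_le_iff₀
        (norm_pos_iff.2 (sub_ne_zero.2 hst)), mul_comm]
      exact (convex_Icc (t - δ / 2) (t + δ / 2)).norm_image_sub_le_of_norm_deriv_le
        (f := fun s => γ s i x) (fun u hu => hγ.differentiableAt_time i (u, x) (hcyl ⟨hu, hx'⟩))
        (fun u hu => hM₁ (u, x) ⟨hu, hx'⟩) htC hs
    have h2 := hM₂ (s, x) ⟨hs, hx'⟩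
    have h3 := hM₂ (t, x) ⟨htC, hx'⟩
    calc ‖(starRingEnd ℂ (slope (fun s => γ s i x) t s) *
          (velocity (γ s i) x + velocity (γ t i) x)).im‖
        ≤ ‖starRingEnd ℂ (slope (fun s => γ s i x) t s) *
          (velocity (γ s i) x + velocity (γ t i) x)‖ := Complex.abs_im_le_norm _
      _ = ‖slope (fun s => γ s i x) t s‖ * ‖velocity (γ s i) x + velocity (γ t i) x‖ := by
          rw [norm_mul, Complex.norm_conj]
      _ ≤ M₁ * (M₂ + M₂) := mul_le_mul h1 ((norm_add_le _ _).trans (add_le_add h2 h3))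
          (norm_nonneg _) hMM
  · refine Eventually.of_forall fun x hx => ?_
    rw [uIoc_of_le zero_le_one] at hx
    have hx' := Ioc_subset_Icc_self hx
    have h1 := (hasDerivAt_iff_tendsto_slope.1
      (hγ.differentiableAt_time i (t, x) ⟨ht.1, ht.2, hx'⟩).hasDerivAt)
    have h2 : Tendsto (fun s => velocity (γ s i) x) (𝓝[≠] t) (𝓝 (velocity (γ t i) x)) := by
      have := hγ.continuousOn_velocity i (t, x) ⟨ht.1, ht.2, hx'⟩
      have hg : Tendsto (fun s : ℝ => (s, x)) (𝓝[≠] t) (𝓝[openCylinder T] (t, x)) := by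
        refine tendsto_nhdsWithin_iff.2 ⟨?_, ?_⟩
        · exact (Continuous.tendsto (f := fun s : ℝ => (s, x)) (by fun_prop) t).mono_left
            nhdsWithin_le_nhds
        · filter_upwards [hnear] with s hs
          exact hcyl ⟨hs, hx'⟩
      exact this.tendsto.comp hg
    exact (Complex.continuous_im.tendsto _).comp
      (((Complex.continuous_conj.tendsto _).comp h1).mul (h2.add tendsto_const_nhds))

variable {a : ℤ → Fin n × Bool} {p : ℤ → Fin 2} {m : ℕ}

/-- The signed area of the region enclosed by a loop of a network. -/
def loopArea (a : ℤ → Fin n × Bool) (m : ℕ) (σ : Fin n → ℝ → ℂ) : ℝ :=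
  ∑ k ∈ Finset.range m, signedArea (loopArc a σ k)

/-- The total curvature of a loop of a network. -/
def loopCurvature (a : ℤ → Fin n × Bool) (m : ℕ) (σ : Fin n → ℝ → ℂ) : ℝ :=
  ∑ k ∈ Finset.range m, totalCurvature (loopArc a σ k)

/-- In a motion by curvature the area decreases at the rate given by the total curvature. -/
theorem IsCurvatureFlow.hasDerivAt_loopArea (hγ : IsCurvatureFlow Ω T v O γ)
    (ha : IsLoopCode v a p m) {t : ℝ} (ht : t ∈ positiveTimes T) :
    HasDerivAt (fun s => loopArea a m (γ s)) (-loopCurvature a m (γ t)) t := by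
  have hloop : ∀ s ∈ positiveTimes T, IsArcLoop (loopArc a (γ s)) m := fun s hs =>
    ha.isArcLoop (hγ.network s hs.1.le hs.2) (hγ.herring s hs.1.le hs.2)
  have hev : (fun s => loopArea a m (γ s)) =ᶠ[𝓝 t] fun s => loopArea a m (γ t) +
      2⁻¹ * ∑ k ∈ Finset.range m, orientSign (a k).2 *
        areaIncrement (γ t (a k).1) (γ s (a k).1) := by
    filter_upwards [(isOpen_positiveTimes T).mem_nhds ht] with s hs
    have := (hloop t ht).sum_signedArea_sub (hloop s hs)
    simp only [loopArc, areaIncrement_orient] at this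
    simp only [loopArea, loopArc]
    linarith
  have hd : HasDerivAt (fun s => loopArea a m (γ t) +
      2⁻¹ * ∑ k ∈ Finset.range m, orientSign (a k).2 *
        areaIncrement (γ t (a k).1) (γ s (a k).1))
      (2⁻¹ * ∑ k ∈ Finset.range m, orientSign (a k).2 * (-2 * totalCurvature (γ t (a k).1))) t :=
    ((HasDerivAt.fun_sum fun (k : ℕ) _ =>
      (hγ.hasDerivAt_areaIncrement (a k).1 ht).const_mul _).const_mul _).const_add _
  convert! hd.congr_of_eventuallyEq hev using 1
  rw [loopCurvature, Finset.mul_sum, ← Finset.sum_neg_distrib]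
  refine Finset.sum_congr rfl fun k _ => ?_
  rw [loopArc, totalCurvature_orient]
  ring

lemma IsCurvatureFlow.contDiffOn_two (hγ : IsCurvatureFlow Ω T v O γ) (i : Fin n) {t : ℝ}
    (ht : 0 ≤ t) (htT : (t : EReal) < T) : ContDiffOn ℝ 2 (γ t i) (Icc 0 1) := by
  rcases ht.eq_or_lt with rfl | h0
  · exact hγ.initial_contDiffOn i
  · exact hγ.contDiffOn i t h0 htT

/-- The rotation number of a loop, and its consequences for the total curvature and the area. -/
theorem IsCurvatureFlow.exists_rotation (hγ : IsCurvatureFlow Ω T v O γ)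
    (ha : IsLoopCode v a p m) {t : ℝ} (ht : 0 ≤ t) (htT : (t : EReal) < T) :
    ∃ ρ : ℝ, (ρ = 1 ∨ ρ = -1) ∧ (6 - m) * Real.pi / 3 ≤ ρ * loopCurvature a m (γ t) ∧
      0 ≤ ρ * loopArea a m (γ t) ∧ ∀ E : Set ℂ, volume E ≠ ⊤ →
      (∀ z w, HasWinding (concat (loopArc a (γ t))) m z w → w ≠ 0 → z ∈ E) →
      ρ * loopArea a m (γ t) ≤ volume.real E := by
  have hloop := ha.isArcLoop (hγ.network t ht htT) (hγ.herring t ht htT)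
  obtain ⟨θ, ρ, hθ, hρ⟩ := hloop.simpleClosed.exists_isSecantLog
  obtain ⟨h1, h2⟩ := hloop.signedArea_bounds hθ hρ
  have h3 := hloop.abs_sum_totalCurvature_sub_le
    (fun k => contDiffOn_orient (hγ.contDiffOn_two _ ht htT) _) hθ
  rw [abs_le] at h3
  refine ⟨ρ, ?_, ?_, h1, h2⟩
  · rcases hρ with rfl | rfl <;> simp
  · rcases hρ with rfl | rfl
    · push_cast at h3 ⊢
      rw [loopCurvature]
      linarith [h3.1]
    · push_cast at h3 ⊢
      rw [loopCurvature]
      linarith [h3.2]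

end Flow

/-! ### Decay of the area -/

/-- Without zeros `S` stays positive, so S' ≤ −c throughout and 0 < S t ≤ S s − c(t − s). -/
lemma mul_sub_le_of_pos {S K : ℝ → ℝ} {c s t : ℝ} (hst : s ≤ t)
    (hd : ∀ u ∈ Icc s t, HasDerivAt S (-K u) u)
    (hK : ∀ u ∈ Icc s t, 0 < S u → c ≤ K u) (hne : ∀ u ∈ Icc s t, S u ≠ 0) (hs : 0 < S s) :
    c * (t - s) ≤ S s := by
  have hc : ContinuousOn S (Icc s t) := fun u hu => (hd u hu).continuousAt.continuousWithinAt
  have hpos : ∀ u ∈ Icc s t, 0 < S u := by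
    intro u hu
    by_contra! hle
    obtain ⟨w, hw, hw0⟩ := intermediate_value_Icc' hu.1
      (hc.mono (Icc_subset_Icc_right hu.2)) ⟨hle, hs.le⟩
    exact hne w ⟨hw.1, hw.2.trans hu.2⟩ hw0
  have := (convex_Icc s t).image_sub_le_mul_sub_of_deriv_le hc
    (fun u hu => (hd u (interior_subset hu)).differentiableAt.differentiableWithinAt) (C := -c)
    (fun u hu => by
      rw [(hd u (interior_subset hu)).deriv]
      linarith [hK u (interior_subset hu) (hpos u (interior_subset hu))])
    s ⟨le_rfl, hst⟩ t ⟨hst, le_rfl⟩ hst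
  have h2 := hpos t ⟨hst, le_rfl⟩
  linarith

/-- A function whose absolute value decreases at least at the rate `c`. -/
lemma mul_sub_le_abs {S K : ℝ → ℝ} {U : Set ℝ} (hU : IsOpen U)
    (hUc : ∀ s ∈ U, ∀ t ∈ U, Icc s t ⊆ U) (hd : ∀ u ∈ U, HasDerivAt S (-K u) u) {c : ℝ}
    (hc : 0 < c)
    (hρ : ∀ u ∈ U, ∃ ρ : ℝ, (ρ = 1 ∨ ρ = -1) ∧ c ≤ ρ * K u ∧ 0 ≤ ρ * S u) :
    ∀ s ∈ U, ∀ t ∈ U, s ≤ t → c * (t - s) ≤ |S s| := by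
  have hSK : ∀ u ∈ U, 0 ≤ S u * K u := by
    intro u hu
    obtain ⟨ρ, h0, h1, h2⟩ := hρ u hu
    rcases h0 with rfl | rfl
    · nlinarith
    · nlinarith
  -- Since S and K never have opposite signs, S² does not increase. A zero would therefore persist
  -- and make K vanish shortly afterwards, against c ≤ ρK.
  have hne : ∀ u ∈ U, S u ≠ 0 := by
    intro u hu hu0
    obtain ⟨δ, hδ, hball⟩ := Metric.isOpen_iff.1 hU u hu
    have hsub : Icc u (u + δ / 2) ⊆ U := fun w hw => hball (by
      rw [Metric.mem_ball, Real.dist_eq, abs_lt]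
      constructor <;> linarith [hw.1, hw.2])
    have hanti : AntitoneOn (fun w => S w ^ 2) (Icc u (u + δ / 2)) := by
      refine antitoneOn_of_deriv_nonpos (convex_Icc _ _)
        (fun w hw => ((hd w (hsub hw)).pow 2).continuousAt.continuousWithinAt)
        (fun w hw => ((hd w (hsub (interior_subset hw))).pow 2).differentiableAt.differentiableWithinAt)
        fun w hw => ?_
      have := (hd w (hsub (interior_subset hw))).fun_pow 2
      rw [this.deriv]
      have := hSK w (hsub (interior_subset hw))
      simp only [Nat.cast_ofNat, Nat.add_one_sub_one, pow_one]
      nlinarith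
    have hzero : ∀ w ∈ Icc u (u + δ / 2), S w = 0 := by
      intro w hw
      have := hanti ⟨le_rfl, by linarith⟩ hw hw.1
      simp only [hu0] at this
      nlinarith [sq_nonneg (S w)]
    have hmid : u + δ / 4 ∈ Ioo u (u + δ / 2) := ⟨by linarith, by linarith⟩
    have hmU := hsub (Ioo_subset_Icc_self hmid)
    have h0 : S =ᶠ[𝓝 (u + δ / 4)] fun _ => 0 := by
      filter_upwards [Ioo_mem_nhds hmid.1 hmid.2] with w hw
      exact hzero w (Ioo_subset_Icc_self hw)
    have hK0 := (hd _ hmU).unique ((hasDerivAt_const _ (0 : ℝ)).congr_of_eventuallyEq h0)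
    obtain ⟨ρ, -, h1, -⟩ := hρ _ hmU
    rw [neg_eq_zero.1 hK0, mul_zero] at h1
    linarith
  intro s hs t ht hst
  have hsub := hUc s hs t ht
  rcases lt_or_gt_of_ne (hne s hs) with hneg | hpos
  · rw [abs_of_neg hneg]
    refine mul_sub_le_of_pos (S := fun u => -S u) (K := fun u => -K u) hst
      (fun u hu => (hd u (hsub hu)).fun_neg) (fun u hu hS => ?_)
      (fun u hu => neg_ne_zero.2 (hne u (hsub hu))) (by simpa using hneg)
    obtain ⟨ρ, rfl | rfl, h1, h2⟩ := hρ u (hsub hu)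
    · linarith
    · linarith
  · rw [abs_of_pos hpos]
    refine mul_sub_le_of_pos hst (fun u hu => hd u (hsub hu)) (fun u hu hS => ?_)
      (fun u hu => hne u (hsub hu)) hpos
    obtain ⟨ρ, rfl | rfl, h1, h2⟩ := hρ u (hsub hu)
    · linarith
    · linarith

/-- The ray from an outer point away from the origin avoids Γ and is unbounded. This makes the
enclosed area finite, so its real-valued measure is meaningful. -/
lemma enclosedRegion_subset_closedBall {Γ : Set ℂ} {R : ℝ} (hR0 : 0 ≤ R)
    (hR : ∀ z ∈ Γ, ‖z‖ ≤ R) :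
    enclosedRegion Γ ⊆ Metric.closedBall 0 R := by
  rintro z ⟨hz, hb⟩
  rw [mem_closedBall_zero_iff]
  by_contra! hlt
  have hray : (fun r : ℝ => (r : ℂ) * z) '' Ici 1 ⊆ connectedComponentIn Γᶜ z := by
    refine IsPreconnected.subset_connectedComponentIn ?_ ⟨1, by simp, by simp⟩ ?_
    · exact isPreconnected_Ici.image _ (by fun_prop)
    · rintro _ ⟨r, hr, rfl⟩ hmem
      have h1 := hR _ hmem
      rw [mem_Ici] at hr
      simp only [norm_mul, Complex.norm_real, Real.norm_eq_abs, abs_of_nonneg (zero_le_one.trans hr)]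
        at h1
      nlinarith [norm_nonneg z]
  obtain ⟨B, hB⟩ := isBounded_iff_forall_norm_le.1 hb
  have hz0 : 0 < ‖z‖ := hR0.trans_lt hlt
  have h1 := hB _ (hray ⟨1 + |B| / ‖z‖, by simp [mem_Ici]; positivity, rfl⟩)
  rw [norm_mul, Complex.norm_real, Real.norm_eq_abs, abs_of_nonneg (by positivity), add_mul,
    div_mul_cancel₀ _ hz0.ne'] at h1
  linarith [le_abs_self B]

end CurveNetwork

/-! ### Bounds for the lifetime and for the energy. -/

namespace CurveNetwork

section Flow

variable {Ω : Set ℂ} {T : EReal} {n : ℕ} {v : Fin n × Bool → Option (Fin 2)}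
  {O : ℝ → Fin 2 → ℂ} {γ : ℝ → Fin n → ℝ → ℂ}
  {a : ℤ → Fin n × Bool} {p : ℤ → Fin 2} {m : ℕ}

lemma exists_mem_positiveTimes (hT : 0 < T) : ∃ t, t ∈ positiveTimes T := by
  obtain ⟨t, h0, h1⟩ := EReal.lt_iff_exists_real_btwn.1 hT
  exact ⟨t, EReal.coe_pos.1 h0, h1⟩

/-- The curves converge uniformly to the initial ones. -/
lemma IsCurvatureFlow.eventually_norm_sub_lt (hγ : IsCurvatureFlow Ω T v O γ) (hT : 0 < T)
    {η : ℝ} (hη : 0 < η) :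
    ∀ᶠ s in 𝓝[>] (0 : ℝ), s ∈ positiveTimes T ∧
      ∀ i, ∀ x ∈ Icc (0 : ℝ) 1, ‖γ s i x - γ 0 i x‖ < η := by
  obtain ⟨t, ht0, htT⟩ := exists_mem_positiveTimes hT
  have hK : IsCompact (Icc 0 t ×ˢ Icc (0 : ℝ) 1) := isCompact_Icc.prod isCompact_Icc
  have hsub : Icc 0 t ×ˢ Icc (0 : ℝ) 1 ⊆ {q | 0 ≤ q.1 ∧ (q.1 : EReal) < T ∧ q.2 ∈ Icc (0 : ℝ) 1} :=
    fun q hq => ⟨hq.1.1, (EReal.coe_le_coe_iff.2 hq.1.2).trans_lt htT, hq.2⟩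
  have hev : ∀ i, ∀ᶠ s in 𝓝[>] (0 : ℝ), ∀ x ∈ Icc (0 : ℝ) 1, ‖γ s i x - γ 0 i x‖ < η := by
    intro i
    obtain ⟨δ, hδ, h⟩ := Metric.uniformContinuousOn_iff.1
      (hK.uniformContinuousOn_of_continuous ((hγ.continuousOn i).mono hsub)) η hη
    filter_upwards [Ioo_mem_nhdsGT (lt_min ht0 hδ)] with s hs x hx
    have hs1 := hs.2.trans_le (min_le_left _ _)
    have hs2 := hs.2.trans_le (min_le_right _ _)
    have := h (s, x) ⟨⟨hs.1.le, hs1.le⟩, hx⟩ (0, x) ⟨⟨le_rfl, ht0.le⟩, hx⟩ (by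
      rw [Prod.dist_eq, dist_self, Real.dist_eq, sub_zero, abs_of_pos hs.1]
      exact max_lt hs2 hδ)
    rwa [dist_eq_norm] at this
  filter_upwards [Ioo_mem_nhdsGT ht0, eventually_all.2 hev] with s hs h
  exact ⟨⟨hs.1, (EReal.coe_lt_coe_iff.2 hs.2).trans htT⟩, h⟩

lemma norm_concat_loopArc_sub_lt {σ σ' : Fin n → ℝ → ℂ} {η : ℝ}
    (h : ∀ i, ∀ x ∈ Icc (0 : ℝ) 1, ‖σ' i x - σ i x‖ < η) (u : ℝ) :
    ‖concat (loopArc a σ') u - concat (loopArc a σ) u‖ < η := by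
  have hu : Int.fract u ∈ Icc (0 : ℝ) 1 := ⟨Int.fract_nonneg u, (Int.fract_lt_one u).le⟩
  simp only [concat, loopArc, orient]
  split_ifs
  · exact h _ _ hu
  · exact h _ _ ⟨by linarith [hu.2], by linarith [hu.1]⟩

/-- A point at distance more than η from the initial loop has the same winding number at time `s` as
at time 0; if that is nonzero, the initial loop encloses the point. -/
lemma IsCurvatureFlow.abs_loopArea_le (hγ : IsCurvatureFlow Ω T v O γ)
    (ha : IsLoopCode v a p m) {s : ℝ} (hs : s ∈ positiveTimes T) {η : ℝ}
    (hη : ∀ i, ∀ x ∈ Icc (0 : ℝ) 1, ‖γ s i x - γ 0 i x‖ < η) :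
    |loopArea a m (γ s)| ≤ enclosedArea (range (concat (loopArc a (γ 0)))) +
      volume.real (Metric.cthickening η (range (concat (loopArc a (γ 0))))) := by
  have hT : 0 < T := (EReal.coe_pos.2 hs.1).trans hs.2
  have h0 := ha.isArcLoop (hγ.network 0 le_rfl hT) (hγ.herring 0 le_rfl hT)
  have hm : (0 : ℝ) < m := by exact_mod_cast h0.pos
  set Γ := range (concat (loopArc a (γ 0))) with hΓ
  have hΓb : Bornology.IsBounded Γ := by
    rw [hΓ, h0.range_concat]
    exact (IsCompact.isBounded ((Finset.range m).isCompact_biUnion fun k _ =>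
      isCompact_Icc.image_of_continuousOn (h0.contDiffOn k).continuousOn))
  obtain ⟨R, hR⟩ := isBounded_iff_forall_norm_le.1 hΓb
  have hR0 : 0 ≤ R := (norm_nonneg _).trans (hR _ (mem_range_self 0))
  have hE1 : volume (enclosedRegion Γ) ≠ ⊤ :=
    ((Metric.isBounded_closedBall.subset
      (enclosedRegion_subset_closedBall hR0 hR)).measure_lt_top).ne
  have hE2 : volume (Metric.cthickening η Γ) ≠ ⊤ := hΓb.cthickening.measure_lt_top.ne
  obtain ⟨ρ, hρ, -, hS, hA⟩ := hγ.exists_rotation ha hs.1.le hs.2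
  have habs : |loopArea a m (γ s)| = ρ * loopArea a m (γ s) := by
    rcases hρ with rfl | rfl
    · rw [one_mul] at hS ⊢
      exact abs_of_nonneg hS
    · rw [neg_one_mul] at hS ⊢
      exact abs_of_nonpos (by linarith)
  rw [habs]
  refine (hA (enclosedRegion Γ ∪ Metric.cthickening η Γ)
    (measure_union_lt_top hE1.lt_top hE2.lt_top).ne fun z w hw hw0 => ?_).trans
    (measureReal_union_le _ _)
  by_cases hz : z ∈ Metric.cthickening η Γ
  · exact Or.inr hz
  refine Or.inl ?_
  have hfar : ∀ u, η < ‖concat (loopArc a (γ 0)) u - z‖ := by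
    intro u
    by_contra! hle
    refine hz (Metric.mem_cthickening_of_dist_le z _ η Γ (mem_range_self u) ?_)
    rwa [dist_comm, dist_eq_norm]
  have hη0 : 0 < η := (norm_nonneg _).trans_lt (norm_concat_loopArc_sub_lt (a := a) hη 0)
  obtain ⟨w₀, hw₀⟩ := exists_hasWinding h0.continuous_concat h0.concat_periodic (z := z) fun u hu => by
    have := hfar u
    rw [hu, sub_self, norm_zero] at this
    linarith
  have : w₀ = w := hw₀.eq_of_norm_lt hw fun u => by
    rw [sub_sub_sub_cancel_right]
    exact (norm_concat_loopArc_sub_lt hη u).trans (hfar u)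
  exact hw₀.mem_enclosedRegion hm h0.continuous_concat h0.concat_periodic (this ▸ hw0)

/-- The area enclosed by the loop decreases at least at the rate `(6 - m) π / 3`. -/
theorem IsCurvatureFlow.mul_time_le_enclosedArea (hγ : IsCurvatureFlow Ω T v O γ)
    (ha : IsLoopCode v a p m) (hm6 : (m : ℝ) < 6) {t : ℝ} (ht : t ∈ positiveTimes T) :
    (6 - m) * Real.pi / 3 * t ≤ enclosedArea (range (concat (loopArc a (γ 0)))) := by
  have hT : 0 < T := (EReal.coe_pos.2 ht.1).trans ht.2
  have h0 := ha.isArcLoop (hγ.network 0 le_rfl hT) (hγ.herring 0 le_rfl hT)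
  set Γ := range (concat (loopArc a (γ 0))) with hΓ
  have hΓc : IsCompact Γ := by
    rw [hΓ, h0.range_concat]
    exact (Finset.range m).isCompact_biUnion fun k _ =>
      isCompact_Icc.image_of_continuousOn (h0.contDiffOn k).continuousOn
  have hΓ0 : volume Γ = 0 := by
    rw [hΓ, h0.range_concat]
    exact (measure_biUnion_null_iff (Finset.range m).countable_toSet).2
      fun k _ => volume_image_eq_zero (h0.contDiffOn k)
  have hc : 0 < (6 - m) * Real.pi / 3 :=
    div_pos (mul_pos (by linarith) Real.pi_pos) (by norm_num)
  have hdecay := mul_sub_le_abs (isOpen_positiveTimes T)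
    (fun s hs t ht => Icc_subset_positiveTimes hs ht) (fun u hu => hγ.hasDerivAt_loopArea ha hu) hc
    (fun u hu => by
      obtain ⟨ρ, h1, h2, h3, -⟩ := hγ.exists_rotation ha hu.1.le hu.2
      exact ⟨ρ, h1, h2, h3⟩)
  -- First s → 0 with η fixed, then η → 0: the thickenings shrink to the initial loop, which is
  -- compact and null.
  have hη : ∀ η : ℝ, 0 < η → (6 - m) * Real.pi / 3 * t ≤
      enclosedArea Γ + volume.real (Metric.cthickening η Γ) := by
    intro η hη
    have hlim : Tendsto (fun s : ℝ => (6 - m) * Real.pi / 3 * (t - s)) (𝓝[>] 0)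
        (𝓝 ((6 - m) * Real.pi / 3 * t)) := by
      have : Continuous fun s : ℝ => (6 - (m : ℝ)) * Real.pi / 3 * (t - s) := by fun_prop
      simpa using (this.tendsto 0).mono_left nhdsWithin_le_nhds
    refine le_of_tendsto hlim ?_
    filter_upwards [hγ.eventually_norm_sub_lt hT hη, Ioo_mem_nhdsGT ht.1] with s hs hst
    exact (hdecay s hs.1 t ht hst.2.le).trans (hγ.abs_loopArea_le ha hs.1 hs.2)
  have hlim : Tendsto (fun η => enclosedArea Γ + volume.real (Metric.cthickening η Γ)) (𝓝[>] 0)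
      (𝓝 (enclosedArea Γ + 0)) := by
    refine tendsto_const_nhds.add ?_
    have := (tendsto_measure_cthickening_of_isCompact (μ := volume) hΓc).mono_left
      (nhdsWithin_le_nhds (s := Ioi 0))
    rw [hΓ0] at this
    exact (ENNReal.tendsto_toReal ENNReal.zero_ne_top).comp this
  rw [add_zero] at hlim
  refine ge_of_tendsto hlim ?_
  filter_upwards [self_mem_nhdsWithin] with η h
  exact hη η h

/-- A lower bound for the energy of a network having a loop. -/
theorem IsCurvatureFlow.div_length_le_energy (hγ : IsCurvatureFlow Ω T v O γ)
    (ha : IsLoopCode v a p m) (hm6 : (m : ℝ) ≤ 6) {J : Finset (Fin n)}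
    (hJ : ∀ f : Fin n → ℝ, ∑ i ∈ J, f i = ∑ k ∈ Finset.range m, f (a k).1) {t : ℝ}
    (ht : 0 ≤ t) (htT : (t : EReal) < T) :
    0 < ∑ i ∈ J, length (γ t i) ∧
      (6 - (m : ℝ)) ^ 2 * Real.pi ^ 2 / (9 * ∑ i ∈ J, length (γ t i)) ≤ energy (γ t) := by
  have hnet := hγ.network t ht htT
  obtain ⟨ρ, hρ, hK, -⟩ := hγ.exists_rotation ha ht htT
  have hlen : ∀ i, 0 < length (γ t i) := fun i =>
    length_pos (hnet.contDiffOn i) (hnet.velocity_ne_zero i)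
  have hL : 0 < ∑ i ∈ J, length (γ t i) := by
    rw [hJ]
    exact Finset.sum_pos (fun k _ => hlen _) (Finset.nonempty_range_iff.2 ha.pos.ne')
  refine ⟨hL, ?_⟩
  have hquad : ∀ r : ℝ, 0 ≤ ∑ i ∈ J, curveEnergy (γ t i) - 2 * r * loopCurvature a m (γ t) +
      r ^ 2 * ∑ i ∈ J, length (γ t i) := by
    intro r
    rw [hJ, hJ, loopCurvature, Finset.mul_sum, Finset.mul_sum, ← Finset.sum_sub_distrib,
      ← Finset.sum_add_distrib]
    refine Finset.sum_nonneg fun k _ => ?_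
    -- Reversing an arc changes the sign of its curvature, so `r` carries the sign of the
    -- orientation.
    have := curveEnergy_quadratic_nonneg (hγ.contDiffOn_two (a k).1 ht htT)
      (hnet.velocity_ne_zero _) (r * orientSign (a k).2)
    rw [mul_pow, orientSign_sq, mul_one] at this
    rw [loopArc, totalCurvature_orient]
    linarith
  have hK2 : ((6 - m) * Real.pi / 3) ^ 2 ≤ loopCurvature a m (γ t) ^ 2 := by
    have hρ2 : (ρ * loopCurvature a m (γ t)) ^ 2 = loopCurvature a m (γ t) ^ 2 := by
      rcases hρ with rfl | rfl <;> ring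
    rw [← hρ2]
    exact pow_le_pow_left₀ (div_nonneg (mul_nonneg (by linarith) Real.pi_pos.le) (by norm_num)) hK 2
  have hE : ∑ i ∈ J, curveEnergy (γ t i) ≤ energy (γ t) :=
    Finset.sum_le_sum_of_subset_of_nonneg (Finset.subset_univ J)
      fun i _ _ => curveEnergy_nonneg _
  set L := ∑ i ∈ J, length (γ t i)
  set K := loopCurvature a m (γ t)
  -- The minimizing value, which turns the quadratic inequality into Cauchy–Schwarz.
  have hq := hquad (K / L)
  have h1 : K ^ 2 / L ≤ ∑ i ∈ J, curveEnergy (γ t i) := by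
    have : 2 * (K / L) * K - (K / L) ^ 2 * L = K ^ 2 / L := by
      field_simp
      ring
    linarith
  calc (6 - (m : ℝ)) ^ 2 * Real.pi ^ 2 / (9 * L) = ((6 - m) * Real.pi / 3) ^ 2 / L := by
        field_simp
        ring
    _ ≤ K ^ 2 / L := div_le_div_of_nonneg_right hK2 hL.le
    _ ≤ _ := h1.trans hE

end Flow

end CurveNetwork

end

theorem proposition4p8 (Ω : Set ℂ) (hΩ : IsOpen Ω) (hΩc : Convex ℝ Ω) (T : EReal) (hT : 0 < T)
    (n : ℕ) (v : Fin n × Bool → Option (Fin 2)) (O : ℝ → Fin 2 → ℂ) (γ : ℝ → Fin n → ℝ → ℂ)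
    (hγ : CurveNetwork.IsCurvatureFlow Ω T v O γ)
    (Γ : Set ℂ) (hΓ : CurveNetwork.IsJordanCurve Γ) (hΓS : Γ ⊆ CurveNetwork.support (γ 0)) :
    ∃ J : Finset (Fin n), Γ = (⋃ i ∈ J, γ 0 i '' Set.Icc 0 1) ∧
      (J.card = 1 ∨ J.card = 2) ∧
      ∃ T' : ℝ, T = (T' : EReal) ∧
        T' ≤ 3 * CurveNetwork.enclosedArea Γ / ((6 - (J.card : ℝ)) * Real.pi) ∧
        (∀ t : ℝ, 0 ≤ t → t < T' →
          (6 - (J.card : ℝ)) ^ 2 * Real.pi ^ 2 / (9 * ∑ i ∈ J, CurveNetwork.length (γ t i))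
            ≤ CurveNetwork.energy (γ t)) ∧
        (Filter.Tendsto (fun t : ℝ => ∑ i ∈ J, CurveNetwork.length (γ t i))
            (nhdsWithin T' (Set.Iio T')) (nhds 0) →
          Filter.Tendsto (fun t : ℝ => CurveNetwork.energy (γ t))
            (nhdsWithin T' (Set.Iio T')) Filter.atTop) := by
  obtain ⟨J, a, p, m, hJΓ, ha, hm, hcard, hsum, hΓa⟩ :=
    (hγ.network 0 le_rfl hT).exists_loopCode hΓ hΓS
  have hm6 : (m : ℝ) < 6 := by rcases hm with rfl | rfl <;> norm_num
  have h0 := ha.isArcLoop (hγ.network 0 le_rfl hT) (hγ.herring 0 le_rfl hT)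
  have hc : 0 < (6 - (m : ℝ)) * Real.pi := mul_pos (by linarith) Real.pi_pos
  have hbound : ∀ t ∈ CurveNetwork.positiveTimes T,
      t ≤ 3 * CurveNetwork.enclosedArea Γ / ((6 - (m : ℝ)) * Real.pi) := by
    intro t ht
    have := hγ.mul_time_le_enclosedArea ha hm6 ht
    rw [h0.range_concat, ← hΓa] at this
    rw [le_div_iff₀ hc]
    linarith
  subst hcard
  refine ⟨J, hJΓ, hm, ?_⟩
  induction T with
  | bot => exact absurd hT (by simp)
  | top =>
    -- A positive time beyond the bound, available if T were infinite.
    have := hbound (max 1 (3 * CurveNetwork.enclosedArea Γ / ((6 - (J.card : ℝ)) * Real.pi) + 1))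
      ⟨lt_max_of_lt_left one_pos, EReal.coe_lt_top _⟩
    linarith [le_max_right 1 (3 * CurveNetwork.enclosedArea Γ / ((6 - (J.card : ℝ)) * Real.pi) + 1)]
  | coe T' =>
    have hT' : 0 < T' := EReal.coe_pos.1 hT
    have hE := fun t (ht : 0 ≤ t) (htT : t < T') =>
      hγ.div_length_le_energy ha hm6.le hsum ht (EReal.coe_lt_coe_iff.2 htT)
    refine ⟨T', rfl, ?_, fun t ht htT => (hE t ht htT).2, fun hL => ?_⟩
    · refine le_of_forall_lt_imp_le_of_dense fun s hs => ?_
      -- The maximum with T'/2 keeps the time positive.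
      refine (le_max_left s (T' / 2)).trans (hbound _ ⟨?_, ?_⟩)
      · exact lt_max_of_lt_right (by linarith)
      · exact EReal.coe_lt_coe_iff.2 (max_lt hs (by linarith))
    · have hev : ∀ᶠ t in 𝓝[<] T', t ∈ Ioo 0 T' := Ioo_mem_nhdsLT hT'
      have hL' : Tendsto (fun t : ℝ => ∑ i ∈ J, CurveNetwork.length (γ t i)) (𝓝[<] T')
          (𝓝[>] 0) :=
        tendsto_nhdsWithin_iff.2 ⟨hL, hev.mono fun t ht => (hE t ht.1.le ht.2).1⟩
      have hpos : 0 < (6 - (J.card : ℝ)) ^ 2 * Real.pi ^ 2 / 9 :=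
        div_pos (mul_pos (pow_pos (by linarith) 2) (pow_pos Real.pi_pos 2)) (by norm_num)
      refine tendsto_atTop_mono' _ ?_ ((tendsto_inv_nhdsGT_zero.comp hL').const_mul_atTop hpos)
      filter_upwards [hev] with t ht
      have := (hE t ht.1.le ht.2).2
      rwa [← div_div, div_eq_mul_inv (_ / 9)] at this
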